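/- **Theorem 1.2.** Let $p>q>1$ be coprime integers and put $c=\frac{pq}{2(p-q)}$. Let $C_{p,q}\subset\mathbb C^2$ be the Schoen–Wolfson cone, i.e. the cone $\{s\,\gamma_{p,q}(\theta): s\ge 0,\ 0\le\theta<2\pi\}$ over the curve $\gamma_{p,q}(\theta)=\bigl(\sqrt{\tfrac{q}{p+q}}\,e^{ip\theta},\ i\sqrt{\tfrac{p}{p+q}}\,e^{-iq\theta}\bigr)$ in $S^3$. For $\mu\ge 0$, $0\le\theta<2\pi$ define $$F_t(\mu,\theta)=\sqrt{\tfrac{-t}{c}}\,\bigl(\sqrt q\cosh\mu\, e^{ip\theta},\ i\sqrt p\,\sinh\mu\, e^{-iq\theta}\bigr)\quad (t<0,\ \text{the half-shrinker } S_t),$$ $$F_t(\mu,\theta)=\sqrt{\tfrac{t}{c}}\,\bigl(\sqrt q\sinh\mu\, e^{ip\theta},\ i\sqrt p\,\cosh\mu\, e^{-iq\theta}\bigr)\quad (t>0,\ \text{the half-expander } E_t).$$ These parametrizations, and the parametrization $(s,\theta)\mapsto s\,\gamma_{p,q}(\theta)$ of the cone, are injective off a null set of parameters. Let $V_t$ $(t\neq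 0)$ be the multiplicity one $2$-varifold of the surface $F_t$, let $V_0$ be the multiplicity one $2$-varifold of $C_{p,q}$, and let $\|V_t\|$ be the weight measures. Then these are varifolds (Radon measures on $\mathbb C^2\times G(2,\mathbb C^2)$), and $(V_t)_{-\infty<t<\infty}$ is a Hamiltonian stationary self-similar eternal Brakke motion that resolves $C_{p,q}$: 1. (Brakke motion) For every $t\in\mathbb R$ and every $\phi\in C^1_c(\mathbb C^2)$ with $\phi\ge0$, $$\limsup_{t_1\to t}\frac{\|V_{t_1}\|(\phi)-\|V_t\|(\phi)}{t_1-t}\ \le\ -\int\phi\,|h(V_t)|^2\,d\|V_t\|+\int D\phi\cdot h(V_t)\,d\|V_t\|,$$ where $h(V_t)$ is the generalized mean curvature vector of $V_t$ and the right-hand side is $-\infty$ if the first integral diverges. 2. (No mass loss) Equality holds in 1, and $t\mapsto\|V_t\|(\phi)$ is continuous on $\mathbb R$ for every $\phi\in C_c(\mathbb C^2)$. 3. (Self-similar, Hamiltonian stationary) For $t\ne0$, $F_t$ is a smooth Lagrangian immersion (up to and including $\mu=0$) whose Lagrangian angle is harmonic, and it satisfies $F_t^{\perp}=2c_tH$ for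 a constant $c_t$, where $H$ is the mean curvature vector, with $c_t<0$ (self-shrinker) for $t<0$ and $c_t>0$ (self-expander) for $t>0$. 4. (Convergence) $V_t\to V_0$ as varifolds as $t\to0^-$ and as $t\to0^+$. 5. (No boundary contribution) For $t\neq0$ the boundary circle $\{\mu=0\}$ of $F_t$ contributes nothing to the first variation: for every continuous vector field $W$ on $\mathbb C^2$, $\int_0^{2\pi}W(F_t(0,\theta))\cdot\nu_t(\theta)\,|\partial_\theta F_t(0,\theta)|\,d\theta=0$, where $\nu_t$ is the outer unit conormal along $\mu=0$; and the generalized mean curvature vector of $V_t$ is the usual mean curvature vector of $F_t$, i.e. $\delta V_t(W)=-\int h\cdot W\,d\|V_t\|$ for all compactly supported $C^1$ vector fields $W$, where $h$ is locally $\|V_t\|$-integrable and $h\circ F_t=H$. The corresponding sums of roots of unity vanish: $\sum_{k=0}^{p-1}e^{-2\pi i qk/p}=0$ (for $t<0$) and $\sum_{k=0}^{q-1}e^{2\pi i pk/q}=0$ (for $t>0$). -/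

import Mathlib

open MeasureTheory Filter Topology Set
open scoped ContDiff ENNReal

noncomputable section

section Varifolds

variable {m : ℕ} {E : Type*} [NormedAddCommGroup E] [InnerProductSpace ℝ E]
  [FiniteDimensional ℝ E] [MeasurableSpace E] [BorelSpace E]

/-- An `m`-varifold in the Euclidean space `E`: a Radon measure on `E × G(m, E)`. An `m`-plane is
represented by the orthogonal projection onto it, so `G(m, E)` is a compact subset of
`E →L[ℝ] E`, and the measure is required to be concentrated on `E × G(m, E)`. -/
structure Varifold (m : ℕ) (E : Type*) [NormedAddCommGroup E] [InnerProductSpace ℝ E]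
    [FiniteDimensional ℝ E] [MeasurableSpace E] [BorelSpace E] where
  measure : Measure (E × (E →L[ℝ] E))
  locallyFinite : IsLocallyFiniteMeasure measure
  planes : ∀ᵐ z ∂measure, ∃ K : Submodule ℝ E, Module.finrank ℝ K = m ∧ z.2 = K.starProjection

/-- The weight (mass) measure `‖V‖` on `E`. -/
def Varifold.weight (V : Varifold m E) : Measure E := V.measure.map Prod.fst

/-- `‖V‖(φ) = ∫ φ d‖V‖`. -/
def Varifold.mass (V : Varifold m E) (φ : E → ℝ) : ℝ := ∫ x, φ x ∂V.weight

/-- The first variation `δV(W) = ∫ div_P W(x) dV(x, P)`, where `div_P W = tr (P ∘ DW)`. -/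
def Varifold.firstVariation (V : Varifold m E) (W : E → E) : ℝ :=
  ∫ z, LinearMap.trace ℝ E ((z.2 ∘L fderiv ℝ W z.1 : E →L[ℝ] E) : E →ₗ[ℝ] E) ∂V.measure

/-- `h` is the generalized mean curvature vector of `V`: it is locally integrable and
`δV(W) = -∫ ⟪h, W⟫ d‖V‖` for every compactly supported `C¹` vector field `W`
(so that `δV` has no singular part). -/
def Varifold.IsGeneralizedMeanCurvature (V : Varifold m E) (h : E → E) : Prop :=
  LocallyIntegrable h V.weight ∧
    ∀ W : E → E, ContDiff ℝ 1 W → HasCompactSupport W →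
      V.firstVariation W = -∫ x, inner ℝ (h x) (W x) ∂V.weight

/-- `-∫ φ |h|² d‖V‖ + ∫ Dφ · h d‖V‖` for `φ ≥ 0`; it is `-∞` if the first integral diverges. -/
def Varifold.variationAlong (V : Varifold m E) (φ : E → ℝ) (h : E → E) : EReal :=
  -((∫⁻ x, ENNReal.ofReal (φ x * ‖h x‖ ^ 2) ∂V.weight : ℝ≥0∞) : EReal) +
    ((∫ x, fderiv ℝ φ x (h x) ∂V.weight : ℝ) : EReal)

/-- Brakke's `δ(V, φ)(h(V))`. The generalized mean curvature vector `h(V)` is unique up to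
`‖V‖`-null sets, so the supremum has at most one value to range over; by Brakke's convention
the result is `-∞` if `V` has no generalized mean curvature vector. -/
def Varifold.brakkeVariation (V : Varifold m E) (φ : E → ℝ) : EReal :=
  ⨆ (h : E → E) (_ : V.IsGeneralizedMeanCurvature h), V.variationAlong φ h

/-- The upper derivative `D̄‖V_t‖(φ)` at time `t`. -/
def upperMassDerivative (V : ℝ → Varifold m E) (φ : E → ℝ) (t : ℝ) : EReal :=
  limsup (fun s : ℝ => ((((V s).mass φ - (V t).mass φ) / (s - t) : ℝ) : EReal)) (𝓝[≠] t)

/-- `V_t`, `-∞ < t < ∞`, is a solution of the Brakke motion. -/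
def IsBrakkeMotion (V : ℝ → Varifold m E) : Prop :=
  ∀ t : ℝ, ∀ φ : E → ℝ, ContDiff ℝ 1 φ → HasCompactSupport φ → (∀ x, 0 ≤ φ x) →
    upperMassDerivative V φ t ≤ (V t).brakkeVariation φ

/-- No mass is lost: the weight measures depend continuously on time (as Radon measures) and
equality holds in Brakke's inequality. -/
def HasNoMassLoss (V : ℝ → Varifold m E) : Prop :=
  (∀ φ : E → ℝ, Continuous φ → HasCompactSupport φ → Continuous fun t => (V t).mass φ) ∧
  ∀ t : ℝ, ∀ φ : E → ℝ, ContDiff ℝ 1 φ → HasCompactSupport φ → (∀ x, 0 ≤ φ x) →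
    upperMassDerivative V φ t = (V t).brakkeVariation φ

/-- Convergence of varifolds (as Radon measures on `E × G(m, E)`) along a filter. -/
def VarifoldTendsto (V : ℝ → Varifold m E) (l : Filter ℝ) (V₀ : Varifold m E) : Prop :=
  ∀ f : E × (E →L[ℝ] E) → ℝ, Continuous f → HasCompactSupport f →
    Tendsto (fun t => ∫ z, f z ∂(V t).measure) l (𝓝 (∫ z, f z ∂V₀.measure))

end Varifolds

section Surfaces

/-- `ℂ²` with its Hermitian norm; as a real space it carries the Euclidean inner product. -/
abbrev C2 : Type := EuclideanSpace ℂ (Fin 2)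

/-- The partial derivatives of a function of the two parameters, `i = 0` or `1`. -/
def pd {G : Type*} [NormedAddCommGroup G] [NormedSpace ℝ G] (i : Fin 2) (F : ℝ × ℝ → G)
    (u : ℝ × ℝ) : G :=
  fderiv ℝ F u ((![((1 : ℝ), (0 : ℝ)), ((0 : ℝ), (1 : ℝ))] : Fin 2 → ℝ × ℝ) i)

/-- The induced metric `g_{ij}` of a parametrized surface. -/
def metric (F : ℝ × ℝ → C2) (u : ℝ × ℝ) : Matrix (Fin 2) (Fin 2) ℝ :=
  Matrix.of fun i j => inner ℝ (pd i F u) (pd j F u)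

/-- The area density `√det g`. -/
def areaDensity (F : ℝ × ℝ → C2) (u : ℝ × ℝ) : ℝ := Real.sqrt (metric F u).det

/-- The orthogonal projection of `ℂ²` onto the tangent plane of the surface. -/
def tangentProj (F : ℝ × ℝ → C2) (u : ℝ × ℝ) : C2 →L[ℝ] C2 :=
  (Submodule.span ℝ {pd 0 F u, pd 1 F u}).starProjection

/-- The normal component of a vector. -/
def normalPart (F : ℝ × ℝ → C2) (u : ℝ × ℝ) (v : C2) : C2 := v - tangentProj F u v

/-- The mean curvature vector: the trace of the second fundamental form,
`H = ∑ g^{ij} (∂_i ∂_j F)^⊥`. -/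
def meanCurvature (F : ℝ × ℝ → C2) (u : ℝ × ℝ) : C2 :=
  ∑ i : Fin 2, ∑ j : Fin 2, ((metric F u)⁻¹ i j) • normalPart F u (pd i (pd j F) u)

/-- The Laplace operator of the induced metric,
`Δ_g f = (det g)^{-1/2} ∑ ∂_i ((det g)^{1/2} g^{ij} ∂_j f)`. -/
def laplaceBeltrami (F : ℝ × ℝ → C2) (f : ℝ × ℝ → ℝ) (u : ℝ × ℝ) : ℝ :=
  (areaDensity F u)⁻¹ * ∑ i : Fin 2,
    pd i (fun v => areaDensity F v * ∑ j : Fin 2, (metric F v)⁻¹ i j * pd j f v) u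

/-- The standard symplectic form `∑ dx^k ∧ dy^k`. -/
def sympForm (v w : C2) : ℝ := ∑ k : Fin 2, ((v k).re * (w k).im - (v k).im * (w k).re)

/-- `F` is smooth, and an immersion at the points of `D`. -/
def IsSmoothImmersion (F : ℝ × ℝ → C2) (D : Set (ℝ × ℝ)) : Prop :=
  ContDiff ℝ ∞ F ∧ ∀ u ∈ D, LinearIndependent ℝ ![pd 0 F u, pd 1 F u]

/-- The surface is Lagrangian: the symplectic form restricts to zero. -/
def IsLagrangian (F : ℝ × ℝ → C2) (D : Set (ℝ × ℝ)) : Prop :=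
  IsSmoothImmersion F D ∧ ∀ u ∈ D, sympForm (pd 0 F u) (pd 1 F u) = 0

/-- `β` is a Lagrangian angle: `dz¹ ∧ dz²` restricts to `e^{iβ}` times the area form. -/
def IsLagrangianAngle (F : ℝ × ℝ → C2) (D : Set (ℝ × ℝ)) (β : ℝ × ℝ → ℝ) : Prop :=
  ContDiff ℝ ∞ β ∧ ∀ u ∈ D,
    pd 0 F u 0 * pd 1 F u 1 - pd 0 F u 1 * pd 1 F u 0 =
      Complex.exp (Complex.I * (β u : ℂ)) * (areaDensity F u : ℂ)

/-- A Lagrangian surface is Hamiltonian stationary if its Lagrangian angle is harmonic. -/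
def IsHamiltonianStationary (F : ℝ × ℝ → C2) (D : Set (ℝ × ℝ)) : Prop :=
  IsLagrangian F D ∧ ∃ β : ℝ × ℝ → ℝ, IsLagrangianAngle F D β ∧
    ∀ u ∈ D, laplaceBeltrami F β u = 0

/-- `F^⊥ = 2 c H`. -/
def IsSelfSimilar (F : ℝ × ℝ → C2) (D : Set (ℝ × ℝ)) (c : ℝ) : Prop :=
  ∀ u ∈ D, normalPart F u (F u) = (2 * c) • meanCurvature F u

def IsSelfShrinker (F : ℝ × ℝ → C2) (D : Set (ℝ × ℝ)) : Prop := ∃ c < 0, IsSelfSimilar F D c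

def IsSelfExpander (F : ℝ × ℝ → C2) (D : Set (ℝ × ℝ)) : Prop := ∃ c > 0, IsSelfSimilar F D c

/-- The image, in `ℂ² × G(2, ℂ²)`, of the area measure of the surface `F` over `D` under
`u ↦ (F u, T_u F)`. -/
def surfaceMeasure (F : ℝ × ℝ → C2) (D : Set (ℝ × ℝ)) : Measure (C2 × (C2 →L[ℝ] C2)) :=
  ((volume.restrict D).withDensity fun u => ENNReal.ofReal (areaDensity F u)).map
    fun u => (F u, tangentProj F u)

/-- `V` is the (multiplicity one) varifold of the surface parametrized by `F` over `D`, the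
parametrization being injective off a null set of parameters. -/
def IsVarifoldOf (V : Varifold 2 C2) (F : ℝ × ℝ → C2) (D : Set (ℝ × ℝ)) : Prop :=
  (∃ N : Set (ℝ × ℝ), volume N = 0 ∧ InjOn F (D \ N)) ∧ V.measure = surfaceMeasure F D

/-- `V_t` is a Hamiltonian stationary self-similar eternal Brakke motion, whose time slices for
`t ≠ 0` are the surfaces `F_t` over the parameter domain `D`. -/
structure IsHamStatSelfSimilarEternalBrakkeMotion (V : ℝ → Varifold 2 C2)
    (F : ℝ → ℝ × ℝ → C2) (D : Set (ℝ × ℝ)) : Prop where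
  brakke : IsBrakkeMotion V
  noMassLoss : HasNoMassLoss V
  slices : ∀ t ≠ 0, IsVarifoldOf (V t) (F t) D
  shrinker : ∀ t < 0, IsHamiltonianStationary (F t) D ∧ IsSelfShrinker (F t) D
  expander : ∀ t > 0, IsHamiltonianStationary (F t) D ∧ IsSelfExpander (F t) D

/-- The component of `∂F/∂μ` orthogonal to `∂F/∂θ`, at a boundary point `(0, θ)` of a surface
parametrized over `μ ≥ 0`. -/
def innerConormal (F : ℝ × ℝ → C2) (θ : ℝ) : C2 :=
  pd 0 F (0, θ) - (Submodule.span ℝ {pd 1 F (0, θ)}).starProjection (pd 0 F (0, θ))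

/-- The outer unit conormal at the boundary point `(0, θ)`. -/
def outerConormal (F : ℝ × ℝ → C2) (θ : ℝ) : C2 :=
  -(‖innerConormal F θ‖⁻¹ • innerConormal F θ)

/-- The contribution `∫ ⟪W, ν⟫ ds` of the boundary `{μ = 0}` to the first variation of a surface
parametrized over `μ ≥ 0`, `0 ≤ θ < 2π`. -/
def boundaryVariation (F : ℝ × ℝ → C2) (W : C2 → C2) : ℝ :=
  ∫ θ in (0 : ℝ)..2 * Real.pi,
    inner ℝ (W (F (0, θ))) (outerConormal F θ) * ‖pd 1 F (0, θ)‖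

end Surfaces

section Examples

/-- The parameters `μ ≥ 0`, `0 ≤ θ < 2π`. -/
def halfStrip : Set (ℝ × ℝ) := Ici 0 ×ˢ Ico 0 (2 * Real.pi)

/-- The Schoen–Wolfson curve `γ_{pq}` in the unit sphere. -/
def swCurve (p q : ℕ) (θ : ℝ) : C2 :=
  !₂[(√((q : ℝ) / (p + q)) : ℂ) * Complex.exp (Complex.I * p * θ),
    Complex.I * (√((p : ℝ) / (p + q)) : ℂ) * Complex.exp (-(Complex.I * q * θ))]

/-- The Schoen–Wolfson cone `C_{pq}`, the cone over `γ_{pq}`, parametrized over `halfStrip`. -/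
def swCone (p q : ℕ) (u : ℝ × ℝ) : C2 := u.1 • swCurve p q u.2

/-- The constant `c = pq / (2 (p - q))`. -/
def swConst (p q : ℕ) : ℝ := (p : ℝ) * q / (2 * ((p : ℝ) - q))

/-- The shrinker `S_t(μ, θ)`, `t < 0`. -/
def shrinker (p q : ℕ) (t : ℝ) (u : ℝ × ℝ) : C2 :=
  √(-t / swConst p q) •
    !₂[(Real.cosh u.1 * √(q : ℝ) : ℂ) * Complex.exp (Complex.I * p * u.2),
      Complex.I * (Real.sinh u.1 * √(p : ℝ) : ℂ) * Complex.exp (-(Complex.I * q * u.2))]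

/-- The expander `E_t(μ, θ)`, `t > 0`. -/
def expander (p q : ℕ) (t : ℝ) (u : ℝ × ℝ) : C2 :=
  √(t / swConst p q) •
    !₂[(Real.sinh u.1 * √(q : ℝ) : ℂ) * Complex.exp (Complex.I * p * u.2),
      Complex.I * (Real.cosh u.1 * √(p : ℝ) : ℂ) * Complex.exp (-(Complex.I * q * u.2))]

/-- `S_t` for `t < 0` and `E_t` for `t > 0`. -/
def swFlow (p q : ℕ) (t : ℝ) : ℝ × ℝ → C2 :=
  if t < 0 then shrinker p q t else expander p q t

end Examples

end

noncomputable section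

/-! A slice is a rotation surface `pos p q f g θ` over a branch of the hyperbola f² − g² = −t/c. In
the parameter μ with f' = g, g' = f, the weights √q and √p make (μ, √(pq) θ) conformal with factor E
= p f² + q g² (`energy`). The mean curvature vector is therefore E⁻¹ times the flat Laplacian of the
position, which in the rotating frame is (p − q)E⁻¹(−f/q, g/p). This depends on the point of ℂ² and
not on t, so one vector field `curvatureField` serves every slice, the cone included. The hyperbola
equation turns it into F^⊥ = 2tH (`pos_sub_planeProj_pos`). The Lagrangian angle is (p − q)θ, linear
in a conformal coordinate, hence harmonic.

To pass through t = 0, all slices are parametrized over one strip by s = √(|t|/c) sinh μ. With k =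
√(s² + |t|/c) (`flowSpeed`), the area density is √(pq) E/k ≤ C k and the position is O(k). Since
|h|² is a constant over E, density times |h| is bounded uniformly in t, while density times |h|² is
exactly a constant over k. For fixed s > 0 these quantities are continuous in t, so dominated
convergence gives varifold convergence and continuity of the masses.

For the first variation, `divergence_eq` writes density times divergence as an s-derivative plus a
θ-derivative minus density times h · W. The only boundary term sits on the circle s = 0. There a
rotation of θ by 2π/q (or 2π/p) fixes the point but multiplies the conormal by a root of unity,
which is not 1 because p and q are coprime and greater than 1. The boundary integral equals a
nontrivial multiple of itself and vanishes (`integral_inner_radial_eq_zero`).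

For t ≠ 0, slices with times of the same sign are dilations of each other. Differentiating the mass
in the dilation factor and testing the first variation with φ(x)x gives Brakke's equality
(`dilation_eq_massRate`, `hasDerivAt_mass`). At t = 0 the mean value theorem replaces difference
quotients by rates at nearby nonzero times, and `tendsto_massRate_zero` finds their limit. If φ(0) =
0, then φ = O(k) along the slices compensates 1/k. If φ(0) > 0, the divergence of ∫ ds/s makes both
sides −∞. -/

namespace SchoenWolfson

/-! ### Moving frames on `ℂ²` -/

/-- The vector with coordinates `α, β` in the frame `(e^{ipθ}, 0)`, `(0, i e^{-iqθ})`. -/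
def frame (p q : ℕ) (θ : ℝ) (α β : ℂ) : C2 :=
  !₂[α * Complex.exp (Complex.I * p * θ), Complex.I * β * Complex.exp (-(Complex.I * q * θ))]

/-- The point `(√q f e^{ipθ}, i √p g e^{-iqθ})` of the rotation surface with profile `(f, g)`. -/
def pos (p q : ℕ) (f g θ : ℝ) : C2 := frame p q θ (√(q : ℝ) * f : ℝ) (√(p : ℝ) * g : ℝ)

/-- The direction of the profile curve `f' = g`, `g' = f`. -/
def radial (p q : ℕ) (f g θ : ℝ) : C2 := pos p q g f θ

/-- The `θ`-derivative of `pos`. -/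
def angular (p q : ℕ) (f g θ : ℝ) : C2 :=
  frame p q θ (Complex.I * p * (√(q : ℝ) * f : ℝ)) (-(Complex.I * q * (√(p : ℝ) * g : ℝ)))

/-- The squared length of `radial`. -/
def energy (p q : ℕ) (f g : ℝ) : ℝ := p * f ^ 2 + q * g ^ 2

/-- The orthogonal projection onto the span of `radial` and `angular`. -/
def planeProj (p q : ℕ) (f g θ : ℝ) : C2 →L[ℝ] C2 :=
  (energy p q f g)⁻¹ •
    ((innerSL ℝ (radial p q f g θ)).smulRight (radial p q f g θ) +
      ((p : ℝ) * q)⁻¹ • (innerSL ℝ (angular p q f g θ)).smulRight (angular p q f g θ))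

/-- The common mean curvature vector field of all the time slices. -/
def curvatureField (p q : ℕ) (z : C2) : C2 :=
  (((p : ℝ) - q) * (p * ‖z 0‖ ^ 2 / q + q * ‖z 1‖ ^ 2 / p)⁻¹) •
    !₂[-(((q : ℝ)⁻¹ : ℝ) * z 0), (((p : ℝ)⁻¹ : ℝ) * z 1)]

section Frame

variable (p q : ℕ) (θ : ℝ)

lemma norm_exp_pos : ‖Complex.exp (Complex.I * p * θ)‖ = 1 := by
  rw [Complex.norm_exp]; simp

lemma norm_exp_neg : ‖Complex.exp (-(Complex.I * q * θ))‖ = 1 := by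
  rw [Complex.norm_exp]; simp

@[simp] lemma frame_apply_zero (α β : ℂ) :
    frame p q θ α β 0 = α * Complex.exp (Complex.I * p * θ) := rfl

@[simp] lemma frame_apply_one (α β : ℂ) :
    frame p q θ α β 1 = Complex.I * β * Complex.exp (-(Complex.I * q * θ)) := rfl

lemma C2_ext {v w : C2} (h0 : v 0 = w 0) (h1 : v 1 = w 1) : v = w := by
  ext i; fin_cases i
  · exact h0
  · exact h1

lemma frame_add (α β α' β' : ℂ) :
    frame p q θ α β + frame p q θ α' β' = frame p q θ (α + α') (β + β') := by
  apply C2_ext <;> simp <;> ring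

lemma frame_sub (α β α' β' : ℂ) :
    frame p q θ α β - frame p q θ α' β' = frame p q θ (α - α') (β - β') := by
  apply C2_ext <;> simp <;> ring

lemma smul_frame (r : ℝ) (α β : ℂ) :
    r • frame p q θ α β = frame p q θ (r * α) (r * β) := by
  apply C2_ext <;> simp <;> ring

lemma inner_frame (α β α' β' : ℂ) :
    inner ℝ (frame p q θ α β) (frame p q θ α' β') =
      (α' * (starRingEnd ℂ) α).re + (β' * (starRingEnd ℂ) β).re := by
  have h1 : Complex.exp (Complex.I * p * θ) * (starRingEnd ℂ) (Complex.exp (Complex.I * p * θ))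
      = 1 := by
    rw [Complex.mul_conj, Complex.normSq_eq_norm_sq, norm_exp_pos]; simp
  have h2 : Complex.exp (-(Complex.I * q * θ)) *
      (starRingEnd ℂ) (Complex.exp (-(Complex.I * q * θ))) = 1 := by
    rw [Complex.mul_conj, Complex.normSq_eq_norm_sq, norm_exp_neg]; simp
  have h3 : Complex.I * (starRingEnd ℂ) Complex.I = 1 := by simp
  rw [PiLp.inner_apply, Fin.sum_univ_two, Complex.inner, Complex.inner]
  simp only [frame_apply_zero, frame_apply_one, map_mul]
  congr 2
  · linear_combination (α' * (starRingEnd ℂ) α) * h1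
  · linear_combination (β' * (starRingEnd ℂ) β) * h2 * (Complex.I * (starRingEnd ℂ) Complex.I) +
      (β' * (starRingEnd ℂ) β) * h3

lemma inner_frame_ofReal (α β α' β' : ℝ) :
    inner ℝ (frame p q θ α β) (frame p q θ α' β') = α * α' + β * β' := by
  rw [inner_frame]; simp; ring

variable {p q θ}

lemma hasDerivAt_C2 {F : ℝ → C2} {v : C2} {r : ℝ} (h0 : HasDerivAt (fun x => F x 0) (v 0) r)
    (h1 : HasDerivAt (fun x => F x 1) (v 1) r) : HasDerivAt F v r := by
  rw [hasDerivAt_iff_hasFDerivAt, ← hasFDerivWithinAt_univ, hasFDerivWithinAt_piLp]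
  intro i
  rw [hasFDerivWithinAt_univ]
  fin_cases i
  · exact h0.hasFDerivAt.congr_fderiv (by ext; simp)
  · exact h1.hasFDerivAt.congr_fderiv (by ext; simp)

lemma hasDerivAt_frame {α β : ℝ → ℂ} {α' β' : ℂ} {r : ℝ} (hα : HasDerivAt α α' r)
    (hβ : HasDerivAt β β' r) :
    HasDerivAt (fun x => frame p q θ (α x) (β x)) (frame p q θ α' β') r := by
  apply hasDerivAt_C2
  · exact hα.mul_const _
  · exact (hβ.const_mul _).mul_const _

lemma hasDerivAt_frame_angle (p q : ℕ) (θ : ℝ) (α β : ℂ) :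
    HasDerivAt (fun x => frame p q x α β)
      (frame p q θ (Complex.I * p * α) (-(Complex.I * q * β))) θ := by
  have hx : HasDerivAt (fun x : ℝ => (x : ℂ)) 1 θ := Complex.ofRealCLM.hasDerivAt
  apply hasDerivAt_C2
  · have := ((hx.const_mul (Complex.I * p)).cexp).const_mul α
    refine this.congr_deriv ?_
    simp only [frame_apply_zero]; ring
  · have h := (((hx.const_mul (-(Complex.I * q)))).cexp).const_mul (Complex.I * β)
    simp only [neg_mul] at h
    refine h.congr_deriv ?_
    simp only [frame_apply_one]; ring

lemma continuous_frame (p q : ℕ) :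
    Continuous fun x : ℝ × ℂ × ℂ => frame p q x.1 x.2.1 x.2.2 := by
  refine (PiLp.continuous_toLp 2 _).comp (continuous_pi fun i => ?_)
  fin_cases i <;> simp <;> fun_prop

lemma contDiff_frame {E : Type*} [NormedAddCommGroup E] [NormedSpace ℝ E] {θ : E → ℝ}
    {α β : E → ℂ} (hθ : ContDiff ℝ ∞ θ) (hα : ContDiff ℝ ∞ α) (hβ : ContDiff ℝ ∞ β) :
    ContDiff ℝ ∞ fun x => frame p q (θ x) (α x) (β x) := by
  rw [contDiff_piLp]
  have h : ContDiff ℝ ∞ fun x => ((θ x : ℝ) : ℂ) := Complex.ofRealCLM.contDiff.comp hθ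
  intro i; fin_cases i
  · exact hα.mul ((contDiff_const.mul h).cexp)
  · exact (contDiff_const.mul hβ).mul ((contDiff_const.mul h).neg.cexp)

end Frame

/-! ### Geometry of one tangent plane: conformality, curvature vector, self-similarity. -/

section Plane

variable {p q : ℕ} (f g θ : ℝ)

lemma energy_pos (hp : 0 < p) (hq : 0 < q) (h : f ≠ 0 ∨ g ≠ 0) : 0 < energy p q f g := by
  have hp' : (0 : ℝ) < p := by exact_mod_cast hp
  have hq' : (0 : ℝ) < q := by exact_mod_cast hq
  unfold energy
  rcases h with h | h <;> positivity

lemma inner_radial_radial : inner ℝ (radial p q f g θ) (radial p q f g θ) = energy p q f g := by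
  have h1 := Real.mul_self_sqrt (Nat.cast_nonneg (α := ℝ) p)
  have h2 := Real.mul_self_sqrt (Nat.cast_nonneg (α := ℝ) q)
  unfold radial pos energy
  rw [inner_frame_ofReal]
  linear_combination g ^ 2 * h2 + f ^ 2 * h1

/-- Together with `inner_radial_radial` and `inner_radial_angular` this is conformality of (μ, √(pq)
θ): the weights √q, √p in `pos` make both squared lengths multiples of the same function. -/
lemma inner_angular_angular :
    inner ℝ (angular p q f g θ) (angular p q f g θ) = p * q * energy p q f g := by
  have h1 := Real.mul_self_sqrt (Nat.cast_nonneg (α := ℝ) p)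
  have h2 := Real.mul_self_sqrt (Nat.cast_nonneg (α := ℝ) q)
  unfold angular energy
  rw [inner_frame]
  simp
  linear_combination p ^ 2 * f ^ 2 * h2 + q ^ 2 * g ^ 2 * h1

lemma inner_radial_angular : inner ℝ (radial p q f g θ) (angular p q f g θ) = 0 := by
  unfold radial pos angular
  rw [inner_frame]
  simp

lemma inner_pos_angular : inner ℝ (pos p q f g θ) (angular p q f g θ) = 0 := by
  unfold pos angular
  rw [inner_frame]
  simp

lemma inner_pos_radial : inner ℝ (pos p q f g θ) (radial p q f g θ) = (p + q) * f * g := by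
  have h1 := Real.mul_self_sqrt (Nat.cast_nonneg (α := ℝ) p)
  have h2 := Real.mul_self_sqrt (Nat.cast_nonneg (α := ℝ) q)
  unfold radial pos
  rw [inner_frame_ofReal]
  linear_combination f * g * h2 + f * g * h1

lemma norm_sq_pos : ‖pos p q f g θ‖ ^ 2 = q * f ^ 2 + p * g ^ 2 := by
  have h1 := Real.mul_self_sqrt (Nat.cast_nonneg (α := ℝ) p)
  have h2 := Real.mul_self_sqrt (Nat.cast_nonneg (α := ℝ) q)
  rw [← real_inner_self_eq_norm_sq]
  unfold pos
  rw [inner_frame_ofReal]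
  linear_combination f ^ 2 * h2 + g ^ 2 * h1

lemma planeProj_apply (v : C2) : planeProj p q f g θ v =
    (energy p q f g)⁻¹ • (inner ℝ (radial p q f g θ) v • radial p q f g θ +
      ((p : ℝ) * q)⁻¹ • inner ℝ (angular p q f g θ) v • angular p q f g θ) := by
  simp [planeProj]

lemma starProjection_span_pair {a b : C2} (ha : a ≠ 0) (hb : b ≠ 0) (hab : inner ℝ a b = 0)
    (v : C2) : (Submodule.span ℝ {a, b}).starProjection v =
      ((inner ℝ a a)⁻¹ * inner ℝ a v) • a + ((inner ℝ b b)⁻¹ * inner ℝ b v) • b := by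
  have ha' : inner ℝ a a ≠ 0 := by simpa using ha
  have hb' : inner ℝ b b ≠ 0 := by simpa using hb
  have hba : inner ℝ b a = 0 := by rw [real_inner_comm]; exact hab
  apply Submodule.eq_starProjection_of_mem_of_inner_eq_zero
  · exact Submodule.mem_span_pair.2 ⟨_, _, rfl⟩
  · intro w hw
    obtain ⟨x, y, rfl⟩ := Submodule.mem_span_pair.1 hw
    simp only [inner_sub_left, inner_add_left, inner_add_right, inner_smul_left, inner_smul_right,
      hab, hba, real_inner_comm a v, real_inner_comm b v, map_mul, conj_trivial]
    field_simp
    ring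

variable {f g}

/-- The free factor `l` serves the cone, whose radial derivative is only a multiple of `radial`. -/
lemma planeProj_eq_starProjection (hp : 0 < p) (hq : 0 < q) (h : energy p q f g ≠ 0) {l : ℝ}
    (hl : l ≠ 0) : planeProj p q f g θ =
      (Submodule.span ℝ {l • radial p q f g θ, angular p q f g θ}).starProjection := by
  have hp' : (p : ℝ) ≠ 0 := by exact_mod_cast hp.ne'
  have hq' : (q : ℝ) ≠ 0 := by exact_mod_cast hq.ne'
  have hr : radial p q f g θ ≠ 0 := fun h0 => h (by
    rw [← inner_radial_radial f g θ, h0, inner_zero_left])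
  have ha : angular p q f g θ ≠ 0 := fun h0 => by
    have := inner_angular_angular (p := p) (q := q) f g θ
    rw [h0, inner_zero_left] at this
    exact mul_ne_zero (mul_ne_zero hp' hq') h this.symm
  ext1 v
  rw [starProjection_span_pair (smul_ne_zero hl hr) ha
    (by rw [inner_smul_left, inner_radial_angular, mul_zero]), planeProj_apply]
  simp only [inner_smul_left, inner_smul_right, inner_radial_radial, inner_angular_angular,
    smul_add, smul_smul, conj_trivial]
  congr 2 <;> field_simp

lemma linearIndependent_radial_angular (hp : 0 < p) (hq : 0 < q) (h : energy p q f g ≠ 0) {l : ℝ}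
    (hl : l ≠ 0) : LinearIndependent ℝ ![l • radial p q f g θ, angular p q f g θ] := by
  have hp' : (p : ℝ) ≠ 0 := by exact_mod_cast hp.ne'
  have hq' : (q : ℝ) ≠ 0 := by exact_mod_cast hq.ne'
  rw [LinearIndependent.pair_iff]
  intro s t hst
  have h1 := congrArg (fun v => inner ℝ (radial p q f g θ) v) hst
  have h2 := congrArg (fun v => inner ℝ (angular p q f g θ) v) hst
  simp only [inner_add_right, inner_smul_right, inner_radial_radial, inner_radial_angular,
    inner_angular_angular, real_inner_comm (radial p q f g θ) (angular p q f g θ),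
    inner_zero_right, mul_zero, add_zero, zero_add] at h1 h2
  simp_all

lemma curvatureField_frame (α β : ℂ) :
    curvatureField p q (frame p q θ α β) =
      (((p : ℝ) - q) * (p * ‖α‖ ^ 2 / q + q * ‖β‖ ^ 2 / p)⁻¹) •
        frame p q θ (-((q : ℝ)⁻¹ * α)) ((p : ℝ)⁻¹ * β) := by
  unfold curvatureField
  simp only [frame_apply_zero, frame_apply_one, norm_mul, norm_exp_pos, norm_exp_neg,
    Complex.norm_I, mul_one, one_mul]
  congr 1
  apply C2_ext <;> simp <;> ring

lemma curvatureField_pos (hp : 0 < p) (hq : 0 < q) :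
    curvatureField p q (pos p q f g θ) =
      (((p : ℝ) - q) * (energy p q f g)⁻¹) • pos p q (-(f / q)) (g / p) θ := by
  have hp' : (p : ℝ) ≠ 0 := by exact_mod_cast hp.ne'
  have hq' : (q : ℝ) ≠ 0 := by exact_mod_cast hq.ne'
  unfold pos
  rw [curvatureField_frame]
  congr 1
  · congr 2
    simp only [Complex.norm_real, Real.norm_eq_abs, sq_abs, mul_pow,
      Real.sq_sqrt (Nat.cast_nonneg _), energy]
    field_simp
  · congr 1 <;> push_cast <;> ring

/-- Against `radial` the two coordinates contribute −fg and fg. Against `angular` the product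
vanishes because real frame coordinates meet purely imaginary ones. -/
lemma planeProj_curvatureField (hp : 0 < p) (hq : 0 < q) :
    planeProj p q f g θ (curvatureField p q (pos p q f g θ)) = 0 := by
  have hp' : (p : ℝ) ≠ 0 := by exact_mod_cast hp.ne'
  have hq' : (q : ℝ) ≠ 0 := by exact_mod_cast hq.ne'
  have h1 := Real.mul_self_sqrt (Nat.cast_nonneg (α := ℝ) p)
  have h2 := Real.mul_self_sqrt (Nat.cast_nonneg (α := ℝ) q)
  have e1 : inner ℝ (radial p q f g θ) (pos p q (-(f / q)) (g / p) θ) = 0 := by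
    unfold radial pos
    rw [inner_frame_ofReal]
    field_simp
    rw [pow_two, pow_two, h1, h2]
    ring
  have e2 : inner ℝ (angular p q f g θ) (pos p q (-(f / q)) (g / p) θ) = 0 := by
    unfold angular pos
    rw [inner_frame]
    simp
  rw [curvatureField_pos θ hp hq, planeProj_apply, inner_smul_right, inner_smul_right, e1, e2]
  simp

/-- The hyperbolas `f² - g² = -t / c` are self-similar: the normal part of the position vector is
`2 t` times the mean curvature vector. -/
lemma pos_sub_planeProj_pos (hq : 0 < q) (hqp : q < p) (h : energy p q f g ≠ 0) {t : ℝ}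
    (hfg : f ^ 2 - g ^ 2 = -t / swConst p q) :
    pos p q f g θ - planeProj p q f g θ (pos p q f g θ) =
      (2 * t) • curvatureField p q (pos p q f g θ) := by
  have hp : 0 < p := hq.trans hqp
  have hp' : (p : ℝ) ≠ 0 := by exact_mod_cast hp.ne'
  have hq' : (q : ℝ) ≠ 0 := by exact_mod_cast hq.ne'
  have hpq : (p : ℝ) - q ≠ 0 := sub_ne_zero.2 (by exact_mod_cast hqp.ne')
  -- With c = pq / (2(p − q)) inserted, the hyperbola equation becomes the one relation to which
  -- both frame coordinates reduce.
  have ht : (f ^ 2 - g ^ 2) * (p * q) = -(2 * t * (p - q)) := by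
    rw [hfg, swConst]; field_simp
  rw [curvatureField_pos θ hp hq, planeProj_apply, real_inner_comm, inner_pos_radial,
    real_inner_comm, inner_pos_angular]
  unfold radial pos
  simp only [zero_smul, smul_zero, add_zero, smul_frame, frame_sub]
  have hE : energy p q f g = p * f ^ 2 + q * g ^ 2 := rfl
  congr 1
  · simp only [← Complex.ofReal_mul, ← Complex.ofReal_sub]
    congr 1
    field_simp
    rw [hE]
    linear_combination f * ht
  · simp only [← Complex.ofReal_mul, ← Complex.ofReal_sub]
    congr 1
    field_simp
    rw [hE]
    linear_combination (-g) * ht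

lemma hasDerivAt_pos_angle : HasDerivAt (fun x => pos p q f g x) (angular p q f g θ) θ :=
  hasDerivAt_frame_angle p q θ _ _

lemma hasDerivAt_angular_angle : HasDerivAt (fun x => angular p q f g x)
    (-pos p q (p ^ 2 * f) (q ^ 2 * g) θ) θ := by
  refine (hasDerivAt_frame_angle p q θ _ _).congr_deriv ?_
  rw [← neg_one_smul ℝ (pos _ _ _ _ _), pos, smul_frame]
  congr 1 <;> push_cast
  · linear_combination (p ^ 2 * (√(q : ℝ) * f) : ℂ) * Complex.I_mul_I
  · linear_combination (q ^ 2 * (√(p : ℝ) * g) : ℂ) * Complex.I_mul_I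

lemma hasDerivAt_pos {F G : ℝ → ℝ} {F' G' r : ℝ} (hF : HasDerivAt F F' r)
    (hG : HasDerivAt G G' r) :
    HasDerivAt (fun x => pos p q (F x) (G x) θ) (pos p q F' G' θ) r :=
  hasDerivAt_frame (hF.const_mul _).ofReal_comp (hG.const_mul _).ofReal_comp

lemma smul_pos (r : ℝ) : r • pos p q f g θ = pos p q (r * f) (r * g) θ := by
  unfold pos; rw [smul_frame]; congr 1 <;> push_cast <;> ring

lemma pos_add (f' g' : ℝ) : pos p q f g θ + pos p q f' g' θ = pos p q (f + f') (g + g') θ := by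
  unfold pos; rw [frame_add]; congr 1 <;> push_cast <;> ring

/-- The tension of the rotation surface in conformal coordinates. -/
lemma pos_add_angular_deriv (hp : 0 < p) (hq : 0 < q) (h : energy p q f g ≠ 0) :
    pos p q f g θ + ((p : ℝ) * q)⁻¹ • -pos p q (p ^ 2 * f) (q ^ 2 * g) θ =
      energy p q f g • curvatureField p q (pos p q f g θ) := by
  have hp' : (p : ℝ) ≠ 0 := by exact_mod_cast hp.ne'
  have hq' : (q : ℝ) ≠ 0 := by exact_mod_cast hq.ne'
  rw [curvatureField_pos θ hp hq, smul_neg, ← neg_smul, smul_pos, pos_add, smul_pos, smul_pos]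
  congr 1 <;> field_simp <;> ring

end Plane

/-! ### Rotation surfaces over a profile curve -/

section Surface

lemma pd_zero_eq {G : Type*} [NormedAddCommGroup G] [NormedSpace ℝ G] {F : ℝ × ℝ → G}
    {u : ℝ × ℝ} {v : G} (hF : DifferentiableAt ℝ F u)
    (h : HasDerivAt (fun r => F (r, u.2)) v u.1) : pd 0 F u = v := by
  have h1 : HasDerivAt (fun r : ℝ => (r, u.2)) ((1 : ℝ), (0 : ℝ)) u.1 :=
    (hasDerivAt_id _).prodMk (hasDerivAt_const _ _)
  exact (HasFDerivAt.comp_hasDerivAt u.1 (f := fun r : ℝ => (r, u.2)) hF.hasFDerivAt h1).unique h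

lemma pd_one_eq {G : Type*} [NormedAddCommGroup G] [NormedSpace ℝ G] {F : ℝ × ℝ → G}
    {u : ℝ × ℝ} {v : G} (hF : DifferentiableAt ℝ F u)
    (h : HasDerivAt (fun r => F (u.1, r)) v u.2) : pd 1 F u = v := by
  have h1 : HasDerivAt (fun r : ℝ => (u.1, r)) ((0 : ℝ), (1 : ℝ)) u.2 :=
    (hasDerivAt_const _ _).prodMk (hasDerivAt_id _)
  exact (HasFDerivAt.comp_hasDerivAt u.2 (f := fun r : ℝ => (u.1, r)) hF.hasFDerivAt h1).unique h

variable {p q : ℕ} {F : ℝ × ℝ → C2} {u : ℝ × ℝ} {f g l θ : ℝ}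

lemma areaDensity_eq (hl : 0 ≤ l) (h0 : pd 0 F u = l • radial p q f g θ)
    (h1 : pd 1 F u = angular p q f g θ) :
    areaDensity F u = l * √((p : ℝ) * q) * energy p q f g := by
  have hD : 0 ≤ energy p q f g := by unfold energy; positivity
  have : (metric F u).det = (l * energy p q f g) ^ 2 * (p * q) := by
    rw [Matrix.det_fin_two]
    simp only [metric, Matrix.of_apply, h0, h1, inner_smul_left, inner_smul_right,
      inner_radial_radial, inner_angular_angular, inner_radial_angular, conj_trivial]
    ring
  rw [areaDensity, this, Real.sqrt_mul (sq_nonneg _), Real.sqrt_sq (mul_nonneg hl hD)]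
  ring

lemma tangentProj_eq (hp : 0 < p) (hq : 0 < q) (hD : energy p q f g ≠ 0) (hl : l ≠ 0)
    (h0 : pd 0 F u = l • radial p q f g θ) (h1 : pd 1 F u = angular p q f g θ) :
    tangentProj F u = planeProj p q f g θ := by
  simp only [tangentProj, h0, h1, planeProj_eq_starProjection θ hp hq hD hl]

end Surface

/-- The rotation surface over the profile curve `(f, g)`. -/
def profileSurface (p q : ℕ) (f g : ℝ → ℝ) (u : ℝ × ℝ) : C2 := pos p q (f u.1) (g u.1) u.2

/-- A nowhere vanishing solution of `f' = g`, `g' = f`. -/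
structure IsHyperbolicProfile (f g : ℝ → ℝ) : Prop where
  smooth : ContDiff ℝ ∞ f
  smooth' : ContDiff ℝ ∞ g
  deriv : ∀ r, HasDerivAt f (g r) r
  deriv' : ∀ r, HasDerivAt g (f r) r
  ne_zero : ∀ r, f r ≠ 0 ∨ g r ≠ 0

namespace IsHyperbolicProfile

variable {p q : ℕ} {f g : ℝ → ℝ} (H : IsHyperbolicProfile f g)

include H

lemma symm : IsHyperbolicProfile g f :=
  ⟨H.smooth', H.smooth, H.deriv', H.deriv, fun r => (H.ne_zero r).symm⟩

lemma contDiff_profileSurface : ContDiff ℝ ∞ (profileSurface p q f g) := by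
  refine contDiff_frame contDiff_snd ?_ ?_
  · exact Complex.ofRealCLM.contDiff.comp (contDiff_const.mul (H.smooth.comp contDiff_fst))
  · exact Complex.ofRealCLM.contDiff.comp (contDiff_const.mul (H.smooth'.comp contDiff_fst))

lemma differentiable_profileSurface : Differentiable ℝ (profileSurface p q f g) :=
  H.contDiff_profileSurface.differentiable (by simp)

lemma differentiable_angular :
    Differentiable ℝ fun u : ℝ × ℝ => angular p q (f u.1) (g u.1) u.2 := by
  refine (contDiff_frame contDiff_snd ?_ ?_).differentiable (by simp)
  · exact contDiff_const.mul
      (Complex.ofRealCLM.contDiff.comp (contDiff_const.mul (H.smooth.comp contDiff_fst)))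
  · exact (contDiff_const.mul
      (Complex.ofRealCLM.contDiff.comp (contDiff_const.mul (H.smooth'.comp contDiff_fst)))).neg

lemma pd_zero : pd 0 (profileSurface p q f g) = profileSurface p q g f := by
  ext1 u
  exact pd_zero_eq (H.differentiable_profileSurface u)
    (hasDerivAt_pos u.2 (H.deriv u.1) (H.deriv' u.1))

lemma pd_one :
    pd 1 (profileSurface p q f g) = fun u : ℝ × ℝ => angular p q (f u.1) (g u.1) u.2 := by
  ext1 u
  exact pd_one_eq (H.differentiable_profileSurface u) (hasDerivAt_pos_angle (f := f u.1) (g := g u.1) u.2)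

lemma pd_zero' (u : ℝ × ℝ) :
    pd 0 (profileSurface p q f g) u = (1 : ℝ) • radial p q (f u.1) (g u.1) u.2 := by
  rw [H.pd_zero, one_smul]; rfl

lemma pd_one' (u : ℝ × ℝ) :
    pd 1 (profileSurface p q f g) u = angular p q (f u.1) (g u.1) u.2 := by
  rw [H.pd_one]

lemma pd_zero_pd_zero : pd 0 (pd 0 (profileSurface p q f g)) = profileSurface p q f g := by
  rw [H.pd_zero, H.symm.pd_zero]

lemma pd_one_pd_one (u : ℝ × ℝ) : pd 1 (pd 1 (profileSurface p q f g)) u =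
    -pos p q (p ^ 2 * f u.1) (q ^ 2 * g u.1) u.2 := by
  rw [H.pd_one]
  exact pd_one_eq (H.differentiable_angular u) (hasDerivAt_angular_angle (f := f u.1) (g := g u.1) u.2)

lemma energy_ne_zero (hp : 0 < p) (hq : 0 < q) (r : ℝ) : energy p q (f r) (g r) ≠ 0 :=
  (energy_pos _ _ hp hq (H.ne_zero r)).ne'

lemma metric_eq (u : ℝ × ℝ) : metric (profileSurface p q f g) u =
    Matrix.diagonal ![energy p q (f u.1) (g u.1), p * q * energy p q (f u.1) (g u.1)] := by
  have h1 := inner_radial_radial (p := p) (q := q) (f u.1) (g u.1) u.2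
  have h2 := inner_angular_angular (p := p) (q := q) (f u.1) (g u.1) u.2
  rw [real_inner_self_eq_norm_sq] at h1 h2
  ext i j
  fin_cases i <;> fin_cases j <;>
    simp [metric, H.pd_zero', H.pd_one', h1, h2, inner_radial_angular,
      real_inner_comm (radial p q _ _ _) (angular p q _ _ _)]

lemma metric_inv (hp : 0 < p) (hq : 0 < q) (u : ℝ × ℝ) : (metric (profileSurface p q f g) u)⁻¹ =
    Matrix.diagonal ![(energy p q (f u.1) (g u.1))⁻¹,
      ((p : ℝ) * q)⁻¹ * (energy p q (f u.1) (g u.1))⁻¹] := by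
  have hp' : (p : ℝ) ≠ 0 := by exact_mod_cast hp.ne'
  have hq' : (q : ℝ) ≠ 0 := by exact_mod_cast hq.ne'
  have hD := H.energy_ne_zero hp hq u.1
  apply Matrix.inv_eq_right_inv
  rw [H.metric_eq, Matrix.diagonal_mul_diagonal, ← Matrix.diagonal_one]
  congr 1
  ext i
  fin_cases i <;> simp <;> field_simp

lemma areaDensity_eq (u : ℝ × ℝ) : areaDensity (profileSurface p q f g) u =
    √((p : ℝ) * q) * energy p q (f u.1) (g u.1) := by
  rw [SchoenWolfson.areaDensity_eq zero_le_one (H.pd_zero' u) (H.pd_one' u), one_mul]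

lemma tangentProj_eq (hp : 0 < p) (hq : 0 < q) (u : ℝ × ℝ) :
    tangentProj (profileSurface p q f g) u = planeProj p q (f u.1) (g u.1) u.2 :=
  SchoenWolfson.tangentProj_eq hp hq (H.energy_ne_zero hp hq u.1) one_ne_zero (H.pd_zero' u)
    (H.pd_one' u)

/-- In conformal coordinates the trace of the second derivatives is E times `curvatureField`, by
`pos_add_angular_deriv`. It is already normal, so the tangential parts subtracted in the definition
cancel in the sum. -/
lemma meanCurvature_eq (hp : 0 < p) (hq : 0 < q) (u : ℝ × ℝ) :
    meanCurvature (profileSurface p q f g) u = curvatureField p q (profileSurface p q f g u) := by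
  have hD := H.energy_ne_zero hp hq u.1
  have key := pos_add_angular_deriv u.2 hp hq hD
  have hn := planeProj_curvatureField (f := f u.1) (g := g u.1) u.2 hp hq
  have key' := congrArg (planeProj p q (f u.1) (g u.1) u.2) key
  rw [map_smul, hn, smul_zero, map_add, map_smul] at key'
  simp only [meanCurvature, Fin.sum_univ_two, H.metric_inv hp hq, Matrix.diagonal_apply_eq,
    Matrix.diagonal_apply_ne _ (zero_ne_one' (Fin 2)), H.pd_zero_pd_zero, H.pd_one_pd_one,
    Matrix.diagonal_apply_ne _ (zero_ne_one' (Fin 2)).symm, zero_smul, add_zero, zero_add,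
    normalPart, H.tangentProj_eq hp hq, Matrix.cons_val_zero, Matrix.cons_val_one]
  have : curvatureField p q (pos p q (f u.1) (g u.1) u.2) =
      (energy p q (f u.1) (g u.1))⁻¹ • (energy p q (f u.1) (g u.1) •
        curvatureField p q (pos p q (f u.1) (g u.1) u.2)) := by
    rw [smul_smul, inv_mul_cancel₀ hD, one_smul]
  rw [profileSurface, this, ← key, mul_comm ((p : ℝ) * q)⁻¹, mul_smul, ← smul_add]
  congr 1
  rw [smul_sub, sub_add_sub_comm, key', sub_zero]

lemma isSelfSimilar (hq : 0 < q) (hqp : q < p) {t : ℝ}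
    (hfg : ∀ r, f r ^ 2 - g r ^ 2 = -t / swConst p q) (D : Set (ℝ × ℝ)) :
    IsSelfSimilar (profileSurface p q f g) D t := by
  have hp := hq.trans hqp
  intro u _
  rw [H.meanCurvature_eq hp hq, normalPart, H.tangentProj_eq hp hq]
  exact pos_sub_planeProj_pos u.2 hq hqp (H.energy_ne_zero hp hq _) (hfg _)

/-- The two coordinates rotate in opposite directions, so their contributions pqfg and −pqfg to the
symplectic form cancel. -/
lemma isLagrangian (hp : 0 < p) (hq : 0 < q) (D : Set (ℝ × ℝ)) :
    IsLagrangian (profileSurface p q f g) D := by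
  refine ⟨⟨H.contDiff_profileSurface, fun u _ => ?_⟩, fun u _ => ?_⟩
  · rw [H.pd_zero', H.pd_one']
    exact linearIndependent_radial_angular u.2 hp hq (H.energy_ne_zero hp hq _) one_ne_zero
  · have hs : ∀ v w : C2, sympForm v w = ((starRingEnd ℂ) (v 0) * w 0).im +
        ((starRingEnd ℂ) (v 1) * w 1).im := by
      intro v w
      simp [sympForm, Fin.sum_univ_two]
      ring
    have h1 : (starRingEnd ℂ) (Complex.exp (Complex.I * p * u.2)) *
        Complex.exp (Complex.I * p * u.2) = 1 := by
      rw [mul_comm, Complex.mul_conj, Complex.normSq_eq_norm_sq, norm_exp_pos]; simp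
    have h2 : (starRingEnd ℂ) (Complex.exp (-(Complex.I * q * u.2))) *
        Complex.exp (-(Complex.I * q * u.2)) = 1 := by
      rw [mul_comm, Complex.mul_conj, Complex.normSq_eq_norm_sq, norm_exp_neg]; simp
    have h3 := Real.mul_self_sqrt (Nat.cast_nonneg (α := ℝ) p)
    have h4 := Real.mul_self_sqrt (Nat.cast_nonneg (α := ℝ) q)
    rw [H.pd_zero', H.pd_one', one_smul, hs]
    have e0 : (starRingEnd ℂ) (radial p q (f u.1) (g u.1) u.2 0) *
        angular p q (f u.1) (g u.1) u.2 0 = Complex.I * ((p * q * f u.1 * g u.1 : ℝ) : ℂ) := by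
      simp only [radial, pos, angular, frame_apply_zero, map_mul, Complex.conj_ofReal]
      have h4' : ((√(q : ℝ) : ℝ) : ℂ) * (√(q : ℝ) : ℝ) = (q : ℂ) := by exact_mod_cast h4
      push_cast
      linear_combination (√(q : ℝ) : ℂ) * (√(q : ℝ) : ℂ) * Complex.I * p * f u.1 * g u.1 * h1
        + Complex.I * p * f u.1 * g u.1 * h4'
    have e1 : (starRingEnd ℂ) (radial p q (f u.1) (g u.1) u.2 1) *
        angular p q (f u.1) (g u.1) u.2 1 = -(Complex.I * ((p * q * f u.1 * g u.1 : ℝ) : ℂ)) := by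
      simp only [radial, pos, angular, frame_apply_one, map_mul, Complex.conj_ofReal,
        Complex.conj_I]
      have h3' : ((√(p : ℝ) : ℝ) : ℂ) * (√(p : ℝ) : ℝ) = (p : ℂ) := by exact_mod_cast h3
      push_cast
      linear_combination (√(p : ℝ) : ℂ) * (√(p : ℝ) : ℂ) * Complex.I ^ 3 * q * f u.1 * g u.1 * h2
        + Complex.I ^ 3 * q * f u.1 * g u.1 * h3'
        + Complex.I * p * q * f u.1 * g u.1 * Complex.I_sq
    rw [e0, e1, Complex.neg_im, add_neg_cancel]

/-- The angle is (p − q)θ, read off from the phases e^{ipθ} and e^{−iqθ}. Conformality makes √det g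
· g^{θθ} constant, so a function linear in θ is harmonic. -/
lemma isHamiltonianStationary (hp : 0 < p) (hq : 0 < q) (D : Set (ℝ × ℝ)) :
    IsHamiltonianStationary (profileSurface p q f g) D := by
  refine ⟨H.isLagrangian hp hq D, fun u => ((p : ℝ) - q) * u.2, ⟨?_, fun u _ => ?_⟩, fun u _ => ?_⟩
  · exact contDiff_const.mul contDiff_snd
  · have h5 : ((√((p : ℝ) * q) : ℝ) : ℂ) = (√(p : ℝ) : ℝ) * (√(q : ℝ) : ℝ) := by
      rw [Real.sqrt_mul (Nat.cast_nonneg _)]; push_cast; rfl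
    have h6 : Complex.exp (Complex.I * ((((p : ℝ) - q) * u.2 : ℝ) : ℂ)) =
        Complex.exp (Complex.I * p * u.2) * Complex.exp (-(Complex.I * q * u.2)) := by
      rw [← Complex.exp_add]; congr 1; push_cast; ring
    rw [H.pd_zero', H.pd_one', H.areaDensity_eq, one_smul, h6, Complex.ofReal_mul, h5]
    simp only [radial, pos, angular, frame_apply_zero, frame_apply_one, energy]
    push_cast
    linear_combination (-(Complex.exp (Complex.I * p * u.2) *
      Complex.exp (-(Complex.I * q * u.2)) * √(p : ℝ) * √(q : ℝ) *
        (q * g u.1 ^ 2 + p * f u.1 ^ 2))) * Complex.I_sq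
  · have hp' : (p : ℝ) ≠ 0 := by exact_mod_cast hp.ne'
    have hq' : (q : ℝ) ≠ 0 := by exact_mod_cast hq.ne'
    have b0 : ∀ v, pd 0 (fun u : ℝ × ℝ => ((p : ℝ) - q) * u.2) v = 0 := fun v =>
      pd_zero_eq (by fun_prop) (hasDerivAt_const v.1 (((p : ℝ) - q) * v.2))
    have b1 : ∀ v, pd 1 (fun u : ℝ × ℝ => ((p : ℝ) - q) * u.2) v = (p : ℝ) - q := fun v =>
      pd_one_eq (by fun_prop) (by simpa using (hasDerivAt_id v.2).const_mul ((p : ℝ) - q))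
    have hc : ∀ (c : ℝ) (i : Fin 2) (v : ℝ × ℝ), pd i (fun _ => c) v = 0 := by
      intro c i v; simp [pd]
    have c0 : (fun v => areaDensity (profileSurface p q f g) v * ∑ j : Fin 2,
        (metric (profileSurface p q f g) v)⁻¹ 0 j *
          pd j (fun u : ℝ × ℝ => ((p : ℝ) - q) * u.2) v) = fun _ => 0 := by
      ext v
      simp [H.metric_inv hp hq, Fin.sum_univ_two, b0]
    have c1 : (fun v => areaDensity (profileSurface p q f g) v * ∑ j : Fin 2,
        (metric (profileSurface p q f g) v)⁻¹ 1 j *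
          pd j (fun u : ℝ × ℝ => ((p : ℝ) - q) * u.2) v) =
        fun _ => √((p : ℝ) * q) * ((p : ℝ) * q)⁻¹ * ((p : ℝ) - q) := by
      ext v
      have hD := H.energy_ne_zero hp hq v.1
      simp only [H.metric_inv hp hq, Fin.sum_univ_two, b1, H.areaDensity_eq,
        Matrix.diagonal_apply_ne _ (zero_ne_one' (Fin 2)).symm, Matrix.diagonal_apply_eq,
        Matrix.cons_val_one]
      simp
      field_simp
    rw [laplaceBeltrami, Fin.sum_univ_two, c0, c1, hc, hc]
    simp

end IsHyperbolicProfile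

/-! ### Cancellation along the boundary circles -/

section Boundary

variable {p q : ℕ}

lemma exp_two_pi_div_ne_one {m n : ℕ} (hn : 1 < n) (hmn : Nat.Coprime m n) :
    Complex.exp (2 * Real.pi * Complex.I * m / n) ≠ 1 := by
  have hn' : (n : ℂ) ≠ 0 := by exact_mod_cast (by omega : n ≠ 0)
  intro h
  obtain ⟨k, hk⟩ := Complex.exp_eq_one_iff.1 h
  have h2 : (m : ℂ) = k * n := by
    have := Complex.two_pi_I_ne_zero
    field_simp at hk
    apply mul_left_cancel₀ this
    linear_combination (2 * Real.pi * Complex.I) * hk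
  have h3 : (m : ℤ) = k * n := by exact_mod_cast h2
  have h4 : n ∣ m := Int.natCast_dvd_natCast.1 ⟨k, by rw [h3, mul_comm]⟩
  have := Nat.Coprime.eq_one_of_dvd hmn.symm h4
  omega

lemma sum_exp_two_pi_mul_div {m n : ℕ} (hn : 1 < n) (hmn : Nat.Coprime m n) :
    ∑ k ∈ Finset.range n, Complex.exp (2 * Real.pi * Complex.I * m * k / n) = 0 := by
  have hn' : (n : ℂ) ≠ 0 := by exact_mod_cast (by omega : n ≠ 0)
  have h : ∀ k : ℕ, Complex.exp (2 * Real.pi * Complex.I * m * k / n) =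
      Complex.exp (2 * Real.pi * Complex.I * m / n) ^ k := by
    intro k; rw [← Complex.exp_nat_mul]; congr 1; ring
  simp only [h]
  rw [geom_sum_eq (exp_two_pi_div_ne_one hn hmn), ← h]
  have : Complex.exp (2 * Real.pi * Complex.I * m * n / n) = 1 := by
    rw [mul_div_assoc, div_self hn', mul_one, mul_comm]
    exact Complex.exp_nat_mul_two_pi_mul_I m
  rw [this, sub_self, zero_div]

/-- A shift does not change the integral over a full period, yet here it multiplies it by w ≠ 1. -/
lemma integral_eq_zero_of_add_eq_mul {G : ℝ → ℂ} (hG : Function.Periodic G (2 * Real.pi))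
    {s : ℝ} {w : ℂ} (hw : w ≠ 1) (h : ∀ θ, G (θ + s) = w * G θ) :
    ∫ θ in (0 : ℝ)..2 * Real.pi, G θ = 0 := by
  have h1 : ∫ θ in (0 : ℝ)..2 * Real.pi, G (θ + s) = ∫ θ in (0 : ℝ)..2 * Real.pi, G θ := by
    rw [intervalIntegral.integral_comp_add_right, zero_add, add_comm (2 * Real.pi) s,
      hG.intervalIntegral_add_eq s 0, zero_add]
  simp only [h, intervalIntegral.integral_const_mul] at h1
  have h2 : (w - 1) * ∫ θ in (0 : ℝ)..2 * Real.pi, G θ = 0 := by rw [sub_mul, h1]; ring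
  exact (mul_eq_zero.1 h2).resolve_left (sub_ne_zero.2 hw)

lemma exp_I_mul_add (m : ℕ) (θ s : ℝ) : Complex.exp (Complex.I * m * ((θ + s : ℝ) : ℂ)) =
    Complex.exp (Complex.I * m * s) * Complex.exp (Complex.I * m * θ) := by
  rw [← Complex.exp_add]; congr 1; push_cast; ring

lemma exp_neg_I_mul_add (m : ℕ) (θ s : ℝ) : Complex.exp (-(Complex.I * m * ((θ + s : ℝ) : ℂ))) =
    Complex.exp (-(Complex.I * m * s)) * Complex.exp (-(Complex.I * m * θ)) := by
  rw [← Complex.exp_add]; congr 1; push_cast; ring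

lemma exp_I_mul_two_pi (m : ℕ) : Complex.exp (Complex.I * m * ((2 * Real.pi : ℝ) : ℂ)) = 1 := by
  rw [← Complex.exp_nat_mul_two_pi_mul_I m]; congr 1; push_cast; ring

lemma exp_neg_I_mul_two_pi (m : ℕ) :
    Complex.exp (-(Complex.I * m * ((2 * Real.pi : ℝ) : ℂ))) = 1 := by
  rw [Complex.exp_neg, exp_I_mul_two_pi, inv_one]

lemma frame_add_two_pi (θ : ℝ) (α β : ℂ) :
    frame p q (θ + 2 * Real.pi) α β = frame p q θ α β := by
  apply C2_ext
  · rw [frame_apply_zero, frame_apply_zero, exp_I_mul_add, exp_I_mul_two_pi, one_mul]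
  · rw [frame_apply_one, frame_apply_one, exp_neg_I_mul_add, exp_neg_I_mul_two_pi, one_mul]

lemma continuous_pos (p q : ℕ) : Continuous fun x : ℝ × ℝ × ℝ => pos p q x.1 x.2.1 x.2.2 :=
  (continuous_frame p q).comp (f := fun x : ℝ × ℝ × ℝ =>
    (x.2.2, ((√(q : ℝ) * x.1 : ℝ) : ℂ), ((√(p : ℝ) * x.2.1 : ℝ) : ℂ))) (by fun_prop)

/-- The conormals of the sheets of the surface along a multiply covered boundary circle cancel. -/
lemma integral_inner_radial_eq_zero (hq : 1 < q) (hqp : q < p) (hpq : Nat.Coprime p q)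
    {f g : ℝ} (hfg : f * g = 0) {W : C2 → C2} (hW : Continuous W) :
    ∫ θ in (0 : ℝ)..2 * Real.pi, inner ℝ (W (pos p q f g θ)) (radial p q f g θ) = 0 := by
  have hcont : Continuous fun θ => pos p q f g θ :=
    (continuous_pos p q).comp (f := fun θ => (f, g, θ)) (by fun_prop)
  have hcont' : Continuous fun θ => radial p q f g θ :=
    (continuous_pos p q).comp (f := fun θ => (g, f, θ)) (by fun_prop)
  have hper : ∀ (θ α β : ℝ), pos p q α β (θ + 2 * Real.pi) = pos p q α β θ := fun θ α β =>
    frame_add_two_pi θ _ _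
  -- The coordinate products are kept complex: a shift of θ multiplies them by a root of unity,
  -- which their real parts alone would not show.
  let G : Fin 2 → ℝ → ℂ := fun i θ =>
    radial p q f g θ i * (starRingEnd ℂ) (W (pos p q f g θ) i)
  have hG : ∀ i, Function.Periodic (G i) (2 * Real.pi) := by
    intro i θ
    simp only [G, radial, hper]
  have hGc : ∀ i, Continuous (G i) := by
    intro i
    have h1 : Continuous fun θ => W (pos p q f g θ) i :=
      (PiLp.continuous_apply 2 _ i).comp (hW.comp hcont)
    exact ((PiLp.continuous_apply 2 _ i).comp hcont').mul (Complex.continuous_conj.comp h1)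
  have hp0 : (p : ℂ) ≠ 0 := by exact_mod_cast (by omega : p ≠ 0)
  have hq0 : (q : ℂ) ≠ 0 := by exact_mod_cast (by omega : q ≠ 0)
  have hzero : ∀ i, ∫ θ in (0 : ℝ)..2 * Real.pi, G i θ = 0 := by
    rcases mul_eq_zero.1 hfg with rfl | rfl
    -- For f = 0 the point has period 2π/q in θ, so W is unchanged under the shift, while the
    -- conormal is multiplied by e^{2πip/q}.
    · have hinv : ∀ θ, pos p q 0 g (θ + 2 * Real.pi / q) = pos p q 0 g θ := by
        intro θ
        have e : Complex.exp (-(Complex.I * q * ((2 * Real.pi / q : ℝ) : ℂ))) = 1 := by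
          rw [← exp_neg_I_mul_two_pi 1]; congr 1; push_cast; field_simp
        apply C2_ext
        · simp [pos]
        · rw [pos, pos, frame_apply_one, frame_apply_one, exp_neg_I_mul_add, e, one_mul]
      rw [Fin.forall_fin_two]
      constructor
      · refine integral_eq_zero_of_add_eq_mul (hG 0) (s := 2 * Real.pi / q)
          (exp_two_pi_div_ne_one hq hpq) fun θ => ?_
        simp only [G, hinv]
        generalize W (pos p q 0 g θ) = z
        simp only [radial, pos, frame_apply_zero]
        have e : Complex.exp (Complex.I * p * ((2 * Real.pi / q : ℝ) : ℂ)) =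
            Complex.exp (2 * Real.pi * Complex.I * p / q) := by
          congr 1; push_cast; ring
        rw [exp_I_mul_add, e]
        ring
      · have : G 1 = fun _ => 0 := by
          ext θ; simp [G, radial, pos]
        simp [this]
    -- For g = 0 the period is 2π/p. The second coordinate rotates backwards, so the conormal is
    -- multiplied by the inverse of e^{2πiq/p}.
    · have hinv : ∀ θ, pos p q f 0 (θ + 2 * Real.pi / p) = pos p q f 0 θ := by
        intro θ
        have e : Complex.exp (Complex.I * p * ((2 * Real.pi / p : ℝ) : ℂ)) = 1 := by
          rw [← exp_I_mul_two_pi 1]; congr 1; push_cast; field_simp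
        apply C2_ext
        · rw [pos, pos, frame_apply_zero, frame_apply_zero, exp_I_mul_add, e, one_mul]
        · simp [pos]
      rw [Fin.forall_fin_two]
      constructor
      · have : G 0 = fun _ => 0 := by
          ext θ; simp [G, radial, pos]
        simp [this]
      · have hne := inv_ne_one.2 (exp_two_pi_div_ne_one (hq.trans hqp) hpq.symm)
        rw [← Complex.exp_neg] at hne
        refine integral_eq_zero_of_add_eq_mul (hG 1) (s := 2 * Real.pi / p) hne fun θ => ?_
        simp only [G, hinv]
        generalize W (pos p q f 0 θ) = z
        simp only [radial, pos, frame_apply_one]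
        have e : Complex.exp (-(Complex.I * q * ((2 * Real.pi / p : ℝ) : ℂ))) =
            Complex.exp (-(2 * Real.pi * Complex.I * q / p)) := by
          congr 1; push_cast; ring
        rw [exp_neg_I_mul_add, e]
        ring
  have hsplit : ∀ θ, inner ℝ (W (pos p q f g θ)) (radial p q f g θ) =
      Complex.reCLM (G 0 θ + G 1 θ) := by
    intro θ
    rw [PiLp.inner_apply, Fin.sum_univ_two, Complex.inner, Complex.inner, map_add]
    rfl
  simp only [hsplit]
  rw [Complex.reCLM.intervalIntegral_comp_comm (f := fun θ => G 0 θ + G 1 θ)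
    (((hGc 0).add (hGc 1)).intervalIntegrable _ _),
    intervalIntegral.integral_add ((hGc 0).intervalIntegrable _ _)
      ((hGc 1).intervalIntegrable _ _), hzero, hzero]
  simp

/-- The outer conormal at μ = 0 is −`radial` normalized, and both lengths in the integrand are
independent of θ, so they come out of the integral as a constant. -/
lemma IsHyperbolicProfile.boundaryVariation_eq_zero {f g : ℝ → ℝ} (H : IsHyperbolicProfile f g)
    (hq : 1 < q) (hqp : q < p) (hpq : Nat.Coprime p q) (hfg : f 0 * g 0 = 0)
    {W : C2 → C2} (hW : Continuous W) : boundaryVariation (profileSurface p q f g) W = 0 := by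
  have hin : ∀ θ, innerConormal (profileSurface p q f g) θ = radial p q (f 0) (g 0) θ := by
    intro θ
    rw [innerConormal, Submodule.starProjection_singleton, H.pd_zero', H.pd_one', one_smul,
      real_inner_comm, inner_radial_angular]
    simp
  have hn : ∀ θ, ‖radial p q (f 0) (g 0) θ‖ = √(energy p q (f 0) (g 0)) := by
    intro θ
    rw [← inner_radial_radial (f 0) (g 0) θ, real_inner_self_eq_norm_sq,
      Real.sqrt_sq (norm_nonneg _)]
  have ha : ∀ θ, ‖angular p q (f 0) (g 0) θ‖ = √(p * q * energy p q (f 0) (g 0)) := by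
    intro θ
    rw [← inner_angular_angular (f 0) (g 0) θ, real_inner_self_eq_norm_sq,
      Real.sqrt_sq (norm_nonneg _)]
  have : ∀ θ, inner ℝ (W (profileSurface p q f g (0, θ)))
        (outerConormal (profileSurface p q f g) θ) * ‖pd 1 (profileSurface p q f g) (0, θ)‖ =
      (-(√(energy p q (f 0) (g 0)))⁻¹ * √(p * q * energy p q (f 0) (g 0))) *
        inner ℝ (W (pos p q (f 0) (g 0) θ)) (radial p q (f 0) (g 0) θ) := by
    intro θ
    rw [outerConormal, hin, hn, H.pd_one', ha, inner_neg_right, inner_smul_right, profileSurface]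
    ring
  rw [boundaryVariation]
  simp only [this]
  rw [intervalIntegral.integral_const_mul,
    integral_inner_radial_eq_zero hq hqp hpq hfg hW, mul_zero]

end Boundary

/-! ### The profiles of the flow -/

section Flow

variable {p q : ℕ}

lemma swConst_pos (hq : 0 < q) (hqp : q < p) : 0 < swConst p q := by
  have hp' : (0 : ℝ) < p := by exact_mod_cast hq.trans hqp
  have hq' : (0 : ℝ) < q := by exact_mod_cast hq
  have : (0 : ℝ) < (p : ℝ) - q := sub_pos.2 (by exact_mod_cast hqp)
  unfold swConst
  positivity

/-- The profile of the time slice at time `t`, in the conformal parameter. -/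
def hypFst (p q : ℕ) (t μ : ℝ) : ℝ :=
  if t < 0 then √(-t / swConst p q) * Real.cosh μ else √(t / swConst p q) * Real.sinh μ

/-- The profile of the time slice at time `t`, in the conformal parameter. -/
def hypSnd (p q : ℕ) (t μ : ℝ) : ℝ :=
  if t < 0 then √(-t / swConst p q) * Real.sinh μ else √(t / swConst p q) * Real.cosh μ

lemma hypFst_of_neg {t : ℝ} (ht : t < 0) (μ : ℝ) :
    hypFst p q t μ = √(-t / swConst p q) * Real.cosh μ := if_pos ht

lemma hypSnd_of_neg {t : ℝ} (ht : t < 0) (μ : ℝ) :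
    hypSnd p q t μ = √(-t / swConst p q) * Real.sinh μ := if_pos ht

lemma hypFst_of_nonneg {t : ℝ} (ht : 0 ≤ t) (μ : ℝ) :
    hypFst p q t μ = √(t / swConst p q) * Real.sinh μ := if_neg ht.not_gt

lemma hypSnd_of_nonneg {t : ℝ} (ht : 0 ≤ t) (μ : ℝ) :
    hypSnd p q t μ = √(t / swConst p q) * Real.cosh μ := if_neg ht.not_gt

lemma swFlow_eq (t : ℝ) :
    swFlow p q t = profileSurface p q (hypFst p q t) (hypSnd p q t) := by
  ext1 u
  rcases lt_or_ge t 0 with ht | ht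
  · rw [swFlow, if_pos ht, profileSurface, hypFst_of_neg ht, hypSnd_of_neg ht, shrinker]
    apply C2_ext <;> simp [pos] <;> ring
  · rw [swFlow, if_neg ht.not_gt, profileSurface, hypFst_of_nonneg ht, hypSnd_of_nonneg ht,
      expander]
    apply C2_ext <;> simp [pos] <;> ring

lemma isHyperbolicProfile_cosh_sinh {a : ℝ} (ha : a ≠ 0) :
    IsHyperbolicProfile (fun μ => a * Real.cosh μ) fun μ => a * Real.sinh μ where
  smooth := contDiff_const.mul Real.contDiff_cosh
  smooth' := contDiff_const.mul Real.contDiff_sinh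
  deriv r := (Real.hasDerivAt_cosh r).const_mul a
  deriv' r := (Real.hasDerivAt_sinh r).const_mul a
  ne_zero r := Or.inl (mul_ne_zero ha (Real.cosh_pos r).ne')

lemma isHyperbolicProfile_hyp (hq : 0 < q) (hqp : q < p) {t : ℝ} (ht : t ≠ 0) :
    IsHyperbolicProfile (hypFst p q t) (hypSnd p q t) := by
  have hc := swConst_pos hq hqp
  rcases lt_or_gt_of_ne ht with h | h
  · have e1 : hypFst p q t = _ := funext (hypFst_of_neg h)
    have e2 : hypSnd p q t = _ := funext (hypSnd_of_neg h)
    rw [e1, e2]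
    exact isHyperbolicProfile_cosh_sinh (Real.sqrt_pos.2 (div_pos (neg_pos.2 h) hc)).ne'
  · have e1 : hypFst p q t = _ := funext (hypFst_of_nonneg h.le)
    have e2 : hypSnd p q t = _ := funext (hypSnd_of_nonneg h.le)
    rw [e1, e2]
    exact (isHyperbolicProfile_cosh_sinh (Real.sqrt_pos.2 (div_pos h hc)).ne').symm

lemma hypFst_sq_sub_hypSnd_sq (hq : 0 < q) (hqp : q < p) (t μ : ℝ) :
    hypFst p q t μ ^ 2 - hypSnd p q t μ ^ 2 = -t / swConst p q := by
  have hc := swConst_pos hq hqp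
  have hcs := Real.cosh_sq μ
  rcases lt_or_ge t 0 with h | h
  · rw [hypFst_of_neg h, hypSnd_of_neg h, mul_pow, mul_pow, hcs,
      Real.sq_sqrt (div_nonneg (neg_nonneg.2 h.le) hc.le)]
    ring
  · rw [hypFst_of_nonneg h, hypSnd_of_nonneg h, mul_pow, mul_pow, hcs,
      Real.sq_sqrt (div_nonneg h hc.le)]
    ring

lemma hypFst_mul_hypSnd_zero (t : ℝ) : hypFst p q t 0 * hypSnd p q t 0 = 0 := by
  rcases lt_or_ge t 0 with h | h
  · simp [hypSnd_of_neg h]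
  · simp [hypFst_of_nonneg h]

end Flow

/-! ### A parametrization of all the time slices that is continuous through time zero -/

/-- The speed of the common parametrization. -/
def flowSpeed (p q : ℕ) (t s : ℝ) : ℝ := √(s ^ 2 + |t| / swConst p q)

/-- The first component of the profile in the common parametrization. -/
def flowFst (p q : ℕ) (t s : ℝ) : ℝ := √(s ^ 2 + max (-t / swConst p q) 0)

/-- The second component of the profile in the common parametrization. -/
def flowSnd (p q : ℕ) (t s : ℝ) : ℝ := √(s ^ 2 + max (t / swConst p q) 0)

/-- The common parametrization of the time slices. -/
def flowPos (p q : ℕ) (t : ℝ) (u : ℝ × ℝ) : C2 :=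
  pos p q (flowFst p q t u.1) (flowSnd p q t u.1) u.2

/-- The tangent planes in the common parametrization. -/
def flowPlane (p q : ℕ) (t : ℝ) (u : ℝ × ℝ) : C2 →L[ℝ] C2 :=
  planeProj p q (flowFst p q t u.1) (flowSnd p q t u.1) u.2

/-- `energy` in the common parametrization. -/
def flowEnergy (p q : ℕ) (t s : ℝ) : ℝ := energy p q (flowFst p q t s) (flowSnd p q t s)

/-- The area density in the common parametrization. -/
def flowDensity (p q : ℕ) (t s : ℝ) : ℝ :=
  √((p : ℝ) * q) * flowEnergy p q t s / flowSpeed p q t s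

/-- The parameters `s > 0`, `0 ≤ θ < 2π`. -/
def openStrip : Set (ℝ × ℝ) := Ioi 0 ×ˢ Ico 0 (2 * Real.pi)

/-- The area measure in the common parametrization. -/
def flowArea (p q : ℕ) (t : ℝ) : Measure (ℝ × ℝ) :=
  (volume.restrict openStrip).withDensity fun u => ENNReal.ofReal (flowDensity p q t u.1)

/-- The measure of the varifold of the time slice. -/
def flowMeasure (p q : ℕ) (t : ℝ) : Measure (C2 × (C2 →L[ℝ] C2)) :=
  (flowArea p q t).map fun u => (flowPos p q t u, flowPlane p q t u)

/-! ### Profile, area density and curvature: estimates valid through time zero. -/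

section Profile

variable {p q : ℕ} {t s : ℝ}

lemma flowSpeed_sq (hq : 0 < q) (hqp : q < p) :
    flowSpeed p q t s ^ 2 = s ^ 2 + |t| / swConst p q := by
  have := swConst_pos hq hqp
  exact Real.sq_sqrt (by positivity)

lemma flowFst_sq : flowFst p q t s ^ 2 = s ^ 2 + max (-t / swConst p q) 0 :=
  Real.sq_sqrt (add_nonneg (sq_nonneg _) (le_max_right _ _))

lemma flowSnd_sq : flowSnd p q t s ^ 2 = s ^ 2 + max (t / swConst p q) 0 :=
  Real.sq_sqrt (add_nonneg (sq_nonneg _) (le_max_right _ _))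

lemma flowSpeed_nonneg : 0 ≤ flowSpeed p q t s := Real.sqrt_nonneg _

lemma flowFst_nonneg : 0 ≤ flowFst p q t s := Real.sqrt_nonneg _

lemma flowSnd_nonneg : 0 ≤ flowSnd p q t s := Real.sqrt_nonneg _

lemma le_flowSpeed (hq : 0 < q) (hqp : q < p) : s ≤ flowSpeed p q t s := by
  have := swConst_pos hq hqp
  exact Real.le_sqrt_of_sq_le (by have : 0 ≤ |t| / swConst p q := by positivity
                                  linarith)

lemma flowSpeed_pos (hq : 0 < q) (hqp : q < p) (hs : 0 < s) : 0 < flowSpeed p q t s :=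
  hs.trans_le (le_flowSpeed hq hqp)

lemma flowFst_pos (hs : 0 < s) : 0 < flowFst p q t s :=
  Real.sqrt_pos.2 (add_pos_of_pos_of_nonneg (by positivity) (le_max_right _ _))

lemma flowSnd_pos (hs : 0 < s) : 0 < flowSnd p q t s :=
  Real.sqrt_pos.2 (add_pos_of_pos_of_nonneg (by positivity) (le_max_right _ _))

lemma max_neg_add_max (a : ℝ) : max (-a) 0 + max a 0 = |a| := by
  rcases le_total 0 a with h | h
  · rw [max_eq_right (neg_nonpos.2 h), max_eq_left h, abs_of_nonneg h, zero_add]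
  · rw [max_eq_left (neg_nonneg.2 h), max_eq_right h, abs_of_nonpos h, add_zero]

lemma max_neg_sub_max (a : ℝ) : max (-a) 0 - max a 0 = -a := by
  rcases le_total 0 a with h | h
  · rw [max_eq_right (neg_nonpos.2 h), max_eq_left h]; ring
  · rw [max_eq_left (neg_nonneg.2 h), max_eq_right h]; ring

lemma max_neg_mul_max (a : ℝ) : max (-a) 0 * max a 0 = 0 := by
  rcases le_total 0 a with h | h
  · rw [max_eq_right (neg_nonpos.2 h), zero_mul]
  · rw [max_eq_right h, mul_zero]

lemma flow_sq_sub : flowFst p q t s ^ 2 - flowSnd p q t s ^ 2 = -t / swConst p q := by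
  rw [flowFst_sq, flowSnd_sq, neg_div]
  linear_combination max_neg_sub_max (t / swConst p q)

/-- One of max(±t/c, 0) is zero and the other is |t|/c, so f²g² = s²(s² + |t|/c). This also makes fg
vanish at s = 0 for every t, as the boundary cancellation requires. -/
lemma flow_mul (hq : 0 < q) (hqp : q < p) (hs : 0 ≤ s) :
    flowFst p q t s * flowSnd p q t s = s * flowSpeed p q t s := by
  have hc := swConst_pos hq hqp
  rw [← sq_eq_sq₀ (mul_nonneg flowFst_nonneg flowSnd_nonneg) (mul_nonneg hs flowSpeed_nonneg),
    mul_pow, mul_pow, flowFst_sq, flowSnd_sq, flowSpeed_sq hq hqp, ← abs_of_pos hc, ← abs_div,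
    abs_of_pos hc, ← max_neg_add_max, neg_div]
  linear_combination max_neg_mul_max (t / swConst p q)

lemma flowFst_le (hq : 0 < q) (hqp : q < p) : flowFst p q t s ≤ flowSpeed p q t s := by
  have hc := swConst_pos hq hqp
  apply Real.sqrt_le_sqrt
  gcongr
  apply max_le (div_le_div_of_nonneg_right (neg_le_abs t) hc.le) (by positivity)

lemma flowSnd_le (hq : 0 < q) (hqp : q < p) : flowSnd p q t s ≤ flowSpeed p q t s := by
  have hc := swConst_pos hq hqp
  apply Real.sqrt_le_sqrt
  gcongr
  apply max_le (div_le_div_of_nonneg_right (le_abs_self t) hc.le) (by positivity)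

lemma flowEnergy_nonneg : 0 ≤ flowEnergy p q t s := by unfold flowEnergy energy; positivity

lemma flowEnergy_pos (hq : 0 < q) (hqp : q < p) (hs : 0 < s) : 0 < flowEnergy p q t s :=
  energy_pos _ _ (hq.trans hqp) hq (Or.inl (flowFst_pos hs).ne')

lemma flowEnergy_le (hq : 0 < q) (hqp : q < p) :
    flowEnergy p q t s ≤ (p + q) * flowSpeed p q t s ^ 2 := by
  have h1 := pow_le_pow_left₀ flowFst_nonneg (flowFst_le (t := t) (s := s) hq hqp) 2
  have h2 := pow_le_pow_left₀ flowSnd_nonneg (flowSnd_le (t := t) (s := s) hq hqp) 2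
  unfold flowEnergy energy
  rw [add_mul]
  gcongr

lemma flowDensity_nonneg : 0 ≤ flowDensity p q t s :=
  div_nonneg (mul_nonneg (Real.sqrt_nonneg _) flowEnergy_nonneg) flowSpeed_nonneg

lemma flowDensity_le (hq : 0 < q) (hqp : q < p) (hs : 0 < s) :
    flowDensity p q t s ≤ √((p : ℝ) * q) * (p + q) * flowSpeed p q t s := by
  have hk := flowSpeed_pos (t := t) hq hqp hs
  rw [flowDensity, div_le_iff₀ hk, mul_assoc, mul_assoc, ← sq]
  gcongr
  exact flowEnergy_le hq hqp

lemma flowSpeed_le (hq : 0 < q) (hqp : q < p) (hs : 0 ≤ s) {T R : ℝ} (ht : |t| ≤ T)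
    (hR : s ≤ R) : flowSpeed p q t s ≤ √(R ^ 2 + T / swConst p q) := by
  have hc := swConst_pos hq hqp
  apply Real.sqrt_le_sqrt
  gcongr

/-- This confines the support of a test function to a range of s that does not depend on t, which
makes every dominating function below integrable. -/
lemma le_norm_flowPos (hq : 0 < q) (u : ℝ × ℝ) : u.1 ≤ ‖flowPos p q t u‖ := by
  have hq1 : (1 : ℝ) ≤ q := by exact_mod_cast hq
  apply (abs_le_of_sq_le_sq' · (norm_nonneg _) |>.2)
  rw [flowPos, norm_sq_pos, flowFst_sq, flowSnd_sq]
  have h1 : (0 : ℝ) ≤ q * max (-t / swConst p q) 0 :=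
    mul_nonneg (Nat.cast_nonneg _) (le_max_right _ _)
  have h2 : (0 : ℝ) ≤ p * (u.1 ^ 2 + max (t / swConst p q) 0) :=
    mul_nonneg (Nat.cast_nonneg _) (add_nonneg (sq_nonneg _) (le_max_right _ _))
  nlinarith [mul_nonneg (sub_nonneg.2 hq1) (sq_nonneg u.1)]

lemma norm_flowPos_le (hq : 0 < q) (hqp : q < p) (u : ℝ × ℝ) :
    ‖flowPos p q t u‖ ≤ √((p : ℝ) + q) * flowSpeed p q t u.1 := by
  have h1 := pow_le_pow_left₀ flowFst_nonneg (flowFst_le (t := t) (s := u.1) hq hqp) 2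
  have h2 := pow_le_pow_left₀ flowSnd_nonneg (flowSnd_le (t := t) (s := u.1) hq hqp) 2
  rw [← abs_of_nonneg (norm_nonneg (flowPos p q t u))]
  apply abs_le_of_sq_le_sq _ (mul_nonneg (Real.sqrt_nonneg _) flowSpeed_nonneg)
  rw [flowPos, norm_sq_pos, mul_pow, Real.sq_sqrt (by positivity), add_mul, add_comm]
  gcongr

lemma norm_sq_curvatureField_flowPos (hq : 0 < q) (hqp : q < p) {u : ℝ × ℝ} (hu : 0 < u.1) :
    ‖curvatureField p q (flowPos p q t u)‖ ^ 2 =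
      ((p : ℝ) - q) ^ 2 / (p * q * flowEnergy p q t u.1) := by
  have hp := hq.trans hqp
  have hp' : (p : ℝ) ≠ 0 := by exact_mod_cast hp.ne'
  have hq' : (q : ℝ) ≠ 0 := by exact_mod_cast hq.ne'
  have hD := (flowEnergy_pos (t := t) hq hqp hu).ne'
  rw [flowPos, curvatureField_pos _ hp hq, norm_smul, mul_pow, norm_sq_pos, Real.norm_eq_abs,
    sq_abs]
  have hE : flowEnergy p q t u.1 =
    p * flowFst p q t u.1 ^ 2 + q * flowSnd p q t u.1 ^ 2 := rfl
  change (_ * (flowEnergy p q t u.1)⁻¹) ^ 2 * _ = _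
  field_simp
  rw [hE]

/-- The density is proportional to E/k and |h|² to 1/E, so E cancels. The remaining 1/k is bounded
for t ≠ 0 and equals 1/s at t = 0: this is the logarithmic divergence at the vertex of the cone. -/
lemma flowDensity_mul_norm_sq (hq : 0 < q) (hqp : q < p) {u : ℝ × ℝ} (hu : 0 < u.1) :
    flowDensity p q t u.1 * ‖curvatureField p q (flowPos p q t u)‖ ^ 2 =
      ((p : ℝ) - q) ^ 2 / √((p : ℝ) * q) / flowSpeed p q t u.1 := by
  have hp' : (0 : ℝ) < p := by exact_mod_cast hq.trans hqp
  have hq' : (0 : ℝ) < q := by exact_mod_cast hq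
  have hD := (flowEnergy_pos (t := t) hq hqp hu).ne'
  have hk := (flowSpeed_pos (t := t) hq hqp hu).ne'
  have hs : √((p : ℝ) * q) ≠ 0 := (Real.sqrt_pos.2 (by positivity)).ne'
  have hs2 : √((p : ℝ) * q) ^ 2 = p * q := Real.sq_sqrt (by positivity)
  rw [norm_sq_curvatureField_flowPos hq hqp hu, flowDensity]
  field_simp
  rw [hs2]

/-- The product is (p − q)√E/k, and E ≤ (p + q)k². The bound is uniform in s and t, so |h| is
locally integrable even at the vertex of the cone. -/
lemma flowDensity_mul_norm_le (hq : 0 < q) (hqp : q < p) {u : ℝ × ℝ} (hu : 0 < u.1) :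
    flowDensity p q t u.1 * ‖curvatureField p q (flowPos p q t u)‖ ≤
      ((p : ℝ) - q) * √((p : ℝ) + q) := by
  have hp' : (0 : ℝ) < p := by exact_mod_cast hq.trans hqp
  have hq' : (0 : ℝ) < q := by exact_mod_cast hq
  have hpq : (0 : ℝ) ≤ p - q := sub_nonneg.2 (by exact_mod_cast hqp.le)
  have hD := (flowEnergy_pos (t := t) hq hqp hu).ne'
  have hk := flowSpeed_pos (t := t) hq hqp hu
  apply (abs_le_of_sq_le_sq' · (by positivity) |>.2)
  have hs2 : √((p : ℝ) * q) ^ 2 = p * q := Real.sq_sqrt (by positivity)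
  rw [mul_pow, norm_sq_curvatureField_flowPos hq hqp hu, flowDensity, mul_pow, div_pow, mul_pow,
    hs2, Real.sq_sqrt (by positivity)]
  have : (p * q * flowEnergy p q t u.1 ^ 2 / flowSpeed p q t u.1 ^ 2 *
      (((p : ℝ) - q) ^ 2 / (p * q * flowEnergy p q t u.1))) =
      (p - q) ^ 2 * (flowEnergy p q t u.1 / flowSpeed p q t u.1 ^ 2) := by field_simp
  rw [this]
  gcongr
  rw [div_le_iff₀ (by positivity)]
  exact flowEnergy_le hq hqp

end Profile

/-! ### Measures on phase space and the time slices as varifolds. -/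

section Measure

variable {p q : ℕ} {t : ℝ}

@[fun_prop] lemma continuous_flowSpeed : Continuous fun x : ℝ × ℝ => flowSpeed p q x.1 x.2 := by
  unfold flowSpeed; fun_prop

@[fun_prop] lemma continuous_flowFst : Continuous fun x : ℝ × ℝ => flowFst p q x.1 x.2 := by
  unfold flowFst; fun_prop

@[fun_prop] lemma continuous_flowSnd : Continuous fun x : ℝ × ℝ => flowSnd p q x.1 x.2 := by
  unfold flowSnd; fun_prop

lemma continuous_radial (p q : ℕ) : Continuous fun x : ℝ × ℝ × ℝ => radial p q x.1 x.2.1 x.2.2 :=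
  (continuous_pos p q).comp (f := fun x : ℝ × ℝ × ℝ => (x.2.1, x.1, x.2.2)) (by fun_prop)

lemma continuous_angular (p q : ℕ) :
    Continuous fun x : ℝ × ℝ × ℝ => angular p q x.1 x.2.1 x.2.2 :=
  (continuous_frame p q).comp (f := fun x : ℝ × ℝ × ℝ =>
    (x.2.2, Complex.I * p * ((√(q : ℝ) * x.1 : ℝ) : ℂ),
      -(Complex.I * q * ((√(p : ℝ) * x.2.1 : ℝ) : ℂ)))) (by fun_prop)

lemma continuous_energy (p q : ℕ) : Continuous fun x : ℝ × ℝ × ℝ => energy p q x.1 x.2.1 := by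
  unfold energy; fun_prop

/-- The factor E⁻¹ is left out: the projection is continuous only where E ≠ 0, but measurable
everywhere. -/
lemma continuous_planeProj_aux (p q : ℕ) : Continuous fun x : ℝ × ℝ × ℝ =>
    (innerSL ℝ (radial p q x.1 x.2.1 x.2.2)).smulRight (radial p q x.1 x.2.1 x.2.2) +
      ((p : ℝ) * q)⁻¹ • (innerSL ℝ (angular p q x.1 x.2.1 x.2.2)).smulRight
        (angular p q x.1 x.2.1 x.2.2) := by
  have h1 := continuous_radial p q
  have h2 := continuous_angular p q
  fun_prop

lemma measurable_planeProj (p q : ℕ) :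
    Measurable fun x : ℝ × ℝ × ℝ => planeProj p q x.1 x.2.1 x.2.2 :=
  (continuous_energy p q).measurable.inv.smul (continuous_planeProj_aux p q).measurable

lemma continuousAt_planeProj {x : ℝ × ℝ × ℝ} (hx : energy p q x.1 x.2.1 ≠ 0) :
    ContinuousAt (fun x : ℝ × ℝ × ℝ => planeProj p q x.1 x.2.1 x.2.2) x :=
  ((continuous_energy p q).continuousAt.inv₀ hx).smul (continuous_planeProj_aux p q).continuousAt

/-- The profile and the angle as functions of time and the parameters. -/
lemma continuous_profile (p q : ℕ) : Continuous fun x : ℝ × ℝ × ℝ =>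
    (flowFst p q x.1 x.2.1, flowSnd p q x.1 x.2.1, x.2.2) := by
  have h1 := (continuous_flowFst (p := p) (q := q)).comp (f := fun x : ℝ × ℝ × ℝ => (x.1, x.2.1))
    (by fun_prop)
  have h2 := (continuous_flowSnd (p := p) (q := q)).comp (f := fun x : ℝ × ℝ × ℝ => (x.1, x.2.1))
    (by fun_prop)
  exact h1.prodMk (h2.prodMk (by fun_prop))

lemma continuous_flowPos : Continuous fun x : ℝ × ℝ × ℝ => flowPos p q x.1 x.2 :=
  (continuous_pos p q).comp (continuous_profile p q)

lemma continuous_flowPos_right (t : ℝ) : Continuous (flowPos p q t) :=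
  continuous_flowPos.comp (f := fun u : ℝ × ℝ => (t, u)) (by fun_prop)

lemma measurable_flowPlane (t : ℝ) : Measurable (flowPlane p q t) := by
  have h : Continuous fun u : ℝ × ℝ => (flowFst p q t u.1, flowSnd p q t u.1, u.2) :=
    (continuous_profile p q).comp (f := fun u : ℝ × ℝ => (t, u)) (by fun_prop)
  have h2 := Measurable.comp (measurable_planeProj p q) h.measurable
  have h3 : flowPlane p q t = (fun x : ℝ × ℝ × ℝ => planeProj p q x.1 x.2.1 x.2.2) ∘
      fun u : ℝ × ℝ => (flowFst p q t u.1, flowSnd p q t u.1, u.2) := by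
    ext1 u; rfl
  rw [h3]; exact h2

lemma continuous_flowEnergy : Continuous fun x : ℝ × ℝ => flowEnergy p q x.1 x.2 := by
  have h1 := (continuous_flowFst (p := p) (q := q))
  have h2 := (continuous_flowSnd (p := p) (q := q))
  unfold flowEnergy energy
  fun_prop

lemma measurable_flowSpeed (t : ℝ) : Measurable (flowSpeed p q t) :=
  (continuous_flowSpeed.comp (f := fun s : ℝ => (t, s)) (by fun_prop)).measurable

lemma measurable_flowDensity (t : ℝ) : Measurable (flowDensity p q t) :=
  ((continuous_flowEnergy.comp (f := fun s : ℝ => (t, s)) (by fun_prop)).measurable.const_mul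
    _).div (measurable_flowSpeed t)

lemma measurableSet_openStrip : MeasurableSet openStrip := measurableSet_Ioi.prod measurableSet_Ico

lemma measurable_ofReal_flowDensity (t : ℝ) :
    Measurable fun u : ℝ × ℝ => ENNReal.ofReal (flowDensity p q t u.1) :=
  ((measurable_flowDensity t).comp measurable_fst).ennreal_ofReal

lemma measurable_flowMap (t : ℝ) :
    Measurable fun u : ℝ × ℝ => (flowPos p q t u, flowPlane p q t u) :=
  (continuous_flowPos_right t).measurable.prodMk (measurable_flowPlane t)

lemma ae_openStrip (t : ℝ) : ∀ᵐ u ∂flowArea p q t, u ∈ openStrip :=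
  (withDensity_absolutelyContinuous _ _).ae_le (ae_restrict_mem measurableSet_openStrip)

lemma volume_restrict_halfStrip :
    (volume : Measure (ℝ × ℝ)).restrict halfStrip = volume.restrict openStrip := by
  rw [halfStrip, openStrip, Measure.volume_eq_prod, ← Measure.prod_restrict,
    ← Measure.prod_restrict, restrict_Ioi_eq_restrict_Ici]

/-- The area measure of a time slice after a change of the radial parameter. -/
lemma map_flowArea {s s' : ℝ → ℝ} (hs : Measurable s) (hs' : Measurable s')
    (hd : ∀ r > 0, HasDerivAt s (s' r) r) (hpos : ∀ r > 0, 0 ≤ s' r)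
    (hinj : InjOn s (Ioi 0)) (himg : s '' Ioi 0 = Ioi 0) :
    (((volume : Measure (ℝ × ℝ)).restrict openStrip).withDensity
      fun u => ENNReal.ofReal (s' u.1 * flowDensity p q t (s u.1))).map
        (fun u : ℝ × ℝ => (s u.1, u.2)) = flowArea p q t := by
  have hm : Measurable fun u : ℝ × ℝ => (s u.1, u.2) :=
    (hs.comp measurable_fst).prodMk measurable_snd
  have hdens : Measurable fun u : ℝ × ℝ => ENNReal.ofReal (s' u.1 * flowDensity p q t (s u.1)) :=
    ((hs'.comp measurable_fst).mul
      ((measurable_flowDensity t).comp (hs.comp measurable_fst))).ennreal_ofReal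
  refine Measure.ext_of_lintegral _ fun φ hφ => ?_
  -- By Tonelli it suffices to substitute in the radial variable for each fixed θ.
  have hint : ∀ θ : ℝ, ∫⁻ r in Ioi 0, ENNReal.ofReal (s' r * flowDensity p q t (s r)) * φ (s r, θ)
      = ∫⁻ r in Ioi 0, ENNReal.ofReal (flowDensity p q t r) * φ (r, θ) := by
    intro θ
    conv_rhs => rw [← himg]
    rw [lintegral_image_eq_lintegral_abs_deriv_mul measurableSet_Ioi
      (fun r hr => (hd r hr).hasDerivWithinAt) hinj]
    refine setLIntegral_congr_fun measurableSet_Ioi fun r hr => ?_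
    rw [abs_of_nonneg (hpos r hr), ENNReal.ofReal_mul (hpos r hr), mul_assoc]
  have hφm : Measurable fun u : ℝ × ℝ => φ (s u.1, u.2) := hφ.comp hm
  rw [lintegral_map hφ hm, lintegral_withDensity_eq_lintegral_mul _ hdens hφm, flowArea,
    lintegral_withDensity_eq_lintegral_mul _ (measurable_ofReal_flowDensity t) hφ, openStrip,
    Measure.volume_eq_prod, setLIntegral_prod_symm _ (hdens.mul hφm).aemeasurable,
    setLIntegral_prod_symm _ ((measurable_ofReal_flowDensity t).mul hφ).aemeasurable]
  exact lintegral_congr fun θ => hint θ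

/-- A reparametrization of a time slice has the same area measure in phase space. -/
lemma surfaceMeasure_eq_flowMeasure {F : ℝ × ℝ → C2} {s s' : ℝ → ℝ} (hs : Measurable s)
    (hs' : Measurable s') (hd : ∀ r > 0, HasDerivAt s (s' r) r) (hpos : ∀ r > 0, 0 ≤ s' r)
    (hinj : InjOn s (Ioi 0)) (himg : s '' Ioi 0 = Ioi 0)
    (hF : ∀ u : ℝ × ℝ, 0 < u.1 → F u = flowPos p q t (s u.1, u.2))
    (hA : ∀ u : ℝ × ℝ, 0 < u.1 → areaDensity F u = s' u.1 * flowDensity p q t (s u.1))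
    (hP : ∀ u : ℝ × ℝ, 0 < u.1 → tangentProj F u = flowPlane p q t (s u.1, u.2)) :
    surfaceMeasure F halfStrip = flowMeasure p q t := by
  have hm : Measurable fun u : ℝ × ℝ => (s u.1, u.2) :=
    (hs.comp measurable_fst).prodMk measurable_snd
  have hmem : ∀ᵐ u ∂(volume : Measure (ℝ × ℝ)).restrict openStrip, u ∈ openStrip :=
    ae_restrict_mem measurableSet_openStrip
  have h1 : ((volume : Measure (ℝ × ℝ)).restrict halfStrip).withDensity
      (fun u => ENNReal.ofReal (areaDensity F u)) = ((volume : Measure (ℝ × ℝ)).restrict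
        openStrip).withDensity (fun u => ENNReal.ofReal (s' u.1 * flowDensity p q t (s u.1))) := by
    rw [volume_restrict_halfStrip]
    exact withDensity_congr_ae (hmem.mono fun u hu => by simp only [hA u hu.1])
  have h2 : (fun u => (F u, tangentProj F u)) =ᵐ[((volume : Measure (ℝ × ℝ)).restrict
        openStrip).withDensity (fun u => ENNReal.ofReal (s' u.1 * flowDensity p q t (s u.1)))]
      (fun u => (flowPos p q t u, flowPlane p q t u)) ∘ fun u : ℝ × ℝ => (s u.1, u.2) :=
    Filter.Eventually.mono ((withDensity_absolutelyContinuous _ _).ae_le hmem) fun u hu => by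
      simp only [Function.comp_apply, hF u hu.1, hP u hu.1]
  rw [surfaceMeasure, h1, Measure.map_congr h2, ← Measure.map_map (measurable_flowMap t) hm,
    flowMeasure, map_flowArea hs hs' hd hpos hinj himg]

/-- The bound used for dominated convergence on the strip. -/
def stripBound (C R : ℝ) : ℝ × ℝ → ℝ := (Iic R ×ˢ univ).indicator fun _ => C

lemma integrableOn_stripBound (C R : ℝ) : IntegrableOn (stripBound C R) openStrip := by
  have hm : MeasurableSet (Iic R ×ˢ (univ : Set ℝ)) := measurableSet_Iic.prod MeasurableSet.univ
  rw [IntegrableOn, stripBound, integrable_indicator_iff hm, IntegrableOn,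
    Measure.restrict_restrict hm]
  refine integrableOn_const ?_
  refine ((measure_mono (?_ : _ ⊆ Icc 0 R ×ˢ Icc 0 (2 * Real.pi))).trans_lt ?_).ne
  · rintro u ⟨hu, hu'⟩
    exact ⟨⟨hu'.1.le, hu.1⟩, hu'.2.1, hu'.2.2.le⟩
  · exact (isCompact_Icc.prod isCompact_Icc).measure_lt_top

lemma norm_le_stripBound {x C R : ℝ} {u : ℝ × ℝ} (h1 : |x| ≤ C) (h2 : R < u.1 → x = 0) :
    ‖x‖ ≤ stripBound C R u := by
  by_cases h : u.1 ≤ R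
  · rw [stripBound, indicator_of_mem (by exact ⟨h, mem_univ _⟩)]; exact h1
  · rw [stripBound, indicator_of_notMem (by exact fun h' => h h'.1), h2 (not_le.1 h), norm_zero]

lemma integrableOn_openStrip {G : ℝ × ℝ → ℝ}
    (hm : AEStronglyMeasurable G (volume.restrict openStrip)) {C R : ℝ}
    (h1 : ∀ u ∈ openStrip, |G u| ≤ C) (h2 : ∀ u ∈ openStrip, R < u.1 → G u = 0) :
    IntegrableOn G openStrip :=
  (integrableOn_stripBound C R).mono' hm <| (ae_restrict_mem measurableSet_openStrip).mono
    fun u hu => norm_le_stripBound (h1 u hu) (h2 u hu)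

/-- Dominated convergence. Continuity is local, so a bound for each bounded range of times is
enough. -/
lemma continuous_setIntegral_openStrip {G : ℝ → ℝ × ℝ → ℝ}
    (hm : ∀ t, AEStronglyMeasurable (G t) (volume.restrict openStrip))
    (hb : ∀ T, ∃ C R : ℝ, ∀ t, |t| ≤ T → ∀ u ∈ openStrip, |G t u| ≤ C ∧ (R < u.1 → G t u = 0))
    (hc : ∀ u ∈ openStrip, Continuous fun t => G t u) :
    Continuous fun t => ∫ u in openStrip, G t u := by
  rw [continuous_iff_continuousAt]
  intro t₀
  obtain ⟨C, R, h⟩ := hb (|t₀| + 1)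
  have hnear : ∀ᶠ t in 𝓝 t₀, |t| ≤ |t₀| + 1 :=
    (continuous_abs.tendsto t₀).eventually (eventually_le_nhds (by linarith))
  refine continuousAt_of_dominated (Eventually.of_forall hm) (hnear.mono fun t ht => ?_)
    (integrableOn_stripBound C R) ?_
  · exact (ae_restrict_mem measurableSet_openStrip).mono
      fun u hu => norm_le_stripBound (h t ht u hu).1 (h t ht u hu).2
  · exact (ae_restrict_mem measurableSet_openStrip).mono fun u hu => (hc u hu).continuousAt

/-- The neighbourhoods are ball × everything: a ball in ℂ² already bounds s by `le_norm_flowPos`,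
and the density is bounded for bounded s. -/
lemma isLocallyFiniteMeasure_flowMeasure (hq : 0 < q) (hqp : q < p) (t : ℝ) :
    IsLocallyFiniteMeasure (flowMeasure p q t) := by
  refine ⟨fun z => ⟨Metric.ball 0 (‖z.1‖ + 1) ×ˢ univ, ?_, ?_⟩⟩
  · exact prod_mem_nhds (Metric.isOpen_ball.mem_nhds (by simp)) univ_mem
  · set R := ‖z.1‖ + 1
    have hms : MeasurableSet (Metric.ball (0 : C2) R ×ˢ (univ : Set (C2 →L[ℝ] C2))) :=
      measurableSet_ball.prod MeasurableSet.univ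
    have hpre := measurable_flowMap (p := p) (q := q) t hms
    rw [flowMeasure, Measure.map_apply (measurable_flowMap t) hms, flowArea,
      withDensity_apply _ hpre, Measure.restrict_restrict hpre]
    set C := √((p : ℝ) * q) * (p + q) * √(R ^ 2 + |t| / swConst p q)
    have hsub : ((fun u => (flowPos p q t u, flowPlane p q t u)) ⁻¹'
        (Metric.ball (0 : C2) R ×ˢ (univ : Set (C2 →L[ℝ] C2))) ∩ openStrip) ⊆
        Icc 0 R ×ˢ Icc 0 (2 * Real.pi) := by
      rintro u ⟨hu, hu'⟩
      have h1 : ‖flowPos p q t u‖ < R := mem_ball_zero_iff.1 hu.1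
      exact ⟨⟨hu'.1.le, ((le_norm_flowPos hq u).trans h1.le)⟩, hu'.2.1, hu'.2.2.le⟩
    have hbd : ∀ u ∈ ((fun u => (flowPos p q t u, flowPlane p q t u)) ⁻¹'
        (Metric.ball (0 : C2) R ×ˢ (univ : Set (C2 →L[ℝ] C2))) ∩ openStrip),
        ENNReal.ofReal (flowDensity p q t u.1) ≤ ENNReal.ofReal C := by
      intro u hu
      apply ENNReal.ofReal_le_ofReal
      refine (flowDensity_le hq hqp hu.2.1).trans ?_
      exact mul_le_mul_of_nonneg_left (flowSpeed_le hq hqp hu.2.1.le le_rfl (hsub hu).1.2)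
        (by positivity)
    calc _ ≤ ∫⁻ _ in ((fun u => (flowPos p q t u, flowPlane p q t u)) ⁻¹'
        (Metric.ball (0 : C2) R ×ˢ (univ : Set (C2 →L[ℝ] C2))) ∩ openStrip), ENNReal.ofReal C :=
          setLIntegral_mono' (hpre.inter measurableSet_openStrip) hbd
      _ = ENNReal.ofReal C * volume ((fun u => (flowPos p q t u, flowPlane p q t u)) ⁻¹'
        (Metric.ball (0 : C2) R ×ˢ (univ : Set (C2 →L[ℝ] C2))) ∩ openStrip) := by
          rw [setLIntegral_const]
      _ < ⊤ := ENNReal.mul_lt_top ENNReal.ofReal_lt_top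
          ((measure_mono hsub).trans_lt (isCompact_Icc.prod isCompact_Icc).measure_lt_top)

/-- The right-hand side consists of closed conditions, so the Grassmannian is closed; this supplies
the measurability needed to pull the almost-everywhere statement back to the strip. -/
lemma exists_eq_starProjection_iff {m : ℕ} {E : Type*} [NormedAddCommGroup E]
    [InnerProductSpace ℝ E] [FiniteDimensional ℝ E] {P : E →L[ℝ] E} :
    (∃ K : Submodule ℝ E, Module.finrank ℝ K = m ∧ P = K.starProjection) ↔
      P * P = P ∧ star P = P ∧ LinearMap.trace ℝ E (P : E →ₗ[ℝ] E) = m := by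
  have htr : ∀ K : Submodule ℝ E, LinearMap.trace ℝ E (K.starProjection : E →ₗ[ℝ] E) =
      Module.finrank ℝ K := fun K =>
    LinearMap.IsProj.trace ⟨fun x => Submodule.starProjection_apply_mem K x,
      fun x hx => Submodule.starProjection_eq_self_iff.2 hx⟩
  constructor
  · rintro ⟨K, rfl, rfl⟩
    have h := isStarProjection_starProjection (U := K)
    exact ⟨h.isIdempotentElem, h.isSelfAdjoint, htr K⟩
  · rintro ⟨h1, h2, h3⟩
    have h : IsStarProjection P := ⟨h1, h2⟩
    obtain ⟨hK, hP⟩ := isStarProjection_iff_eq_starProjection_range.1 h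
    refine ⟨P.range, ?_, hP⟩
    have := htr P.range
    rw [← hP, h3] at this
    exact_mod_cast this.symm

lemma flowMeasure_planes (hq : 0 < q) (hqp : q < p) (t : ℝ) : ∀ᵐ z ∂flowMeasure p q t,
    ∃ K : Submodule ℝ C2, Module.finrank ℝ K = 2 ∧ z.2 = K.starProjection := by
  have hmeas : MeasurableSet {z : C2 × (C2 →L[ℝ] C2) |
      ∃ K : Submodule ℝ C2, Module.finrank ℝ K = 2 ∧ z.2 = K.starProjection} := by
    simp only [exists_eq_starProjection_iff]
    have h3 : Continuous fun P : C2 →L[ℝ] C2 => LinearMap.trace ℝ C2 (P : C2 →ₗ[ℝ] C2) :=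
      LinearMap.continuous_of_finiteDimensional
        ((LinearMap.trace ℝ C2).comp (ContinuousLinearMap.coeLM ℝ))
    refine IsClosed.measurableSet ?_
    exact (isClosed_eq (by fun_prop) (by fun_prop)).inter
      ((isClosed_eq (by fun_prop) (by fun_prop)).inter
        (isClosed_eq (h3.comp continuous_snd) (by fun_prop)))
  rw [flowMeasure, ae_map_iff (measurable_flowMap t).aemeasurable hmeas]
  filter_upwards [ae_openStrip t] with u hu
  have hp := hq.trans hqp
  have hD := (flowEnergy_pos (t := t) hq hqp hu.1).ne'
  have hli := linearIndependent_radial_angular u.2 hp hq hD one_ne_zero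
  refine ⟨_, ?_, planeProj_eq_starProjection u.2 hp hq hD one_ne_zero⟩
  have := finrank_span_eq_card hli
  rwa [Matrix.range_cons, Matrix.range_cons, Matrix.range_empty, union_empty, singleton_union,
    Fintype.card_fin] at this

/-- The time slices as varifolds. -/
def flowVarifold (hq : 0 < q) (hqp : q < p) (t : ℝ) : Varifold 2 C2 where
  measure := flowMeasure p q t
  locallyFinite := isLocallyFiniteMeasure_flowMeasure hq hqp t
  planes := flowMeasure_planes hq hqp t

end Measure

/-! ### The slices are the given surfaces and the cone, injectively parametrized off a null set. -/

section Slices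

variable {p q : ℕ} {t : ℝ}

lemma norm_pos_apply_zero (f g θ : ℝ) : ‖pos p q f g θ 0‖ = √(q : ℝ) * |f| := by
  rw [pos, frame_apply_zero, norm_mul, norm_exp_pos, mul_one, Complex.norm_real, Real.norm_eq_abs,
    abs_mul, abs_of_nonneg (Real.sqrt_nonneg _)]

lemma norm_pos_apply_one (f g θ : ℝ) : ‖pos p q f g θ 1‖ = √(p : ℝ) * |g| := by
  rw [pos, frame_apply_one, norm_mul, norm_exp_neg, mul_one, norm_mul, Complex.norm_I, one_mul,
    Complex.norm_real, Real.norm_eq_abs, abs_mul, abs_of_nonneg (Real.sqrt_nonneg _)]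

/-- Both p(θ − θ') and q(θ − θ') are multiples of 2π, hence by Bézout so is θ − θ', which is smaller
than 2π in absolute value. -/
lemma eq_of_exp_eq (hpq : Nat.Coprime p q) {θ θ' : ℝ} (hθ : θ ∈ Ico 0 (2 * Real.pi))
    (hθ' : θ' ∈ Ico 0 (2 * Real.pi))
    (h0 : Complex.exp (Complex.I * p * θ) = Complex.exp (Complex.I * p * θ'))
    (h1 : Complex.exp (-(Complex.I * q * θ)) = Complex.exp (-(Complex.I * q * θ'))) : θ = θ' := by
  obtain ⟨m, hm⟩ := Complex.exp_eq_exp_iff_exists_int.1 h0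
  obtain ⟨n, hn⟩ := Complex.exp_eq_exp_iff_exists_int.1 h1
  have hm' : (p : ℝ) * (θ - θ') = m * (2 * Real.pi) := by
    have : ((p * (θ - θ') : ℝ) : ℂ) = ((m * (2 * Real.pi) : ℝ) : ℂ) := by
      apply mul_left_cancel₀ Complex.I_ne_zero
      push_cast
      linear_combination hm
    exact_mod_cast this
  have hn' : (q : ℝ) * (θ - θ') = -n * (2 * Real.pi) := by
    have : ((q * (θ - θ') : ℝ) : ℂ) = ((-n * (2 * Real.pi) : ℝ) : ℂ) := by
      apply mul_left_cancel₀ Complex.I_ne_zero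
      push_cast
      linear_combination -hn
    exact_mod_cast this
  have hb : (p : ℝ) * p.gcdA q + q * p.gcdB q = 1 := by
    have := Nat.gcd_eq_gcd_ab p q
    rw [hpq] at this
    exact_mod_cast this.symm
  have hk : θ - θ' = ((m * p.gcdA q - n * p.gcdB q : ℤ) : ℝ) * (2 * Real.pi) := by
    push_cast
    linear_combination (p.gcdA q : ℝ) * hm' + (p.gcdB q : ℝ) * hn' - (θ - θ') * hb
  set k : ℤ := m * p.gcdA q - n * p.gcdB q
  have hpi := Real.two_pi_pos
  have hk0 : k = 0 := by
    have h2 : (k : ℝ) < 1 := by nlinarith [hθ.2, hθ'.1]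
    have h3 : (-1 : ℝ) < k := by nlinarith [hθ.1, hθ'.2]
    have h2' : k < 1 := by exact_mod_cast h2
    have h3' : -1 < k := by exact_mod_cast h3
    omega
  rw [hk0] at hk
  push_cast at hk
  linarith

/-- A rotation surface over a profile in the open quadrant is injectively parametrized. -/
lemma injOn_profileSurface (hq : 0 < q) (hqp : q < p) (hpq : Nat.Coprime p q) {f g : ℝ → ℝ}
    (hf : ∀ r > 0, 0 < f r) (hg : ∀ r > 0, 0 < g r) (hinj : InjOn f (Ioi 0)) :
    ∃ N : Set (ℝ × ℝ), volume N = 0 ∧ InjOn (profileSurface p q f g) (halfStrip \ N) := by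
  -- Only the edge r = 0, which may be multiply covered, is removed. Elsewhere both coordinates are
  -- nonzero: their moduli determine r and their phases determine θ.
  refine ⟨{0} ×ˢ univ, ?_, ?_⟩
  · rw [Measure.volume_eq_prod, Measure.prod_prod]; simp
  · rintro ⟨r, θ⟩ ⟨hu, hN⟩ ⟨r', θ'⟩ ⟨hu', hN'⟩ h
    have hr : 0 < r := lt_of_le_of_ne hu.1 fun h => hN ⟨h.symm, mem_univ _⟩
    have hr' : 0 < r' := lt_of_le_of_ne hu'.1 fun h => hN' ⟨h.symm, mem_univ _⟩
    have hsq : 0 < √(q : ℝ) := Real.sqrt_pos.2 (by exact_mod_cast hq)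
    have hsp : 0 < √(p : ℝ) := Real.sqrt_pos.2 (by exact_mod_cast hq.trans hqp)
    simp only [profileSurface] at h
    have e0 := congrArg (fun z : C2 => ‖z 0‖) h
    have e1 := congrArg (fun z : C2 => ‖z 1‖) h
    simp only [norm_pos_apply_zero, norm_pos_apply_one] at e0 e1
    rw [mul_right_inj' hsq.ne', abs_of_pos (hf r hr), abs_of_pos (hf r' hr')] at e0
    rw [mul_right_inj' hsp.ne', abs_of_pos (hg r hr), abs_of_pos (hg r' hr')] at e1
    have a0 := congrArg (fun z : C2 => z 0) h
    have a1 := congrArg (fun z : C2 => z 1) h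
    simp only [pos, frame_apply_zero, frame_apply_one, e0, e1] at a0 a1
    have hne0 : ((√(q : ℝ) * f r' : ℝ) : ℂ) ≠ 0 := by
      exact_mod_cast (mul_pos hsq (hf r' hr')).ne'
    have hne1 : Complex.I * ((√(p : ℝ) * g r' : ℝ) : ℂ) ≠ 0 :=
      mul_ne_zero Complex.I_ne_zero (by exact_mod_cast (mul_pos hsp (hg r' hr')).ne')
    exact Prod.ext (hinj hr hr' e0)
      (eq_of_exp_eq hpq hu.2 hu'.2 (mul_left_cancel₀ hne0 a0) (mul_left_cancel₀ hne1 a1))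

/-- The change of parameter from the conformal to the common parametrization. -/
def hypParam (p q : ℕ) (t μ : ℝ) : ℝ := √(|t| / swConst p q) * Real.sinh μ

/-- For s = √(|t|/c) sinh μ, the quantity s² + |t|/c is the square of √(|t|/c) cosh μ. The sign of t
decides which profile component receives the cosh. -/
lemma hypParam_profile (hq : 0 < q) (hqp : q < p) {μ : ℝ} (hμ : 0 ≤ μ) :
    flowFst p q t (hypParam p q t μ) = hypFst p q t μ ∧
    flowSnd p q t (hypParam p q t μ) = hypSnd p q t μ ∧
    flowSpeed p q t (hypParam p q t μ) = √(|t| / swConst p q) * Real.cosh μ := by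
  have hc := swConst_pos hq hqp
  have hsinh := Real.sinh_nonneg_iff.2 hμ
  have hsq : √(|t| / swConst p q) ^ 2 = |t| / swConst p q := Real.sq_sqrt (by positivity)
  have key : ∀ a : ℝ, a = √(|t| / swConst p q) →
      √((a * Real.sinh μ) ^ 2 + |t| / swConst p q) = a * Real.cosh μ := by
    intro a ha
    have ha0 : 0 ≤ a := ha ▸ Real.sqrt_nonneg _
    rw [← hsq, ← ha, mul_pow, ← mul_add_one, ← Real.cosh_sq, ← mul_pow,
      Real.sqrt_sq (mul_nonneg ha0 (Real.cosh_pos μ).le)]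
  have key' : √((√(|t| / swConst p q) * Real.sinh μ) ^ 2) = √(|t| / swConst p q) * Real.sinh μ :=
    Real.sqrt_sq (mul_nonneg (Real.sqrt_nonneg _) hsinh)
  refine ⟨?_, ?_, key _ rfl⟩
  · rcases lt_or_ge t 0 with h | h
    · rw [flowFst, hypFst_of_neg h, ← abs_of_neg h, max_eq_left (by positivity)]
      exact key _ rfl
    · rw [flowFst, hypFst_of_nonneg h, max_eq_right, add_zero, hypParam, key', abs_of_nonneg h]
      exact div_nonpos_of_nonpos_of_nonneg (neg_nonpos.2 h) hc.le
  · rcases lt_or_ge t 0 with h | h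
    · rw [flowSnd, hypSnd_of_neg h, max_eq_right, add_zero, hypParam, key', abs_of_neg h]
      exact div_nonpos_of_nonpos_of_nonneg h.le hc.le
    · have := key _ rfl
      rw [abs_of_nonneg h] at this
      rw [flowSnd, hypSnd_of_nonneg h, max_eq_left (by positivity), hypParam, abs_of_nonneg h, this]

/-- The Jacobian ds/dμ = √(|t|/c) cosh μ is exactly k, so it cancels the 1/k in `flowDensity` and
leaves the conformal area density. -/
lemma surfaceMeasure_swFlow (hq : 0 < q) (hqp : q < p) (ht : t ≠ 0) :
    surfaceMeasure (swFlow p q t) halfStrip = flowMeasure p q t := by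
  have hc := swConst_pos hq hqp
  have hp := hq.trans hqp
  have ha : 0 < √(|t| / swConst p q) := Real.sqrt_pos.2 (by positivity)
  have H := isHyperbolicProfile_hyp hq hqp ht
  rw [swFlow_eq]
  refine surfaceMeasure_eq_flowMeasure (s := hypParam p q t)
    (s' := fun μ => √(|t| / swConst p q) * Real.cosh μ) ?_ ?_ ?_ ?_ ?_ ?_ ?_ ?_ ?_
  · exact (Real.continuous_sinh.const_mul _).measurable
  · exact (Real.continuous_cosh.const_mul _).measurable
  · exact fun r _ => (Real.hasDerivAt_sinh r).const_mul _
  · exact fun r _ => (mul_pos ha (Real.cosh_pos r)).le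
  · exact fun r _ r' _ h => Real.sinh_injective (mul_left_cancel₀ ha.ne' h)
  · ext x
    constructor
    · rintro ⟨r, hr, rfl⟩
      exact mul_pos ha (Real.sinh_pos_iff.2 hr)
    · intro hx
      obtain ⟨r, hr⟩ := Real.sinh_surjective (x / √(|t| / swConst p q))
      refine ⟨r, Real.sinh_pos_iff.1 (by rw [hr]; exact div_pos hx ha), ?_⟩
      rw [hypParam, hr, mul_div_cancel₀ _ ha.ne']
  · intro u hu
    obtain ⟨h1, h2, -⟩ := hypParam_profile (t := t) hq hqp hu.le
    rw [flowPos, h1, h2, profileSurface]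
  · intro u hu
    obtain ⟨h1, h2, h3⟩ := hypParam_profile (t := t) hq hqp hu.le
    rw [H.areaDensity_eq, flowDensity, flowEnergy, h1, h2, h3,
      mul_div_cancel₀ _ (mul_pos ha (Real.cosh_pos u.1)).ne']
  · intro u hu
    obtain ⟨h1, h2, -⟩ := hypParam_profile (t := t) hq hqp hu.le
    rw [H.tangentProj_eq hp hq, flowPlane, h1, h2]

lemma hyp_pos (hq : 0 < q) (hqp : q < p) (ht : t ≠ 0) :
    (∀ r > 0, 0 < hypFst p q t r) ∧ ∀ r > 0, 0 < hypSnd p q t r := by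
  have hc := swConst_pos hq hqp
  have ha : 0 < √(|t| / swConst p q) := Real.sqrt_pos.2 (by positivity)
  constructor <;> intro r hr
  · rw [← (hypParam_profile hq hqp hr.le).1]
    exact flowFst_pos (mul_pos ha (Real.sinh_pos_iff.2 hr))
  · rw [← (hypParam_profile hq hqp hr.le).2.1]
    exact flowSnd_pos (mul_pos ha (Real.sinh_pos_iff.2 hr))

lemma isVarifoldOf_swFlow (hq : 0 < q) (hqp : q < p) (hpq : Nat.Coprime p q) (ht : t ≠ 0) :
    IsVarifoldOf (flowVarifold hq hqp t) (swFlow p q t) halfStrip := by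
  refine ⟨?_, (surfaceMeasure_swFlow hq hqp ht).symm⟩
  obtain ⟨hf, hg⟩ := hyp_pos hq hqp ht
  rw [swFlow_eq]
  refine injOn_profileSurface hq hqp hpq hf hg (StrictMonoOn.injOn ?_)
  refine strictMonoOn_of_deriv_pos (convex_Ioi 0) ?_ fun r hr => ?_
  · exact (isHyperbolicProfile_hyp hq hqp ht).smooth.continuous.continuousOn
  · rw [interior_Ioi] at hr
    rw [((isHyperbolicProfile_hyp hq hqp ht).deriv r).deriv]
    exact hg r hr

lemma swCone_eq : swCone p q =
    profileSurface p q (fun r => (√((p : ℝ) + q))⁻¹ * r) fun r => (√((p : ℝ) + q))⁻¹ * r := by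
  ext1 u
  rw [swCone, swCurve, profileSurface, Real.sqrt_div (Nat.cast_nonneg _),
    Real.sqrt_div (Nat.cast_nonneg _)]
  apply C2_ext <;> simp [pos] <;> ring

lemma flow_zero {s : ℝ} (hs : 0 ≤ s) :
    flowFst p q 0 s = s ∧ flowSnd p q 0 s = s ∧ flowSpeed p q 0 s = s := by
  simp [flowFst, flowSnd, flowSpeed, Real.sqrt_sq hs]

/-- The cone's parameter r and s differ by the factor 1/√(p + q). The linear profile does not
satisfy f' = g, so the facts on hyperbolic profiles do not apply: its r-derivative is r⁻¹ times
`radial`. -/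
lemma surfaceMeasure_swCone (hq : 0 < q) (hqp : q < p) :
    surfaceMeasure (swCone p q) halfStrip = flowMeasure p q 0 := by
  have hp := hq.trans hqp
  have hp' : (0 : ℝ) < p := by exact_mod_cast hp
  have hq' : (0 : ℝ) < q := by exact_mod_cast hq
  set b : ℝ := (√((p : ℝ) + q))⁻¹ with hb_def
  have hb : 0 < b := inv_pos.2 (Real.sqrt_pos.2 (by positivity))
  have hcone : swCone p q = profileSurface p q (fun r => b * r) fun r => b * r := swCone_eq
  have hd : ∀ r, HasDerivAt (fun r => b * r) b r := fun r => by
    simpa using (hasDerivAt_id r).const_mul b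
  have hdiff : Differentiable ℝ (swCone p q) := by
    rw [hcone]
    refine (contDiff_frame contDiff_snd ?_ ?_).differentiable (by simp)
    · exact Complex.ofRealCLM.contDiff.comp (contDiff_const.mul (contDiff_const.mul contDiff_fst))
    · exact Complex.ofRealCLM.contDiff.comp (contDiff_const.mul (contDiff_const.mul contDiff_fst))
  have h0 : ∀ u : ℝ × ℝ, 0 < u.1 →
      pd 0 (swCone p q) u = u.1⁻¹ • radial p q (b * u.1) (b * u.1) u.2 := by
    intro u hu
    rw [radial, smul_pos, mul_left_comm, inv_mul_cancel₀ hu.ne', mul_one]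
    refine pd_zero_eq (hdiff u) ?_
    rw [hcone]
    exact hasDerivAt_pos u.2 (hd u.1) (hd u.1)
  have h1 : ∀ u : ℝ × ℝ, pd 1 (swCone p q) u = angular p q (b * u.1) (b * u.1) u.2 := by
    intro u
    refine pd_one_eq (hdiff u) ?_
    rw [hcone]
    exact hasDerivAt_pos_angle (f := b * u.1) (g := b * u.1) u.2
  refine surfaceMeasure_eq_flowMeasure (s := fun r => b * r) (s' := fun _ => b) ?_ ?_ ?_ ?_ ?_ ?_
    ?_ ?_ ?_
  · exact (continuous_const.mul continuous_id).measurable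
  · exact measurable_const
  · exact fun r _ => hd r
  · exact fun r _ => hb.le
  · exact fun r _ r' _ h => mul_left_cancel₀ hb.ne' h
  · ext x
    constructor
    · rintro ⟨r, hr, rfl⟩
      exact mul_pos hb hr
    · exact fun hx => ⟨x / b, div_pos hx hb, mul_div_cancel₀ _ hb.ne'⟩
  · intro u hu
    obtain ⟨e1, e2, -⟩ := flow_zero (p := p) (q := q) (mul_pos hb hu).le
    rw [flowPos, e1, e2, hcone, profileSurface]
  · intro u hu
    obtain ⟨e1, e2, e3⟩ := flow_zero (p := p) (q := q) (mul_pos hb hu).le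
    rw [areaDensity_eq (inv_pos.2 hu).le (h0 u hu) (h1 u), flowDensity, flowEnergy, e1, e2, e3]
    field_simp
  · intro u hu
    obtain ⟨e1, e2, -⟩ := flow_zero (p := p) (q := q) (mul_pos hb hu).le
    rw [tangentProj_eq hp hq (energy_pos _ _ hp hq (Or.inl (mul_pos hb hu).ne')).ne'
      (inv_pos.2 hu).ne' (h0 u hu) (h1 u), flowPlane, e1, e2]

lemma isVarifoldOf_swCone (hq : 0 < q) (hqp : q < p) (hpq : Nat.Coprime p q) :
    IsVarifoldOf (flowVarifold hq hqp 0) (swCone p q) halfStrip := by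
  refine ⟨?_, (surfaceMeasure_swCone hq hqp).symm⟩
  have hq' : (0 : ℝ) < q := by exact_mod_cast hq
  have hb : 0 < (√((p : ℝ) + q))⁻¹ := inv_pos.2 (Real.sqrt_pos.2 (by positivity))
  rw [swCone_eq]
  exact injOn_profileSurface hq hqp hpq (fun r hr => mul_pos hb hr) (fun r hr => mul_pos hb hr)
    fun r _ r' _ h => mul_left_cancel₀ hb.ne' h

end Slices

/-! ### Integrals over the slices pulled back to the strip. -/

section Integrals

variable {p q : ℕ} {t : ℝ} (hq : 0 < q) (hqp : q < p)

lemma weight_flowVarifold (t : ℝ) :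
    (flowVarifold hq hqp t).weight = (flowArea p q t).map (flowPos p q t) := by
  change (flowMeasure p q t).map Prod.fst = _
  rw [flowMeasure, Measure.map_map measurable_fst (measurable_flowMap t)]
  rfl

lemma integral_flowArea (t : ℝ) (G : ℝ × ℝ → ℝ) :
    ∫ u, G u ∂flowArea p q t = ∫ u in openStrip, flowDensity p q t u.1 * G u := by
  rw [flowArea, integral_withDensity_eq_integral_toReal_smul (measurable_ofReal_flowDensity t)
    (Eventually.of_forall fun _ => ENNReal.ofReal_lt_top)]
  simp only [ENNReal.toReal_ofReal flowDensity_nonneg, smul_eq_mul]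

lemma integral_flowMeasure (t : ℝ) {f : C2 × (C2 →L[ℝ] C2) → ℝ} (hf : Measurable f) :
    ∫ z, f z ∂flowMeasure p q t =
      ∫ u in openStrip, flowDensity p q t u.1 * f (flowPos p q t u, flowPlane p q t u) := by
  rw [flowMeasure, integral_map (measurable_flowMap t).aemeasurable hf.aestronglyMeasurable,
    integral_flowArea]

lemma integral_weight (t : ℝ) {f : C2 → ℝ} (hf : Measurable f) :
    ∫ x, f x ∂(flowVarifold hq hqp t).weight =
      ∫ u in openStrip, flowDensity p q t u.1 * f (flowPos p q t u) := by
  rw [weight_flowVarifold, integral_map (continuous_flowPos_right t).measurable.aemeasurable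
    hf.aestronglyMeasurable, integral_flowArea]

lemma lintegral_weight (t : ℝ) {f : C2 → ℝ≥0∞} (hf : Measurable f) :
    ∫⁻ x, f x ∂(flowVarifold hq hqp t).weight =
      ∫⁻ u in openStrip, ENNReal.ofReal (flowDensity p q t u.1) * f (flowPos p q t u) := by
  have hm : Measurable fun u => f (flowPos p q t u) :=
    hf.comp (continuous_flowPos_right t).measurable
  rw [weight_flowVarifold, lintegral_map hf (continuous_flowPos_right t).measurable, flowArea,
    lintegral_withDensity_eq_lintegral_mul _ (measurable_ofReal_flowDensity t) hm]
  rfl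

lemma integrable_weight (t : ℝ) {f : C2 → ℝ} (hf : Measurable f)
    (h : IntegrableOn (fun u => flowDensity p q t u.1 * f (flowPos p q t u)) openStrip) :
    Integrable f (flowVarifold hq hqp t).weight := by
  rw [weight_flowVarifold, integrable_map_measure hf.aestronglyMeasurable
    (continuous_flowPos_right t).measurable.aemeasurable, flowArea,
    integrable_withDensity_iff_integrable_smul' (measurable_ofReal_flowDensity t)
      (Eventually.of_forall fun _ => ENNReal.ofReal_lt_top)]
  simp only [ENNReal.toReal_ofReal flowDensity_nonneg, smul_eq_mul]
  exact h

lemma exists_bound_of_hasCompactSupport {E F : Type*} [NormedAddCommGroup E]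
    [NormedAddCommGroup F] {f : E → F} (hf : Continuous f) (hs : HasCompactSupport f) :
    ∃ C R : ℝ, 0 ≤ C ∧ (∀ x, ‖f x‖ ≤ C) ∧ ∀ x, R < ‖x‖ → f x = 0 := by
  obtain ⟨C, hC⟩ := hs.exists_bound_of_continuous hf
  obtain ⟨R, hR⟩ := hs.isCompact.isBounded.subset_closedBall 0
  refine ⟨C, R, (norm_nonneg _).trans (hC 0), hC, fun x hx => ?_⟩
  by_contra h
  exact absurd (mem_closedBall_zero_iff.1 (hR (subset_tsupport f h))) hx.not_ge

end Integrals

/-! ### The first variation formula for every slice, including the cone. -/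

section FirstVariation

variable {p q : ℕ} {t : ℝ}

lemma trace_planeProj_comp (f g θ : ℝ) (A : C2 →L[ℝ] C2) :
    LinearMap.trace ℝ C2 ((planeProj p q f g θ ∘L A : C2 →L[ℝ] C2) : C2 →ₗ[ℝ] C2) =
      (energy p q f g)⁻¹ * (inner ℝ (radial p q f g θ) (A (radial p q f g θ)) +
        ((p : ℝ) * q)⁻¹ * inner ℝ (angular p q f g θ) (A (angular p q f g θ))) := by
  have h : ((planeProj p q f g θ ∘L A : C2 →L[ℝ] C2) : C2 →ₗ[ℝ] C2) =
      (energy p q f g)⁻¹ • ((((innerSL ℝ (radial p q f g θ)) ∘L A : C2 →L[ℝ] ℝ) :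
          C2 →ₗ[ℝ] ℝ).smulRight (radial p q f g θ) +
        ((p : ℝ) * q)⁻¹ • (((innerSL ℝ (angular p q f g θ)) ∘L A : C2 →L[ℝ] ℝ) :
          C2 →ₗ[ℝ] ℝ).smulRight (angular p q f g θ)) := by
    ext1 v
    simp [planeProj]
  rw [h, map_smul, map_add, map_smul, LinearMap.trace_smulRight, LinearMap.trace_smulRight]
  simp

lemma norm_pos_le {f g θ m : ℝ} (hf : |f| ≤ m) (hg : |g| ≤ m) :
    ‖pos p q f g θ‖ ≤ √((p : ℝ) + q) * m := by
  have h0 := (abs_nonneg f).trans hf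
  have h1 : f ^ 2 ≤ m ^ 2 := sq_le_sq' (by linarith [(abs_le.1 hf).1]) (abs_le.1 hf).2
  have h2 : g ^ 2 ≤ m ^ 2 := sq_le_sq' (by linarith [(abs_le.1 hg).1]) (abs_le.1 hg).2
  rw [← abs_of_nonneg (norm_nonneg (pos p q f g θ))]
  apply abs_le_of_sq_le_sq _ (mul_nonneg (Real.sqrt_nonneg _) h0)
  rw [norm_sq_pos, mul_pow, Real.sq_sqrt (by positivity), add_mul, add_comm]
  gcongr

/-- The derivative is s/f, and fg = sk rewrites it as g/k. This is the profile equation f' = g after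
the change of parameter ds = k dμ. -/
lemma hasDerivAt_flowFst (hq : 0 < q) (hqp : q < p) {s : ℝ} (hs : 0 < s) :
    HasDerivAt (flowFst p q t) ((flowSpeed p q t s)⁻¹ * flowSnd p q t s) s := by
  have hf := flowFst_pos (p := p) (q := q) (t := t) hs
  have hk := (flowSpeed_pos (t := t) hq hqp hs).ne'
  have h := ((hasDerivAt_pow 2 s).add_const (max (-t / swConst p q) 0)).sqrt
    (Real.sqrt_pos.1 hf).ne'
  refine h.congr_deriv ?_
  change _ / (2 * flowFst p q t s) = _
  have := flow_mul (t := t) hq hqp hs.le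
  field_simp
  linear_combination (-2) * this

lemma hasDerivAt_flowSnd (hq : 0 < q) (hqp : q < p) {s : ℝ} (hs : 0 < s) :
    HasDerivAt (flowSnd p q t) ((flowSpeed p q t s)⁻¹ * flowFst p q t s) s := by
  have hg := flowSnd_pos (p := p) (q := q) (t := t) hs
  have hk := (flowSpeed_pos (t := t) hq hqp hs).ne'
  have h := ((hasDerivAt_pow 2 s).add_const (max (t / swConst p q) 0)).sqrt
    (Real.sqrt_pos.1 hg).ne'
  refine h.congr_deriv ?_
  change _ / (2 * flowSnd p q t s) = _
  have := flow_mul (t := t) hq hqp hs.le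
  field_simp
  linear_combination (-2) * this

/-- `radial` in the common parametrization. -/
def flowRadial (p q : ℕ) (t : ℝ) (u : ℝ × ℝ) : C2 :=
  radial p q (flowFst p q t u.1) (flowSnd p q t u.1) u.2

/-- `angular` in the common parametrization. -/
def flowAngular (p q : ℕ) (t : ℝ) (u : ℝ × ℝ) : C2 :=
  angular p q (flowFst p q t u.1) (flowSnd p q t u.1) u.2

/-- The `θ`-derivative of `flowAngular`. -/
def flowAngularDeriv (p q : ℕ) (t : ℝ) (u : ℝ × ℝ) : C2 :=
  -pos p q (p ^ 2 * flowFst p q t u.1) (q ^ 2 * flowSnd p q t u.1) u.2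

lemma continuous_profile_right (p q : ℕ) (t : ℝ) : Continuous fun u : ℝ × ℝ =>
    (flowFst p q t u.1, flowSnd p q t u.1, u.2) :=
  (continuous_profile p q).comp (f := fun u : ℝ × ℝ => (t, u)) (by fun_prop)

lemma continuous_flowRadial : Continuous (flowRadial p q t) :=
  (continuous_radial p q).comp (continuous_profile_right p q t)

lemma continuous_flowAngular : Continuous (flowAngular p q t) :=
  (continuous_angular p q).comp (continuous_profile_right p q t)

lemma continuous_flowAngularDeriv : Continuous (flowAngularDeriv p q t) := by
  have h1 : Continuous fun x : ℝ × ℝ × ℝ =>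
      ((p : ℝ) ^ 2 * x.1, (q : ℝ) ^ 2 * x.2.1, x.2.2) := by fun_prop
  have h2 := ((continuous_pos p q).comp (h1.comp (continuous_profile_right p q t))).neg
  have h3 : flowAngularDeriv p q t = -((fun x : ℝ × ℝ × ℝ => pos p q x.1 x.2.1 x.2.2) ∘
      (fun x : ℝ × ℝ × ℝ => ((p : ℝ) ^ 2 * x.1, (q : ℝ) ^ 2 * x.2.1, x.2.2)) ∘
        fun u : ℝ × ℝ => (flowFst p q t u.1, flowSnd p q t u.1, u.2)) := by
    ext1 u; rfl
  rw [h3]; exact h2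

lemma hasDerivAt_flowPos (hq : 0 < q) (hqp : q < p) {u : ℝ × ℝ} (hu : 0 < u.1) :
    HasDerivAt (fun s => flowPos p q t (s, u.2)) ((flowSpeed p q t u.1)⁻¹ • flowRadial p q t u)
      u.1 := by
  rw [flowRadial, radial, smul_pos]
  exact hasDerivAt_pos u.2 (hasDerivAt_flowFst hq hqp hu) (hasDerivAt_flowSnd hq hqp hu)

lemma hasDerivAt_flowRadial (hq : 0 < q) (hqp : q < p) {u : ℝ × ℝ} (hu : 0 < u.1) :
    HasDerivAt (fun s => flowRadial p q t (s, u.2)) ((flowSpeed p q t u.1)⁻¹ • flowPos p q t u)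
      u.1 := by
  rw [flowPos, smul_pos]
  exact hasDerivAt_pos u.2 (hasDerivAt_flowSnd hq hqp hu) (hasDerivAt_flowFst hq hqp hu)

lemma norm_flowRadial_sq (u : ℝ × ℝ) : ‖flowRadial p q t u‖ ^ 2 = flowEnergy p q t u.1 := by
  rw [← real_inner_self_eq_norm_sq]; exact inner_radial_radial _ _ _

lemma norm_flowAngular_sq (u : ℝ × ℝ) :
    ‖flowAngular p q t u‖ ^ 2 = p * q * flowEnergy p q t u.1 := by
  rw [← real_inner_self_eq_norm_sq]; exact inner_angular_angular _ _ _

lemma norm_flowAngularDeriv_le (hq : 0 < q) (hqp : q < p) (u : ℝ × ℝ) :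
    ‖flowAngularDeriv p q t u‖ ≤ √((p : ℝ) + q) * (p ^ 2 * flowSpeed p q t u.1) := by
  have h : (q : ℝ) ≤ p := by exact_mod_cast hqp.le
  rw [flowAngularDeriv, norm_neg]
  apply norm_pos_le
  · rw [abs_of_nonneg (mul_nonneg (by positivity) flowFst_nonneg)]
    exact mul_le_mul_of_nonneg_left (flowFst_le hq hqp) (by positivity)
  · rw [abs_of_nonneg (mul_nonneg (by positivity) flowSnd_nonneg)]
    exact mul_le_mul (by gcongr) (flowSnd_le hq hqp) flowSnd_nonneg (by positivity)

lemma abs_inner_apply_le (v : C2) (A : C2 →L[ℝ] C2) : |inner ℝ v (A v)| ≤ ‖A‖ * ‖v‖ ^ 2 := by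
  calc |inner ℝ v (A v)| ≤ ‖v‖ * ‖A v‖ := abs_real_inner_le_norm _ _
    _ ≤ ‖v‖ * (‖A‖ * ‖v‖) := by gcongr; exact A.le_opNorm v
    _ = _ := by ring

lemma integrableOn_Ioi_of_bound {G : ℝ → ℝ} (hm : Measurable G) {C R : ℝ}
    (h1 : ∀ s > 0, |G s| ≤ C) (h2 : ∀ s > 0, R < s → G s = 0) : IntegrableOn G (Ioi 0) := by
  have hi : IntegrableOn ((Iic R).indicator fun _ => C) (Ioi 0) := by
    rw [IntegrableOn, integrable_indicator_iff measurableSet_Iic, IntegrableOn,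
      Measure.restrict_restrict measurableSet_Iic]
    refine integrableOn_const ?_
    refine ((measure_mono (?_ : _ ⊆ Icc 0 R)).trans_lt measure_Icc_lt_top).ne
    exact fun s hs => ⟨le_of_lt hs.2, hs.1⟩
  refine hi.mono' hm.aestronglyMeasurable ((ae_restrict_mem measurableSet_Ioi).mono fun s hs => ?_)
  by_cases h : s ≤ R
  · rw [indicator_of_mem (by exact h)]; exact h1 s hs
  · rw [indicator_of_notMem (by exact h), h2 s hs (not_le.1 h), norm_zero]

variable {W : C2 → C2}

/-- The part of the divergence that is a total derivative in the radial parameter. -/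
def radialTerm (p q : ℕ) (t : ℝ) (W : C2 → C2) (u : ℝ × ℝ) : ℝ :=
  (flowSpeed p q t u.1)⁻¹ *
    (inner ℝ (flowRadial p q t u) (fderiv ℝ W (flowPos p q t u) (flowRadial p q t u)) +
      inner ℝ (W (flowPos p q t u)) (flowPos p q t u))

/-- The part of the divergence that is a total derivative in the angle. -/
def angularTerm (p q : ℕ) (t : ℝ) (W : C2 → C2) (u : ℝ × ℝ) : ℝ :=
  (flowSpeed p q t u.1)⁻¹ *
    (inner ℝ (flowAngular p q t u) (fderiv ℝ W (flowPos p q t u) (flowAngular p q t u)) +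
      inner ℝ (W (flowPos p q t u)) (flowAngularDeriv p q t u))

lemma measurable_flowSpeed_inv : Measurable fun u : ℝ × ℝ => (flowSpeed p q t u.1)⁻¹ :=
  ((measurable_flowSpeed t).comp measurable_fst).inv

lemma measurable_radialTerm (hW : ContDiff ℝ 1 W) : Measurable (radialTerm p q t W) := by
  have h1 := (hW.continuous_fderiv one_ne_zero).comp (continuous_flowPos_right (p := p) (q := q) t)
  have h2 := hW.continuous.comp (continuous_flowPos_right (p := p) (q := q) t)
  have h3 := continuous_flowRadial (p := p) (q := q) (t := t)
  exact measurable_flowSpeed_inv.mul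
    ((h3.inner (h1.clm_apply h3)).add (h2.inner (continuous_flowPos_right t))).measurable

lemma measurable_angularTerm (hW : ContDiff ℝ 1 W) : Measurable (angularTerm p q t W) := by
  have h1 := (hW.continuous_fderiv one_ne_zero).comp (continuous_flowPos_right (p := p) (q := q) t)
  have h2 := hW.continuous.comp (continuous_flowPos_right (p := p) (q := q) t)
  have h3 := continuous_flowAngular (p := p) (q := q) (t := t)
  exact measurable_flowSpeed_inv.mul
    ((h3.inner (h1.clm_apply h3)).add (h2.inner continuous_flowAngularDeriv)).measurable

/-- The factor k⁻¹ in front is harmless: squared lengths of the tangent vectors are O(k²), and the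
position and the second derivative are O(k). -/
lemma exists_bound_divergence (hq : 0 < q) (hqp : q < p) (hW : ContDiff ℝ 1 W)
    (hs : HasCompactSupport W) (t : ℝ) : ∃ C R : ℝ, ∀ u : ℝ × ℝ, 0 < u.1 →
      (|radialTerm p q t W u| ≤ C ∧ |angularTerm p q t W u| ≤ C) ∧
      (R < u.1 → radialTerm p q t W u = 0 ∧ angularTerm p q t W u = 0) := by
  obtain ⟨C₁, R₁, hC₁, hb₁, hz₁⟩ := exists_bound_of_hasCompactSupport hW.continuous hs
  obtain ⟨C₂, R₂, hC₂, hb₂, hz₂⟩ := exists_bound_of_hasCompactSupport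
    (hW.continuous_fderiv one_ne_zero) (hs.fderiv ℝ)
  set R := max R₁ R₂
  set K := √(R ^ 2 + |t| / swConst p q)
  set X := C₂ * ((p + q) * K) + C₁ * √((p : ℝ) + q)
  set Y := C₂ * (p * q * ((p + q) * K)) + C₁ * (√((p : ℝ) + q) * p ^ 2)
  have hX : 0 ≤ X := by positivity
  have hY : 0 ≤ Y := by positivity
  refine ⟨X + Y, R, fun u hu => ?_⟩
  have hzero : R < u.1 → radialTerm p q t W u = 0 ∧ angularTerm p q t W u = 0 := by
    intro h
    have h' := h.trans_le (le_norm_flowPos (t := t) hq u (p := p))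
    rw [radialTerm, angularTerm, hz₁ _ ((le_max_left _ _).trans_lt h'),
      hz₂ _ ((le_max_right _ _).trans_lt h')]
    simp
  refine ⟨?_, hzero⟩
  by_cases h : u.1 ≤ R
  swap
  · obtain ⟨h1, h2⟩ := hzero (not_le.1 h)
    rw [h1, h2, abs_zero]
    exact ⟨add_nonneg hX hY, add_nonneg hX hY⟩
  have hk := flowSpeed_pos (t := t) hq hqp hu
  have hkK : flowSpeed p q t u.1 ≤ K := flowSpeed_le hq hqp hu.le le_rfl h
  -- One factor k of (p + q)k² is replaced by its bound K on the support; the other must stay to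
  -- cancel k⁻¹.
  have hE : flowEnergy p q t u.1 ≤ (p + q) * K * flowSpeed p q t u.1 :=
    (flowEnergy_le hq hqp).trans (by rw [sq, ← mul_assoc]; gcongr)
  constructor
  · refine le_trans ?_ (le_add_of_nonneg_right hY)
    rw [radialTerm, abs_mul, abs_of_pos (inv_pos.2 hk), inv_mul_le_iff₀ hk]
    refine (abs_add_le _ _).trans ?_
    have h1 := (abs_inner_apply_le (flowRadial p q t u) (fderiv ℝ W (flowPos p q t u))).trans
      (mul_le_mul (hb₂ _) ((norm_flowRadial_sq u).trans_le hE) (sq_nonneg _) hC₂)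
    have h2 := (abs_real_inner_le_norm (W (flowPos p q t u)) (flowPos p q t u)).trans
      (mul_le_mul (hb₁ _) (norm_flowPos_le hq hqp u) (norm_nonneg _) hC₁)
    exact (add_le_add h1 h2).trans_eq (by simp only [X]; ring)
  · refine le_trans ?_ (le_add_of_nonneg_left hX)
    rw [angularTerm, abs_mul, abs_of_pos (inv_pos.2 hk), inv_mul_le_iff₀ hk]
    refine (abs_add_le _ _).trans ?_
    have h1 := (abs_inner_apply_le (flowAngular p q t u) (fderiv ℝ W (flowPos p q t u))).trans
      (mul_le_mul (hb₂ _) ((norm_flowAngular_sq u).trans_le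
        (mul_le_mul_of_nonneg_left hE (by positivity))) (sq_nonneg _) hC₂)
    have h2 := (abs_real_inner_le_norm (W (flowPos p q t u)) (flowAngularDeriv p q t u)).trans
      (mul_le_mul (hb₁ _) (norm_flowAngularDeriv_le hq hqp u) (norm_nonneg _) hC₁)
    exact (add_le_add h1 h2).trans_eq (by simp only [Y]; ring)

lemma integrableOn_radialTerm (hq : 0 < q) (hqp : q < p) (hW : ContDiff ℝ 1 W)
    (hs : HasCompactSupport W) (t : ℝ) : IntegrableOn (radialTerm p q t W) openStrip := by
  obtain ⟨C, R, h⟩ := exists_bound_divergence hq hqp hW hs t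
  exact integrableOn_openStrip (measurable_radialTerm hW).aestronglyMeasurable
    (fun u hu => (h u hu.1).1.1) (fun u hu hR => ((h u hu.1).2 hR).1)

lemma integrableOn_angularTerm (hq : 0 < q) (hqp : q < p) (hW : ContDiff ℝ 1 W)
    (hs : HasCompactSupport W) (t : ℝ) : IntegrableOn (angularTerm p q t W) openStrip := by
  obtain ⟨C, R, h⟩ := exists_bound_divergence hq hqp hW hs t
  exact integrableOn_openStrip (measurable_angularTerm hW).aestronglyMeasurable
    (fun u hu => (h u hu.1).1.2) (fun u hu hR => ((h u hu.1).2 hR).2)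

lemma flow_zero_mul (hq : 0 < q) (hqp : q < p) : flowFst p q t 0 * flowSnd p q t 0 = 0 := by
  rw [flow_mul hq hqp le_rfl, zero_mul]

/-- The term is the s-derivative of ⟨W, `flowRadial`⟩, so each ray leaves its value at s = 0.
Integrated over θ, these are the conormal contributions that cancel. -/
lemma integral_radialTerm (hq : 1 < q) (hqp : q < p) (hpq : Nat.Coprime p q)
    (hW : ContDiff ℝ 1 W) (hs : HasCompactSupport W) :
    ∫ u in openStrip, radialTerm p q t W u = 0 := by
  have hq0 : 0 < q := by omega
  obtain ⟨C, R, hb⟩ := exists_bound_divergence hq0 hqp hW hs t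
  obtain ⟨-, R₁, -, -, hz₁⟩ := exists_bound_of_hasCompactSupport hW.continuous hs
  have hinner : ∀ θ : ℝ, ∫ s in Ioi 0, radialTerm p q t W (s, θ) =
      0 - inner ℝ (W (flowPos p q t (0, θ))) (flowRadial p q t (0, θ)) := by
    intro θ
    have hcont : Continuous fun s : ℝ =>
        inner ℝ (W (flowPos p q t (s, θ))) (flowRadial p q t (s, θ)) :=
      ((hW.continuous.comp (continuous_flowPos_right t)).inner continuous_flowRadial).comp
        (f := fun s : ℝ => (s, θ)) (by fun_prop)
    -- The derivative is used only for s > 0, where k > 0 even at t = 0. At the endpoint continuity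
    -- suffices, and compact support gives the limit at infinity.
    refine integral_Ioi_of_hasDerivAt_of_tendsto
      (f := fun s => inner ℝ (W (flowPos p q t (s, θ))) (flowRadial p q t (s, θ)))
      hcont.continuousWithinAt (fun s hs => ?_) ?_ ?_
    · have h1 := (hW.differentiable one_ne_zero (flowPos p q t (s, θ))).hasFDerivAt.comp_hasDerivAt
        s (hasDerivAt_flowPos (u := (s, θ)) hq0 hqp hs)
      have h2 := h1.inner ℝ (hasDerivAt_flowRadial (t := t) (u := (s, θ)) hq0 hqp hs)
      refine h2.congr_deriv ?_
      rw [radialTerm, map_smul, inner_smul_right, inner_smul_left, conj_trivial,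
        real_inner_comm (flowRadial p q t (s, θ)), mul_add, add_comm]
      rfl
    · exact integrableOn_Ioi_of_bound ((measurable_radialTerm hW).comp
        (measurable_id.prodMk measurable_const)) (fun s hs => (hb (s, θ) hs).1.1)
        (fun s hs hR => ((hb (s, θ) hs).2 hR).1)
    · refine tendsto_const_nhds.congr' ?_
      filter_upwards [eventually_gt_atTop R₁] with s hs
      rw [hz₁ _ (hs.trans_le (le_norm_flowPos hq0 (s, θ))), inner_zero_left]
  have hpi := Real.two_pi_pos.le
  rw [openStrip, Measure.volume_eq_prod, ← Measure.prod_restrict, integral_prod_symm]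
  · simp only [hinner]
    have h0 := integral_inner_radial_eq_zero hq hqp hpq (flow_zero_mul (t := t) hq0 hqp)
      hW.continuous
    rw [intervalIntegral.integral_of_le hpi, ← integral_Ico_eq_integral_Ioc] at h0
    simp only [zero_sub]
    rw [integral_neg, neg_eq_zero]
    exact h0
  · rw [Measure.prod_restrict]
    exact integrableOn_radialTerm hq0 hqp hW hs t

/-- At fixed s the term is k⁻¹ times the θ-derivative of a 2π-periodic function. -/
lemma integral_angularTerm (hq : 0 < q) (hqp : q < p) (hW : ContDiff ℝ 1 W)
    (hs : HasCompactSupport W) : ∫ u in openStrip, angularTerm p q t W u = 0 := by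
  have hpi := Real.two_pi_pos.le
  have hinner : ∀ s : ℝ, ∫ θ in Ico 0 (2 * Real.pi), angularTerm p q t W (s, θ) = 0 := by
    intro s
    simp only [angularTerm]
    rw [integral_const_mul, integral_Ico_eq_integral_Ioc, ← intervalIntegral.integral_of_le hpi,
      intervalIntegral.integral_eq_sub_of_hasDerivAt
        (f := fun θ => inner ℝ (W (flowPos p q t (s, θ))) (flowAngular p q t (s, θ)))]
    · have h1 : ∀ θ : ℝ, flowPos p q t (s, θ + 2 * Real.pi) = flowPos p q t (s, θ) := fun θ =>
        frame_add_two_pi θ _ _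
      have h2 : ∀ θ : ℝ, flowAngular p q t (s, θ + 2 * Real.pi) = flowAngular p q t (s, θ) :=
        fun θ => frame_add_two_pi θ _ _
      have h1' := h1 0
      have h2' := h2 0
      rw [zero_add] at h1' h2'
      rw [h1', h2', sub_self, mul_zero]
    · intro θ _
      have h1 := (hW.differentiable one_ne_zero (flowPos p q t (s, θ))).hasFDerivAt.comp_hasDerivAt
        θ (hasDerivAt_pos_angle (p := p) (q := q) (f := flowFst p q t s) (g := flowSnd p q t s) θ)
      have h2 := h1.inner ℝ (hasDerivAt_angular_angle (p := p) (q := q) (f := flowFst p q t s)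
        (g := flowSnd p q t s) θ)
      refine h2.congr_deriv ?_
      rw [add_comm, real_inner_comm]
      rfl
    · refine Continuous.intervalIntegrable ?_ _ _
      have h0 : Continuous fun θ : ℝ => (s, θ) := by fun_prop
      have h1 := ((hW.continuous_fderiv one_ne_zero).comp
        (continuous_flowPos_right (p := p) (q := q) t)).comp h0
      have h2 := (hW.continuous.comp (continuous_flowPos_right (p := p) (q := q) t)).comp h0
      have h3 := (continuous_flowAngular (p := p) (q := q) (t := t)).comp h0
      have h4 := (continuous_flowAngularDeriv (p := p) (q := q) (t := t)).comp h0
      exact (h3.inner (h1.clm_apply h3)).add (h2.inner h4)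
  rw [openStrip, Measure.volume_eq_prod, setIntegral_prod _
    (integrableOn_angularTerm hq hqp hW hs t)]
  simp only [hinner, integral_zero]

lemma measurable_curvatureField : Measurable (curvatureField p q) := by
  unfold curvatureField
  have h0 : Measurable fun z : C2 => z 0 := (PiLp.continuous_apply 2 _ 0).measurable
  have h1 : Measurable fun z : C2 => z 1 := (PiLp.continuous_apply 2 _ 1).measurable
  have h2 : Continuous fun z : C2 => (!₂[-(((q : ℝ)⁻¹ : ℝ) * z 0),
      (((p : ℝ)⁻¹ : ℝ) * z 1)] : C2) := by
    refine (PiLp.continuous_toLp 2 _).comp (continuous_pi fun i => ?_)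
    fin_cases i <;> simp <;> fun_prop
  have h3 : Measurable fun z : C2 =>
      ((p : ℝ) - q) * (p * ‖z 0‖ ^ 2 / q + q * ‖z 1‖ ^ 2 / p)⁻¹ :=
    measurable_const.mul ((((h0.norm.pow_const 2).const_mul _).div_const _).add
      (((h1.norm.pow_const 2).const_mul _).div_const _)).inv
  exact h3.smul h2.measurable

/-- Integration by parts in pointwise form. The product rule adds W paired with the second
derivatives of the position, and `pos_add_angular_deriv` identifies their conformal sum as E times
h. -/
lemma divergence_eq (hq : 0 < q) (hqp : q < p) {u : ℝ × ℝ} (hu : 0 < u.1) :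
    flowDensity p q t u.1 * LinearMap.trace ℝ C2 ((flowPlane p q t u ∘L
      fderiv ℝ W (flowPos p q t u) : C2 →L[ℝ] C2) : C2 →ₗ[ℝ] C2) +
    flowDensity p q t u.1 * inner ℝ (curvatureField p q (flowPos p q t u)) (W (flowPos p q t u)) =
      √((p : ℝ) * q) * radialTerm p q t W u +
        √((p : ℝ) * q) * ((p : ℝ) * q)⁻¹ * angularTerm p q t W u := by
  have hE := (flowEnergy_pos (t := t) hq hqp hu).ne'
  have key := congrArg (fun v => inner ℝ (W (flowPos p q t u)) v)
    (pos_add_angular_deriv u.2 (hq.trans hqp) hq hE)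
  simp only [inner_add_right, inner_smul_right] at key
  change inner ℝ _ (flowPos p q t u) + _ * inner ℝ _ (flowAngularDeriv p q t u) =
    flowEnergy p q t u.1 * inner ℝ _ (curvatureField p q (flowPos p q t u)) at key
  rw [flowPlane, trace_planeProj_comp, real_inner_comm (W _), radialTerm, angularTerm, flowDensity]
  change √((p : ℝ) * q) * flowEnergy p q t u.1 / _ * ((flowEnergy p q t u.1)⁻¹ *
    (inner ℝ (flowRadial p q t u) (fderiv ℝ W (flowPos p q t u) (flowRadial p q t u)) +
      _ * inner ℝ (flowAngular p q t u) (fderiv ℝ W (flowPos p q t u) (flowAngular p q t u)))) +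
    _ = _
  have hcancel : flowEnergy p q t u.1 * (flowEnergy p q t u.1)⁻¹ = 1 := mul_inv_cancel₀ hE
  linear_combination (√((p : ℝ) * q) * (flowSpeed p q t u.1)⁻¹ *
    (inner ℝ (flowRadial p q t u) (fderiv ℝ W (flowPos p q t u) (flowRadial p q t u)) +
      ((p : ℝ) * q)⁻¹ * inner ℝ (flowAngular p q t u)
        (fderiv ℝ W (flowPos p q t u) (flowAngular p q t u)))) * hcancel -
    √((p : ℝ) * q) * (flowSpeed p q t u.1)⁻¹ * key

lemma integrableOn_inner_curvatureField (hq : 0 < q) (hqp : q < p) {Y : C2 → C2}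
    (hY : Continuous Y) (hs : HasCompactSupport Y) (t : ℝ) :
    IntegrableOn (fun u => flowDensity p q t u.1 *
      inner ℝ (curvatureField p q (flowPos p q t u)) (Y (flowPos p q t u))) openStrip := by
  obtain ⟨C, R, hC, hb, hz⟩ := exists_bound_of_hasCompactSupport hY hs
  have hpos := continuous_flowPos_right (p := p) (q := q) t
  refine integrableOn_openStrip (C := ((p : ℝ) - q) * √((p : ℝ) + q) * C) (R := R) ?_ ?_ ?_
  · exact (((measurable_flowDensity t).comp measurable_fst).mul
      ((measurable_curvatureField.comp hpos.measurable).inner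
        (hY.comp hpos).measurable)).aestronglyMeasurable
  · intro u hu
    rw [abs_mul, abs_of_nonneg flowDensity_nonneg]
    calc _ ≤ flowDensity p q t u.1 * (‖curvatureField p q (flowPos p q t u)‖ * C) := by
          refine mul_le_mul_of_nonneg_left ?_ flowDensity_nonneg
          exact (abs_real_inner_le_norm _ _).trans (by gcongr; exact hb _)
      _ = flowDensity p q t u.1 * ‖curvatureField p q (flowPos p q t u)‖ * C := by ring
      _ ≤ _ := mul_le_mul_of_nonneg_right (flowDensity_mul_norm_le hq hqp hu.1) hC
  · intro u hu hR
    rw [hz _ (hR.trans_le (le_norm_flowPos hq u)), inner_zero_right, mul_zero]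

lemma firstVariation_eq_integral (hq : 0 < q) (hqp : q < p) (hW : ContDiff ℝ 1 W) (t : ℝ) :
    (flowVarifold hq hqp t).firstVariation W = ∫ u in openStrip, flowDensity p q t u.1 *
      LinearMap.trace ℝ C2 ((flowPlane p q t u ∘L fderiv ℝ W (flowPos p q t u) :
        C2 →L[ℝ] C2) : C2 →ₗ[ℝ] C2) := by
  have hcont : Continuous fun z : C2 × (C2 →L[ℝ] C2) =>
      LinearMap.trace ℝ C2 ((z.2 ∘L fderiv ℝ W z.1 : C2 →L[ℝ] C2) : C2 →ₗ[ℝ] C2) := by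
    have h1 : Continuous fun P : C2 →L[ℝ] C2 => LinearMap.trace ℝ C2 (P : C2 →ₗ[ℝ] C2) :=
      LinearMap.continuous_of_finiteDimensional
        ((LinearMap.trace ℝ C2).comp (ContinuousLinearMap.coeLM ℝ))
    have h2 := hW.continuous_fderiv one_ne_zero
    exact h1.comp (continuous_snd.clm_comp (h2.comp continuous_fst))
  rw [Varifold.firstVariation]
  exact integral_flowMeasure t hcont.measurable

lemma firstVariation_flowVarifold (hq : 1 < q) (hq0 : 0 < q) (hqp : q < p)
    (hpq : Nat.Coprime p q) (hW : ContDiff ℝ 1 W) (hs : HasCompactSupport W) (t : ℝ) :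
    (flowVarifold hq0 hqp t).firstVariation W =
      -∫ x, inner ℝ (curvatureField p q x) (W x) ∂(flowVarifold hq0 hqp t).weight := by
  have hin := integrableOn_inner_curvatureField hq0 hqp hW.continuous hs t
  have hr := integrableOn_radialTerm hq0 hqp hW hs t
  have ha := integrableOn_angularTerm hq0 hqp hW hs t
  rw [firstVariation_eq_integral hq0 hqp hW,
    integral_weight hq0 hqp t (measurable_curvatureField.inner hW.continuous.measurable)]
  have heq : ∀ u ∈ openStrip, flowDensity p q t u.1 * LinearMap.trace ℝ C2 ((flowPlane p q t u ∘L
      fderiv ℝ W (flowPos p q t u) : C2 →L[ℝ] C2) : C2 →ₗ[ℝ] C2) =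
      (√((p : ℝ) * q) * radialTerm p q t W u +
        √((p : ℝ) * q) * ((p : ℝ) * q)⁻¹ * angularTerm p q t W u) -
      flowDensity p q t u.1 *
        inner ℝ (curvatureField p q (flowPos p q t u)) (W (flowPos p q t u)) := fun u hu => by
    rw [← divergence_eq hq0 hqp hu.1, add_sub_cancel_right]
  rw [setIntegral_congr_fun measurableSet_openStrip heq, integral_sub (f := fun u =>
      √((p : ℝ) * q) * radialTerm p q t W u +
        √((p : ℝ) * q) * ((p : ℝ) * q)⁻¹ * angularTerm p q t W u)
    ((hr.const_mul _).add (ha.const_mul _)) hin, integral_add (hr.const_mul _) (ha.const_mul _),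
    integral_const_mul, integral_const_mul, integral_radialTerm hq hqp hpq hW hs,
    integral_angularTerm hq0 hqp hW hs]
  simp

/-- Local integrability comes from the uniform bound on density times |h|, so it includes t = 0: the
vertex carries no singular part of the first variation. -/
lemma isGeneralizedMeanCurvature_flowVarifold (hq : 1 < q) (hq0 : 0 < q) (hqp : q < p)
    (hpq : Nat.Coprime p q) (t : ℝ) :
    (flowVarifold hq0 hqp t).IsGeneralizedMeanCurvature (curvatureField p q) := by
  refine ⟨fun x => ⟨Metric.ball 0 (‖x‖ + 1), Metric.isOpen_ball.mem_nhds (by simp) , ?_⟩,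
    fun W hW hs => firstVariation_flowVarifold hq hq0 hqp hpq hW hs t⟩
  have hpos := continuous_flowPos_right (p := p) (q := q) t
  have hm : Measurable ((Metric.ball (0 : C2) (‖x‖ + 1)).indicator fun y =>
      ‖curvatureField p q y‖) := measurable_curvatureField.norm.indicator measurableSet_ball
  have hi : Integrable ((Metric.ball (0 : C2) (‖x‖ + 1)).indicator fun y =>
      ‖curvatureField p q y‖) (flowVarifold hq0 hqp t).weight := by
    refine integrable_weight hq0 hqp t hm (integrableOn_openStrip
      (C := ((p : ℝ) - q) * √((p : ℝ) + q)) (R := ‖x‖ + 1) ?_ ?_ ?_)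
    · exact (((measurable_flowDensity t).comp measurable_fst).mul
        (hm.comp hpos.measurable)).aestronglyMeasurable
    · intro u hu
      rw [abs_mul, abs_of_nonneg flowDensity_nonneg]
      refine le_trans (mul_le_mul_of_nonneg_left ?_ flowDensity_nonneg)
        (flowDensity_mul_norm_le hq0 hqp hu.1)
      rw [← Real.norm_eq_abs]
      exact (norm_indicator_le_norm_self _ _).trans_eq (norm_norm _)
    · intro u hu hR
      rw [indicator_of_notMem, mul_zero]
      rw [mem_ball_zero_iff, not_lt]
      exact hR.le.trans (le_norm_flowPos hq0 u)
  rw [integrable_indicator_iff measurableSet_ball] at hi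
  exact (integrable_norm_iff measurable_curvatureField.aestronglyMeasurable).1 hi

end FirstVariation

/-! ### Uniqueness of the generalized mean curvature vector. -/

section Uniqueness

variable {m : ℕ} {E : Type*} [NormedAddCommGroup E] [InnerProductSpace ℝ E]
  [FiniteDimensional ℝ E] [MeasurableSpace E] [BorelSpace E] {V : Varifold m E} {h h' : E → E}

/-- Testing with the fields g e, for smooth compactly supported g and constant vectors e, reduces
this to the fundamental lemma of the calculus of variations. -/
lemma ae_eq_of_isGeneralizedMeanCurvature (hh : V.IsGeneralizedMeanCurvature h)
    (hh' : V.IsGeneralizedMeanCurvature h') : h =ᵐ[V.weight] h' := by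
  have hsub := ae_eq_zero_of_integral_contDiff_smul_eq_zero (hh.1.sub hh'.1) (fun g hg hs => by
    refine ext_inner_left ℝ fun e => ?_
    have hi := hh.1.integrable_smul_left_of_hasCompactSupport hg.continuous hs
    have hi' := hh'.1.integrable_smul_left_of_hasCompactSupport hg.continuous hs
    have hW : ContDiff ℝ 1 fun x => g x • e := (hg.of_le (by simp)).smul contDiff_const
    have hWs : HasCompactSupport fun x => g x • e := hs.smul_right
    have h1 := hh.2 _ hW hWs
    rw [hh'.2 _ hW hWs, neg_inj] at h1
    simp only [Pi.sub_apply, smul_sub]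
    rw [integral_sub hi hi', inner_sub_right, ← integral_inner hi, ← integral_inner hi',
      inner_zero_right]
    simp only [inner_smul_right] at h1 ⊢
    simp only [real_inner_comm _ e]
    rw [h1, sub_self])
  exact hsub.mono fun x hx => sub_eq_zero.1 hx

lemma variationAlong_congr (φ : E → ℝ) (hae : h =ᵐ[V.weight] h') :
    V.variationAlong φ h = V.variationAlong φ h' := by
  rw [Varifold.variationAlong, Varifold.variationAlong]
  congr 2
  · exact congrArg _ (lintegral_congr_ae (hae.mono fun x hx => by simp only [hx]))
  · exact integral_congr_ae (hae.mono fun x hx => by simp only [hx])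

lemma brakkeVariation_eq (hh : V.IsGeneralizedMeanCurvature h) (φ : E → ℝ) :
    V.brakkeVariation φ = V.variationAlong φ h := by
  apply le_antisymm
  · exact iSup₂_le fun h' hh' =>
      (variationAlong_congr φ (ae_eq_of_isGeneralizedMeanCurvature hh' hh)).le
  · exact le_iSup₂_of_le h hh le_rfl

end Uniqueness

/-! ### Difference quotients at the singular time. -/

section Slope

/-- A difference quotient at `0` has the limit of the derivatives near `0`, which may be
infinite. -/
lemma tendsto_slope_of_tendsto_deriv {m g : ℝ → ℝ} (hm : Continuous m)
    (hd : ∀ t ≠ 0, HasDerivAt m (g t) t) {L : EReal}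
    (hg : Tendsto (fun t => (g t : EReal)) (𝓝[≠] 0) (𝓝 L)) :
    Tendsto (fun s => (((m s - m 0) / (s - 0) : ℝ) : EReal)) (𝓝[≠] 0) (𝓝 L) := by
  -- The mean value theorem between 0 and s uses derivatives only at interior points, never at 0,
  -- where none need exist.
  have hex : ∀ s : ℝ, s ≠ 0 → ∃ x, x ≠ 0 ∧ |x| ≤ |s| ∧ g x = (m s - m 0) / (s - 0) := by
    intro s hs
    rcases lt_or_gt_of_ne hs with h | h
    · obtain ⟨x, hx, he⟩ := exists_hasDerivAt_eq_slope m g h hm.continuousOn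
        fun x hx => hd x hx.2.ne
      refine ⟨x, hx.2.ne, ?_, ?_⟩
      · rw [abs_of_neg hx.2, abs_of_neg h]; linarith [hx.1]
      · rw [he, ← neg_div_neg_eq]; congr 1 <;> ring
    · obtain ⟨x, hx, he⟩ := exists_hasDerivAt_eq_slope m g h hm.continuousOn
        fun x hx => hd x hx.1.ne'
      refine ⟨x, hx.1.ne', ?_, he⟩
      rw [abs_of_pos hx.1, abs_of_pos h]; exact hx.2.le
  choose! x hx0 hxs hxg using hex
  have hne : ∀ᶠ s : ℝ in 𝓝[≠] 0, s ≠ 0 := eventually_mem_nhdsWithin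
  have hx : Tendsto x (𝓝[≠] 0) (𝓝[≠] 0) := by
    refine tendsto_nhdsWithin_iff.2 ⟨?_, hne.mono fun s hs => hx0 s hs⟩
    refine squeeze_zero_norm' (a := fun s : ℝ => |s|) (hne.mono fun s hs => hxs s hs) ?_
    have : Tendsto (fun s : ℝ => |s|) (𝓝 0) (𝓝 |0|) := continuous_abs.tendsto 0
    rw [abs_zero] at this
    exact this.mono_left nhdsWithin_le_nhds
  exact (hg.comp hx).congr' (hne.mono fun s hs => by
    simp only [Function.comp_apply, hxg s hs])

end Slope

/-! ### Continuity in time of masses and varifolds. -/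

section Continuity

variable {p q : ℕ} {t : ℝ}

lemma continuous_flowPos_left (u : ℝ × ℝ) : Continuous fun t => flowPos p q t u :=
  continuous_flowPos.comp (f := fun t : ℝ => (t, u)) (by fun_prop)

lemma continuous_flowSpeed_left (s : ℝ) : Continuous fun t => flowSpeed p q t s :=
  continuous_flowSpeed.comp (f := fun t : ℝ => (t, s)) (by fun_prop)

lemma continuous_flowDensity_left (hq : 0 < q) (hqp : q < p) {s : ℝ} (hs : 0 < s) :
    Continuous fun t => flowDensity p q t s :=
  (continuous_const.mul (continuous_flowEnergy.comp (f := fun t : ℝ => (t, s))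
    (by fun_prop))).div (continuous_flowSpeed_left s) fun _ => (flowSpeed_pos hq hqp hs).ne'

lemma continuous_flowPlane_left (hq : 0 < q) (hqp : q < p) {u : ℝ × ℝ} (hu : 0 < u.1) :
    Continuous fun t => flowPlane p q t u := by
  rw [continuous_iff_continuousAt]
  intro t
  have h1 : Continuous fun t : ℝ => (flowFst p q t u.1, flowSnd p q t u.1, u.2) :=
    (continuous_profile p q).comp (f := fun t : ℝ => (t, u)) (by fun_prop)
  exact ContinuousAt.comp (f := fun t : ℝ => (flowFst p q t u.1, flowSnd p q t u.1, u.2))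
    (continuousAt_planeProj (flowEnergy_pos hq hqp hu).ne') h1.continuousAt

lemma flowDensity_le_of_le (hq : 0 < q) (hqp : q < p) {s T R : ℝ} (hs : 0 < s) (ht : |t| ≤ T)
    (hR : s ≤ R) :
    flowDensity p q t s ≤ √((p : ℝ) * q) * (p + q) * √(R ^ 2 + T / swConst p q) :=
  (flowDensity_le hq hqp hs).trans
    (mul_le_mul_of_nonneg_left (flowSpeed_le hq hqp hs.le ht hR) (by positivity))

/-- The time slices depend continuously on time, as Radon measures on phase space. -/
lemma continuous_integral_flowMeasure (hq : 0 < q) (hqp : q < p)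
    {f : C2 × (C2 →L[ℝ] C2) → ℝ} (hf : Continuous f) {C R : ℝ} (hC : ∀ z, |f z| ≤ C)
    (hR : ∀ z : C2 × (C2 →L[ℝ] C2), R < ‖z.1‖ → f z = 0) :
    Continuous fun t => ∫ z, f z ∂flowMeasure p q t := by
  simp only [integral_flowMeasure _ hf.measurable]
  have hm : ∀ t, Measurable fun u => f (flowPos p q t u, flowPlane p q t u) := fun t =>
    hf.measurable.comp (f := fun u => (flowPos p q t u, flowPlane p q t u)) (measurable_flowMap t)
  have hd : ∀ t, Measurable fun u : ℝ × ℝ => flowDensity p q t u.1 := fun t =>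
    (measurable_flowDensity t).comp measurable_fst
  refine continuous_setIntegral_openStrip (fun t => ?_) (fun T => ?_) fun u hu => ?_
  · exact ((hd t).mul (hm t)).aestronglyMeasurable
  · refine ⟨√((p : ℝ) * q) * (p + q) * √(R ^ 2 + T / swConst p q) * C, R, fun t ht u hu => ?_⟩
    have hz : R < u.1 → flowDensity p q t u.1 * f (flowPos p q t u, flowPlane p q t u) = 0 :=
      fun h => by
        rw [hR (flowPos p q t u, flowPlane p q t u) (h.trans_le (le_norm_flowPos hq u)), mul_zero]
    refine ⟨?_, hz⟩
    have hC0 : 0 ≤ C := (abs_nonneg _).trans (hC 0)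
    by_cases h : u.1 ≤ R
    · rw [abs_mul, abs_of_nonneg flowDensity_nonneg]
      exact mul_le_mul (flowDensity_le_of_le hq hqp hu.1 ht h) (hC _) (abs_nonneg _)
        (by positivity)
    · rw [hz (not_le.1 h), abs_zero]
      positivity
  · exact (continuous_flowDensity_left hq hqp hu.1).mul
      (hf.comp (f := fun t => (flowPos p q t u, flowPlane p q t u))
        ((continuous_flowPos_left u).prodMk (continuous_flowPlane_left hq hqp hu.1)))

lemma mass_flowVarifold (hq : 0 < q) (hqp : q < p) {φ : C2 → ℝ} (hφ : Continuous φ) (t : ℝ) :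
    (flowVarifold hq hqp t).mass φ = ∫ z, φ z.1 ∂flowMeasure p q t := by
  rw [Varifold.mass, integral_weight hq hqp t hφ.measurable,
    integral_flowMeasure t (f := fun z => φ z.1) (hφ.measurable.comp measurable_fst)]

lemma continuous_mass (hq : 0 < q) (hqp : q < p) {φ : C2 → ℝ} (hφ : Continuous φ)
    (hs : HasCompactSupport φ) : Continuous fun t => (flowVarifold hq hqp t).mass φ := by
  obtain ⟨C, R, -, hC, hR⟩ := exists_bound_of_hasCompactSupport hφ hs
  simp only [mass_flowVarifold hq hqp hφ]
  exact continuous_integral_flowMeasure hq hqp (hφ.comp continuous_fst) (fun z => hC z.1)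
    fun z => hR z.1

lemma tendsto_flowVarifold (hq : 0 < q) (hqp : q < p) (t : ℝ) :
    VarifoldTendsto (flowVarifold hq hqp) (𝓝 t) (flowVarifold hq hqp t) := by
  intro f hf hs
  obtain ⟨C, hC⟩ := hs.exists_bound_of_continuous hf
  obtain ⟨R, hR⟩ := hs.isCompact.isBounded.subset_closedBall 0
  refine (continuous_integral_flowMeasure hq hqp hf hC (R := R) fun z hz => ?_).tendsto t
  by_contra h
  have h1 := mem_closedBall_zero_iff.1 (hR (subset_tsupport f h))
  exact absurd ((norm_fst_le z).trans h1) hz.not_ge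

end Continuity

/-! ### Dilations of the slices and the position vector field. -/

section Derivative

variable {p q : ℕ} {t : ℝ}

/-- The time slices are dilations of each other. -/
lemma mass_flowVarifold_dilation (hq : 0 < q) (hqp : q < p) {φ : C2 → ℝ} (hφ : Continuous φ)
    (t : ℝ) {l : ℝ} (hl : 0 < l) :
    (flowVarifold hq hqp (l ^ 2 * t)).mass φ =
      l ^ 2 * ∫ u in openStrip, flowDensity p q t u.1 * φ (l • flowPos p q t u) := by
  have hl2 : 0 ≤ l ^ 2 := sq_nonneg l
  have hmax : ∀ a : ℝ, max (l ^ 2 * a) 0 = l ^ 2 * max a 0 := fun a => by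
    rw [mul_max_of_nonneg _ _ hl2, mul_zero]
  -- Under (t, s) ↦ (l²t, ls) the profile and the speed are homogeneous of degree one, so the
  -- density is too; ds supplies the second factor l of the area.
  have e1 : ∀ s, flowFst p q (l ^ 2 * t) (l * s) = l * flowFst p q t s := by
    intro s
    rw [flowFst, ← mul_neg, mul_div_assoc, mul_pow, hmax, ← mul_add, Real.sqrt_mul hl2,
      Real.sqrt_sq hl.le, flowFst]
  have e2 : ∀ s, flowSnd p q (l ^ 2 * t) (l * s) = l * flowSnd p q t s := by
    intro s
    rw [flowSnd, mul_div_assoc, mul_pow, hmax, ← mul_add, Real.sqrt_mul hl2,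
      Real.sqrt_sq hl.le, flowSnd]
  have e3 : ∀ s, flowSpeed p q (l ^ 2 * t) (l * s) = l * flowSpeed p q t s := by
    intro s
    rw [flowSpeed, abs_mul, abs_of_nonneg hl2, mul_div_assoc, mul_pow, ← mul_add,
      Real.sqrt_mul hl2, Real.sqrt_sq hl.le, flowSpeed]
  have e4 : ∀ u : ℝ × ℝ, flowPos p q (l ^ 2 * t) (l * u.1, u.2) = l • flowPos p q t u := by
    intro u
    rw [flowPos, e1, e2, flowPos, smul_pos]
  have e5 : ∀ s, l * flowDensity p q (l ^ 2 * t) (l * s) = l ^ 2 * flowDensity p q t s := by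
    intro s
    rw [flowDensity, flowDensity, flowEnergy, flowEnergy, energy, energy, e1, e2, e3]
    field_simp
  have hmap := map_flowArea (p := p) (q := q) (t := l ^ 2 * t) (s := fun r => l * r)
    (s' := fun _ => l) (measurable_const.mul measurable_id) measurable_const
    (fun r _ => by simpa using (hasDerivAt_id r).const_mul l) (fun _ _ => hl.le)
    (fun r _ r' _ h => mul_left_cancel₀ hl.ne' h) (by
      ext x
      constructor
      · rintro ⟨r, hr, rfl⟩
        exact mul_pos hl hr
      · exact fun hx => ⟨x / l, div_pos hx hl, mul_div_cancel₀ _ hl.ne'⟩)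
  have hm : Measurable fun u : ℝ × ℝ => (l * u.1, u.2) :=
    (measurable_fst.const_mul l).prodMk measurable_snd
  have hcont := hφ.comp (continuous_flowPos_right (p := p) (q := q) (l ^ 2 * t))
  rw [Varifold.mass, weight_flowVarifold,
    integral_map (continuous_flowPos_right _).measurable.aemeasurable
      hφ.measurable.aestronglyMeasurable, ← hmap,
    integral_map (f := fun u => φ (flowPos p q (l ^ 2 * t) u)) hm.aemeasurable
      hcont.measurable.aestronglyMeasurable]
  simp only [e4, e5]
  rw [integral_withDensity_eq_integral_toReal_smul _
    (Eventually.of_forall fun _ => ENNReal.ofReal_lt_top), ← integral_const_mul]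
  · refine integral_congr_ae (Eventually.of_forall fun u => ?_)
    simp only
    rw [ENNReal.toReal_ofReal (mul_nonneg hl2 flowDensity_nonneg), smul_eq_mul, mul_assoc]
  · exact (((measurable_flowDensity t).comp measurable_fst).const_mul _).ennreal_ofReal

/-- The derivative of the mass under dilations. -/
lemma hasDerivAt_integral_dilation (hq : 0 < q) (hqp : q < p) {φ : C2 → ℝ} (hφ : ContDiff ℝ 1 φ)
    (hs : HasCompactSupport φ) (t : ℝ) :
    IntegrableOn (fun u => flowDensity p q t u.1 *
      fderiv ℝ φ (flowPos p q t u) (flowPos p q t u)) openStrip ∧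
    HasDerivAt (fun l : ℝ => ∫ u in openStrip, flowDensity p q t u.1 * φ (l • flowPos p q t u))
      (∫ u in openStrip, flowDensity p q t u.1 *
        fderiv ℝ φ (flowPos p q t u) (flowPos p q t u)) 1 := by
  obtain ⟨C₁, R₁, hC₁, hb₁, hz₁⟩ := exists_bound_of_hasCompactSupport hφ.continuous hs
  obtain ⟨C₂, R₂, hC₂, hb₂, hz₂⟩ := exists_bound_of_hasCompactSupport
    (hφ.continuous_fderiv one_ne_zero) (hs.fderiv ℝ)
  have hd : Measurable fun u : ℝ × ℝ => flowDensity p q t u.1 :=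
    (measurable_flowDensity t).comp measurable_fst
  have hpos := continuous_flowPos_right (p := p) (q := q) t
  set K := √((2 * R₂) ^ 2 + |t| / swConst p q)
  set B := √((p : ℝ) * q) * (p + q) * K * (C₂ * (√((p : ℝ) + q) * K))
  have hmF : ∀ l : ℝ, AEStronglyMeasurable (fun u => flowDensity p q t u.1 *
      φ (l • flowPos p q t u)) (volume.restrict openStrip) := fun l =>
    (hd.mul (hφ.continuous.comp (hpos.const_smul l)).measurable).aestronglyMeasurable
  have hmF' : ∀ l : ℝ, AEStronglyMeasurable (fun u => flowDensity p q t u.1 *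
      fderiv ℝ φ (l • flowPos p q t u) (flowPos p q t u)) (volume.restrict openStrip) := fun l =>
    (hd.mul (((hφ.continuous_fderiv one_ne_zero).comp (hpos.const_smul l)).clm_apply
      hpos).measurable).aestronglyMeasurable
  have hi : IntegrableOn (fun u => flowDensity p q t u.1 * φ ((1 : ℝ) • flowPos p q t u))
      openStrip := by
    refine integrableOn_openStrip (C := √((p : ℝ) * q) * (p + q) *
      √(R₁ ^ 2 + |t| / swConst p q) * C₁) (R := R₁) (hmF 1) (fun u hu => ?_) fun u hu hR => ?_
    · by_cases h : u.1 ≤ R₁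
      · rw [abs_mul, abs_of_nonneg flowDensity_nonneg]
        exact mul_le_mul (flowDensity_le_of_le hq hqp hu.1 le_rfl h) (hb₁ _) (abs_nonneg _)
          (by positivity)
      · rw [one_smul, hz₁ _ ((not_le.1 h).trans_le (le_norm_flowPos hq u)), mul_zero, abs_zero]
        positivity
    · rw [one_smul, hz₁ _ (hR.trans_le (le_norm_flowPos hq u)), mul_zero]
  -- For l > 1/2 the derivative of φ at lx vanishes once |x| > 2R₂, which makes the bound uniform in
  -- l.
  have hbound : ∀ᵐ u ∂(volume : Measure (ℝ × ℝ)).restrict openStrip, ∀ l ∈ Ioo (1 / 2 : ℝ) 2,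
      ‖flowDensity p q t u.1 * fderiv ℝ φ (l • flowPos p q t u) (flowPos p q t u)‖ ≤
        stripBound B (2 * R₂) u := by
    refine (ae_restrict_mem measurableSet_openStrip).mono fun u hu l hl => ?_
    have hz : 2 * R₂ < u.1 →
        flowDensity p q t u.1 * fderiv ℝ φ (l • flowPos p q t u) (flowPos p q t u) = 0 := by
      intro h
      have h1 := h.trans_le (le_norm_flowPos (t := t) hq u (p := p))
      have h0 := norm_nonneg (flowPos p q t u)
      have h2 : R₂ < ‖l • flowPos p q t u‖ := by
        rw [norm_smul, Real.norm_eq_abs, abs_of_pos (by linarith [hl.1])]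
        nlinarith [hl.1]
      rw [hz₂ _ h2, zero_apply, mul_zero]
    refine norm_le_stripBound ?_ hz
    by_cases h : u.1 ≤ 2 * R₂
    · rw [abs_mul, abs_of_nonneg flowDensity_nonneg]
      refine mul_le_mul (flowDensity_le_of_le hq hqp hu.1 le_rfl h) ?_ (abs_nonneg _)
        (by positivity)
      refine (ContinuousLinearMap.le_opNorm _ _).trans
        (mul_le_mul (hb₂ _) ((norm_flowPos_le hq hqp u).trans ?_) (norm_nonneg _) hC₂)
      exact mul_le_mul_of_nonneg_left (flowSpeed_le hq hqp hu.1.le le_rfl h) (Real.sqrt_nonneg _)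
    · rw [hz (not_le.1 h), abs_zero]
      positivity
  have key := hasDerivAt_integral_of_dominated_loc_of_deriv_le (𝕜 := ℝ)
    (μ := (volume : Measure (ℝ × ℝ)).restrict openStrip) (x₀ := 1) (s := Ioo (1 / 2) 2)
    (F := fun l u => flowDensity p q t u.1 * φ (l • flowPos p q t u))
    (F' := fun l u => flowDensity p q t u.1 * fderiv ℝ φ (l • flowPos p q t u) (flowPos p q t u))
    (Ioo_mem_nhds (by norm_num) (by norm_num)) (Eventually.of_forall hmF) hi (hmF' 1) hbound
    (integrableOn_stripBound _ _) (Eventually.of_forall fun u l _ => by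
      have h1 : HasDerivAt (fun l : ℝ => l • flowPos p q t u) (flowPos p q t u) l := by
        simpa using (hasDerivAt_id l).smul_const (flowPos p q t u)
      exact ((hφ.differentiable one_ne_zero _).hasFDerivAt.comp_hasDerivAt l h1).const_mul _)
  simp only [one_smul] at key
  exact key

/-- `δ(V_t, φ)(h)` as a real number; meaningful if `φ |h|²` is integrable. -/
def massRate (p q : ℕ) (φ : C2 → ℝ) (t : ℝ) : ℝ :=
  -(∫ u in openStrip, flowDensity p q t u.1 *
      (φ (flowPos p q t u) * ‖curvatureField p q (flowPos p q t u)‖ ^ 2)) +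
    ∫ u in openStrip, flowDensity p q t u.1 *
      fderiv ℝ φ (flowPos p q t u) (curvatureField p q (flowPos p q t u))

/-- The position is 2t h plus a tangent vector, and h is normal. -/
lemma inner_curvatureField_flowPos (hq : 0 < q) (hqp : q < p) {u : ℝ × ℝ} (hu : 0 < u.1) :
    inner ℝ (curvatureField p q (flowPos p q t u)) (flowPos p q t u) =
      2 * t * ‖curvatureField p q (flowPos p q t u)‖ ^ 2 := by
  have hp := hq.trans hqp
  have hE := (flowEnergy_pos (t := t) hq hqp hu).ne'
  have h1 := pos_sub_planeProj_pos u.2 hq hqp hE (flow_sq_sub (p := p) (q := q))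
  have h2 := planeProj_curvatureField (f := flowFst p q t u.1) (g := flowSnd p q t u.1) u.2 hp hq
  rw [planeProj_eq_starProjection u.2 hp hq hE one_ne_zero] at h1 h2
  rw [sub_eq_iff_eq_add] at h1
  change flowPos p q t u = (2 * t) • curvatureField p q (flowPos p q t u) + _ at h1
  change Submodule.starProjection _ (curvatureField p q (flowPos p q t u)) = 0 at h2
  nth_rw 2 [h1]
  rw [inner_add_right, ← Submodule.inner_starProjection_left_eq_right, h2, inner_zero_left,
    inner_smul_right, real_inner_self_eq_norm_sq, add_zero]

/-- On a 2-plane P, div_P(φx) = 2φ + Dφ(Px), and self-similarity gives Px = x − 2t h. -/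
lemma trace_smul_position (hq : 0 < q) (hqp : q < p) {φ : C2 → ℝ} (hφ : ContDiff ℝ 1 φ)
    {u : ℝ × ℝ} (hu : 0 < u.1) :
    LinearMap.trace ℝ C2 ((flowPlane p q t u ∘L fderiv ℝ (fun x => φ x • x) (flowPos p q t u) :
      C2 →L[ℝ] C2) : C2 →ₗ[ℝ] C2) =
      2 * φ (flowPos p q t u) + fderiv ℝ φ (flowPos p q t u) (flowPos p q t u) -
        2 * t * fderiv ℝ φ (flowPos p q t u) (curvatureField p q (flowPos p q t u)) := by
  have hp := hq.trans hqp
  have hp' : (p : ℝ) ≠ 0 := by exact_mod_cast hp.ne'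
  have hq' : (q : ℝ) ≠ 0 := by exact_mod_cast hq.ne'
  have hE := (flowEnergy_pos (t := t) hq hqp hu).ne'
  have h1 := pos_sub_planeProj_pos u.2 hq hqp hE (flow_sq_sub (p := p) (q := q))
  change flowPos p q t u - flowPlane p q t u (flowPos p q t u) =
    (2 * t) • curvatureField p q (flowPos p q t u) at h1
  have h2 := congrArg (fderiv ℝ φ (flowPos p q t u)) h1
  rw [map_sub, map_smul, smul_eq_mul, flowPlane, planeProj_apply] at h2
  have hd : fderiv ℝ (fun x => φ x • x) (flowPos p q t u) =
      φ (flowPos p q t u) • ContinuousLinearMap.id ℝ C2 +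
        (fderiv ℝ φ (flowPos p q t u)).smulRight (flowPos p q t u) :=
    ((hφ.differentiable one_ne_zero _).hasFDerivAt.smul (hasFDerivAt_id _)).fderiv
  rw [hd, flowPlane, trace_planeProj_comp]
  have hr := inner_radial_radial (p := p) (q := q) (flowFst p q t u.1) (flowSnd p q t u.1) u.2
  have ha := inner_angular_angular (p := p) (q := q) (flowFst p q t u.1) (flowSnd p q t u.1) u.2
  simp only [map_add, map_smul, smul_eq_mul] at h2
  simp only [add_apply, smul_apply,
    ContinuousLinearMap.id_apply, ContinuousLinearMap.smulRight_apply, inner_add_right,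
    inner_smul_right, hr, ha]
  have h3 : (energy p q (flowFst p q t u.1) (flowSnd p q t u.1))⁻¹ *
    energy p q (flowFst p q t u.1) (flowSnd p q t u.1) = 1 := inv_mul_cancel₀ hE
  have h4 : ((p : ℝ) * q)⁻¹ * (p * q) = 1 := inv_mul_cancel₀ (mul_ne_zero hp' hq')
  linear_combination -h2 + (φ (flowPos p q t u) * (1 + ((p : ℝ) * q)⁻¹ * (p * q))) * h3 +
    φ (flowPos p q t u) * h4

end Derivative

/-! ### The rate of change of mass away from time zero. -/

section Rate

variable {p q : ℕ} {t : ℝ} {φ : C2 → ℝ}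

/-- The integrand of `∫ φ |h|² d‖V_t‖` in the common parametrization. -/
def dissipation (p q : ℕ) (φ : C2 → ℝ) (t : ℝ) (u : ℝ × ℝ) : ℝ :=
  flowDensity p q t u.1 *
    (φ (flowPos p q t u) * ‖curvatureField p q (flowPos p q t u)‖ ^ 2)

/-- The integrand of `∫ Dφ · h d‖V_t‖` in the common parametrization. -/
def transport (p q : ℕ) (φ : C2 → ℝ) (t : ℝ) (u : ℝ × ℝ) : ℝ :=
  flowDensity p q t u.1 * fderiv ℝ φ (flowPos p q t u) (curvatureField p q (flowPos p q t u))

lemma dissipation_eq (hq : 0 < q) (hqp : q < p) {u : ℝ × ℝ} (hu : 0 < u.1) :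
    dissipation p q φ t u = ((p : ℝ) - q) ^ 2 / √((p : ℝ) * q) *
      (φ (flowPos p q t u) / flowSpeed p q t u.1) := by
  rw [dissipation, mul_left_comm, flowDensity_mul_norm_sq hq hqp hu]
  ring

lemma measurable_dissipation (hφ : Continuous φ) (t : ℝ) : Measurable (dissipation p q φ t) := by
  have hpos := continuous_flowPos_right (p := p) (q := q) t
  exact ((measurable_flowDensity t).comp measurable_fst).mul
    ((hφ.comp hpos).measurable.mul ((measurable_curvatureField.comp hpos.measurable).norm.pow_const
      2))

lemma measurable_transport (hφ : ContDiff ℝ 1 φ) (t : ℝ) : Measurable (transport p q φ t) := by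
  have hpos := continuous_flowPos_right (p := p) (q := q) t
  have h1 : Measurable fun u => fderiv ℝ φ (flowPos p q t u) :=
    ((hφ.continuous_fderiv one_ne_zero).comp hpos).measurable
  have h2 : Measurable fun u => curvatureField p q (flowPos p q t u) :=
    measurable_curvatureField.comp hpos.measurable
  have h3 : Measurable fun u => fderiv ℝ φ (flowPos p q t u)
      (curvatureField p q (flowPos p q t u)) :=
    (isBoundedBilinearMap_apply (𝕜 := ℝ) (E := C2) (F := ℝ)).continuous.measurable.comp
      (h1.prodMk h2)
  exact ((measurable_flowDensity t).comp measurable_fst).mul h3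

lemma continuous_dissipation_left (hq : 0 < q) (hqp : q < p) (hφ : Continuous φ) {u : ℝ × ℝ}
    (hu : 0 < u.1) : Continuous fun t => dissipation p q φ t u := by
  simp only [dissipation_eq hq hqp hu]
  exact continuous_const.mul ((hφ.comp (continuous_flowPos_left u)).div
    (continuous_flowSpeed_left u.1) fun _ => (flowSpeed_pos hq hqp hu).ne')

lemma continuous_curvatureField_flowPos_left (hq : 0 < q) (hqp : q < p) {u : ℝ × ℝ}
    (hu : 0 < u.1) : Continuous fun t => curvatureField p q (flowPos p q t u) := by
  have h1 : Continuous fun t => flowFst p q t u.1 :=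
    continuous_flowFst.comp (f := fun t : ℝ => (t, u.1)) (by fun_prop)
  have h2 : Continuous fun t => flowSnd p q t u.1 :=
    continuous_flowSnd.comp (f := fun t : ℝ => (t, u.1)) (by fun_prop)
  have h3 : Continuous fun t => flowEnergy p q t u.1 :=
    continuous_flowEnergy.comp (f := fun t : ℝ => (t, u.1)) (by fun_prop)
  have h4 : Continuous fun t => (-(flowFst p q t u.1 / q), flowSnd p q t u.1 / p, u.2) := by
    fun_prop
  simp only [flowPos, curvatureField_pos _ (hq.trans hqp) hq]
  exact (continuous_const.mul (h3.inv₀ fun t => (flowEnergy_pos hq hqp hu).ne')).smul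
    ((continuous_pos p q).comp h4)

lemma continuous_transport_left (hq : 0 < q) (hqp : q < p) (hφ : ContDiff ℝ 1 φ) {u : ℝ × ℝ}
    (hu : 0 < u.1) : Continuous fun t => transport p q φ t u :=
  (continuous_flowDensity_left hq hqp hu).mul
    (((hφ.continuous_fderiv one_ne_zero).comp (continuous_flowPos_left u)).clm_apply
      (continuous_curvatureField_flowPos_left hq hqp hu))

/-- Only the first power of |h| enters, so the bound is independent of t and this term stays
continuous through t = 0. -/
lemma exists_bound_transport (hq : 0 < q) (hqp : q < p) (hφ : ContDiff ℝ 1 φ)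
    (hs : HasCompactSupport φ) : ∃ C R : ℝ, ∀ t, ∀ u ∈ openStrip,
      |transport p q φ t u| ≤ C ∧ (R < u.1 → transport p q φ t u = 0) := by
  obtain ⟨C, R, hC, hb, hz⟩ := exists_bound_of_hasCompactSupport
    (hφ.continuous_fderiv one_ne_zero) (hs.fderiv ℝ)
  refine ⟨((p : ℝ) - q) * √((p : ℝ) + q) * C, R, fun t u hu => ⟨?_, fun hR => ?_⟩⟩
  · rw [transport, abs_mul, abs_of_nonneg flowDensity_nonneg]
    calc _ ≤ flowDensity p q t u.1 * (C * ‖curvatureField p q (flowPos p q t u)‖) := by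
          refine mul_le_mul_of_nonneg_left ?_ flowDensity_nonneg
          exact (ContinuousLinearMap.le_opNorm _ _).trans 
            (mul_le_mul_of_nonneg_right (hb _) (norm_nonneg _))
      _ = flowDensity p q t u.1 * ‖curvatureField p q (flowPos p q t u)‖ * C := by ring
      _ ≤ _ := mul_le_mul_of_nonneg_right (flowDensity_mul_norm_le hq hqp hu.1) hC
  · rw [transport, hz _ (hR.trans_le (le_norm_flowPos hq u)), zero_apply, mul_zero]

/-- Since φ is Lipschitz and vanishes at the origin, φ is at most a constant times the distance to
the origin, hence O(k) on the slice, which compensates the factor 1/k uniformly in t. -/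
lemma exists_bound_dissipation (hq : 0 < q) (hqp : q < p) (hφ : ContDiff ℝ 1 φ)
    (hs : HasCompactSupport φ) (h0 : φ 0 = 0) : ∃ C R : ℝ, ∀ t, ∀ u ∈ openStrip,
      |dissipation p q φ t u| ≤ C ∧ (R < u.1 → dissipation p q φ t u = 0) := by
  obtain ⟨C, -, hC, hb, -⟩ := exists_bound_of_hasCompactSupport
    (hφ.continuous_fderiv one_ne_zero) (hs.fderiv ℝ)
  obtain ⟨-, R, -, -, hz⟩ := exists_bound_of_hasCompactSupport hφ.continuous hs
  have hlip : ∀ x, |φ x| ≤ C * ‖x‖ := fun x => by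
    have := convex_univ.norm_image_sub_le_of_norm_fderiv_le (𝕜 := ℝ) (f := φ) (x := 0) (y := x)
      (fun y _ => hφ.differentiable one_ne_zero y) (fun y _ => hb y) (mem_univ _) (mem_univ _)
    simpa [h0] using this
  refine ⟨((p : ℝ) - q) ^ 2 / √((p : ℝ) * q) * (C * √((p : ℝ) + q)), R,
    fun t u hu => ⟨?_, fun hR => ?_⟩⟩
  · have hk := flowSpeed_pos (t := t) hq hqp hu.1
    rw [dissipation_eq hq hqp hu.1, abs_mul, abs_of_nonneg (by positivity), abs_div,
      abs_of_pos hk]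
    refine mul_le_mul_of_nonneg_left ?_ (by positivity)
    rw [div_le_iff₀ hk, mul_assoc]
    exact (hlip _).trans (mul_le_mul_of_nonneg_left (norm_flowPos_le hq hqp u) hC)
  · rw [dissipation, hz _ (hR.trans_le (le_norm_flowPos hq u)), zero_mul, mul_zero]

lemma integrableOn_transport (hq : 0 < q) (hqp : q < p) (hφ : ContDiff ℝ 1 φ)
    (hs : HasCompactSupport φ) (t : ℝ) : IntegrableOn (transport p q φ t) openStrip := by
  obtain ⟨C, R, h⟩ := exists_bound_transport hq hqp hφ hs
  exact integrableOn_openStrip (measurable_transport hφ t).aestronglyMeasurable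
    (fun u hu => (h t u hu).1) fun u hu => (h t u hu).2

/-- The singular factor is 1/k. Either k ≥ √(|t|/c) > 0, or the vanishing of φ at the vertex absorbs
it. -/
lemma integrableOn_dissipation (hq : 0 < q) (hqp : q < p) (hφ : ContDiff ℝ 1 φ)
    (hs : HasCompactSupport φ) (h : t ≠ 0 ∨ φ 0 = 0) :
    IntegrableOn (dissipation p q φ t) openStrip := by
  have hm := (measurable_dissipation (p := p) (q := q) hφ.continuous t).aestronglyMeasurable
    (μ := (volume : Measure (ℝ × ℝ)).restrict openStrip)
  rcases h with ht | h0
  · obtain ⟨C, R, hC, hb, hz⟩ := exists_bound_of_hasCompactSupport hφ.continuous hs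
    have hc := swConst_pos hq hqp
    have hpos : 0 < √(|t| / swConst p q) := Real.sqrt_pos.2 (by positivity)
    refine integrableOn_openStrip
      (C := ((p : ℝ) - q) ^ 2 / √((p : ℝ) * q) * (C / √(|t| / swConst p q))) (R := R) hm
      (fun u hu => ?_) fun u hu hR => ?_
    · have hk := flowSpeed_pos (t := t) hq hqp hu.1
      have hle : √(|t| / swConst p q) ≤ flowSpeed p q t u.1 :=
        Real.sqrt_le_sqrt (le_add_of_nonneg_left (sq_nonneg _))
      rw [dissipation_eq hq hqp hu.1, abs_mul, abs_of_nonneg (by positivity), abs_div,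
        abs_of_pos hk]
      refine mul_le_mul_of_nonneg_left ?_ (by positivity)
      exact div_le_div₀ hC (hb _) hpos hle
    · rw [dissipation, hz _ (hR.trans_le (le_norm_flowPos hq u)), zero_mul, mul_zero]
  · obtain ⟨C, R, h⟩ := exists_bound_dissipation hq hqp hφ hs h0
    exact integrableOn_openStrip hm (fun u hu => (h t u hu).1) fun u hu => (h t u hu).2

lemma massRate_eq (t : ℝ) : massRate p q φ t =
    -(∫ u in openStrip, dissipation p q φ t u) + ∫ u in openStrip, transport p q φ t u := rfl

lemma continuous_integral_transport (hq : 0 < q) (hqp : q < p) (hφ : ContDiff ℝ 1 φ)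
    (hs : HasCompactSupport φ) : Continuous fun t => ∫ u in openStrip, transport p q φ t u := by
  obtain ⟨C, R, h⟩ := exists_bound_transport hq hqp hφ hs
  exact continuous_setIntegral_openStrip (fun t => (measurable_transport hφ t).aestronglyMeasurable)
    (fun T => ⟨C, R, fun t _ => h t⟩) fun u hu => continuous_transport_left hq hqp hφ hu.1

lemma continuous_integral_dissipation (hq : 0 < q) (hqp : q < p) (hφ : ContDiff ℝ 1 φ)
    (hs : HasCompactSupport φ) (h0 : φ 0 = 0) :
    Continuous fun t => ∫ u in openStrip, dissipation p q φ t u := by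
  obtain ⟨C, R, h⟩ := exists_bound_dissipation hq hqp hφ hs h0
  exact continuous_setIntegral_openStrip
    (fun t => (measurable_dissipation hφ.continuous t).aestronglyMeasurable)
    (fun T => ⟨C, R, fun t _ => h t⟩)
    fun u hu => continuous_dissipation_left hq hqp hφ.continuous hu.1

lemma integrableOn_flowDensity_mul (hq : 0 < q) (hqp : q < p) (hφ : Continuous φ)
    (hs : HasCompactSupport φ) (t : ℝ) :
    IntegrableOn (fun u => flowDensity p q t u.1 * φ (flowPos p q t u)) openStrip := by
  obtain ⟨C, R, hC, hb, hz⟩ := exists_bound_of_hasCompactSupport hφ hs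
  refine integrableOn_openStrip (C := √((p : ℝ) * q) * (p + q) *
    √(R ^ 2 + |t| / swConst p q) * C) (R := R) ?_ (fun u hu => ?_) fun u hu hR => ?_
  · exact (((measurable_flowDensity t).comp measurable_fst).mul
      (hφ.comp (continuous_flowPos_right t)).measurable).aestronglyMeasurable
  · by_cases h : u.1 ≤ R
    · rw [abs_mul, abs_of_nonneg flowDensity_nonneg]
      exact mul_le_mul (flowDensity_le_of_le hq hqp hu.1 le_rfl h) (hb _) (abs_nonneg _)
        (by positivity)
    · rw [hz _ ((not_le.1 h).trans_le (le_norm_flowPos hq u)), mul_zero, abs_zero]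
      positivity
  · rw [hz _ (hR.trans_le (le_norm_flowPos hq u)), mul_zero]

/-- The first variation along the position vector field. -/
lemma dilation_eq_massRate (hq : 1 < q) (hq0 : 0 < q) (hqp : q < p) (hpq : Nat.Coprime p q)
    (hφ : ContDiff ℝ 1 φ) (hs : HasCompactSupport φ) :
    2 * (∫ u in openStrip, flowDensity p q t u.1 * φ (flowPos p q t u)) +
      (∫ u in openStrip, flowDensity p q t u.1 *
        fderiv ℝ φ (flowPos p q t u) (flowPos p q t u)) = 2 * t * massRate p q φ t := by
  -- The test field φ(x)x generates localized dilations: its divergence yields 2φ + Dφ · x − 2t Dφ ·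
  -- h, and its pairing with h yields 2tφ|h|².
  have hW : ContDiff ℝ 1 fun x => φ x • x := hφ.smul contDiff_id
  have h1 := firstVariation_flowVarifold hq hq0 hqp hpq hW hs.smul_right t
  rw [firstVariation_eq_integral hq0 hqp hW, integral_weight hq0 hqp t
    (measurable_curvatureField.inner hW.continuous.measurable)] at h1
  have e1 : ∀ u ∈ openStrip, flowDensity p q t u.1 * LinearMap.trace ℝ C2
      ((flowPlane p q t u ∘L fderiv ℝ (fun x => φ x • x) (flowPos p q t u) :
        C2 →L[ℝ] C2) : C2 →ₗ[ℝ] C2) =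
      (2 * (flowDensity p q t u.1 * φ (flowPos p q t u)) + flowDensity p q t u.1 *
        fderiv ℝ φ (flowPos p q t u) (flowPos p q t u)) - 2 * t * transport p q φ t u :=
    fun u hu => by rw [trace_smul_position hq0 hqp hφ hu.1, transport]; ring
  have e2 : ∀ u ∈ openStrip, flowDensity p q t u.1 *
      inner ℝ (curvatureField p q (flowPos p q t u)) (φ (flowPos p q t u) • flowPos p q t u) =
      2 * t * dissipation p q φ t u := fun u hu => by
    rw [inner_smul_right, inner_curvatureField_flowPos hq0 hqp hu.1, dissipation]; ring
  have i1 := (integrableOn_flowDensity_mul hq0 hqp hφ.continuous hs t).const_mul 2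
  have i2 := (hasDerivAt_integral_dilation hq0 hqp hφ hs t).1
  have i3 := (integrableOn_transport hq0 hqp hφ hs t).const_mul (2 * t)
  rw [setIntegral_congr_fun measurableSet_openStrip e1,
    setIntegral_congr_fun measurableSet_openStrip e2,
    integral_sub (f := fun u => 2 * (flowDensity p q t u.1 * φ (flowPos p q t u)) +
      flowDensity p q t u.1 * fderiv ℝ φ (flowPos p q t u) (flowPos p q t u)) (i1.add i2) i3,
    integral_add i1 i2, integral_const_mul, integral_const_mul, integral_const_mul] at h1
  rw [massRate_eq]
  linear_combination h1

/-- Away from time zero the masses satisfy the Brakke equality. -/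
lemma hasDerivAt_mass (hq : 1 < q) (hq0 : 0 < q) (hqp : q < p) (hpq : Nat.Coprime p q)
    (hφ : ContDiff ℝ 1 φ) (hs : HasCompactSupport φ) (ht : t ≠ 0) :
    HasDerivAt (fun s => (flowVarifold hq0 hqp s).mass φ) (massRate p q φ t) t := by
  -- The mass at time l²t is l²M(l), so the mass at a time s with s/t > 0 is obtained from l =
  -- √(s/t).
  set M : ℝ → ℝ := fun l => ∫ u in openStrip, flowDensity p q t u.1 * φ (l • flowPos p q t u)
  have hM := (hasDerivAt_integral_dilation hq0 hqp hφ hs t).2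
  have hdiv : HasDerivAt (fun s => s / t) (1 / t) t := (hasDerivAt_id t).div_const t
  have htt : t / t = 1 := div_self ht
  have hsqrt : HasDerivAt (fun s => √(s / t)) (1 / t / (2 * √(t / t))) t :=
    hdiv.sqrt (by rw [htt]; exact one_ne_zero)
  have hM' : HasDerivAt M (∫ u in openStrip, flowDensity p q t u.1 *
      fderiv ℝ φ (flowPos p q t u) (flowPos p q t u)) √(t / t) := by rw [htt, Real.sqrt_one]; exact hM
  have hcomp := hdiv.mul (hM'.comp t hsqrt)
  have hev : (fun s => (flowVarifold hq0 hqp s).mass φ) =ᶠ[𝓝 t]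
      ((fun s => s / t) * (M ∘ fun s => √(s / t))) := by
    have hpos : ∀ᶠ s in 𝓝 t, 0 < s / t :=
      hdiv.continuousAt.eventually_const_lt (by simp only [htt, one_pos])
    filter_upwards [hpos] with s hs'
    have := mass_flowVarifold_dilation hq0 hqp hφ.continuous t (Real.sqrt_pos.2 hs')
    rw [Real.sq_sqrt hs'.le, div_mul_cancel₀ _ ht] at this
    exact this
  refine (hcomp.congr_of_eventuallyEq hev).congr_deriv ?_
  have hd := dilation_eq_massRate (t := t) hq hq0 hqp hpq hφ hs
  simp only [Function.comp_apply, htt, Real.sqrt_one, M, one_smul]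
  field_simp
  linear_combination hd

end Rate

/-! ### Brakke's equality, including the singular time. -/

section Brakke

variable {p q : ℕ} {t : ℝ} {φ : C2 → ℝ}

lemma lintegral_dissipation (hq : 0 < q) (hqp : q < p) (hφ : Continuous φ) (t : ℝ) :
    ∫⁻ x, ENNReal.ofReal (φ x * ‖curvatureField p q x‖ ^ 2) ∂(flowVarifold hq hqp t).weight =
      ∫⁻ u in openStrip, ENNReal.ofReal (dissipation p q φ t u) := by
  have hm : Measurable fun x => ENNReal.ofReal (φ x * ‖curvatureField p q x‖ ^ 2) :=
    (hφ.measurable.mul (measurable_curvatureField.norm.pow_const 2)).ennreal_ofReal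
  rw [lintegral_weight hq hqp t hm]
  refine lintegral_congr fun u => ?_
  rw [dissipation, ENNReal.ofReal_mul flowDensity_nonneg]

lemma dissipation_nonneg (h0 : ∀ x, 0 ≤ φ x) (u : ℝ × ℝ) : 0 ≤ dissipation p q φ t u :=
  mul_nonneg flowDensity_nonneg (mul_nonneg (h0 _) (sq_nonneg _))

lemma measurable_fderiv_curvatureField (hφ : ContDiff ℝ 1 φ) :
    Measurable fun x => fderiv ℝ φ x (curvatureField p q x) :=
  (isBoundedBilinearMap_apply (𝕜 := ℝ) (E := C2) (F := ℝ)).continuous.measurable.comp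
    ((hφ.continuous_fderiv one_ne_zero).measurable.prodMk measurable_curvatureField)

lemma variationAlong_eq_massRate (hq : 0 < q) (hqp : q < p) (hφ : ContDiff ℝ 1 φ)
    (hs : HasCompactSupport φ) (h0 : ∀ x, 0 ≤ φ x) (h : t ≠ 0 ∨ φ 0 = 0) :
    (flowVarifold hq hqp t).variationAlong φ (curvatureField p q) = (massRate p q φ t : EReal) := by
  have hnn : 0 ≤ ∫ u in openStrip, dissipation p q φ t u :=
    integral_nonneg fun u => dissipation_nonneg h0 u
  rw [Varifold.variationAlong, lintegral_dissipation hq hqp hφ.continuous,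
    ← ofReal_integral_eq_lintegral_ofReal (integrableOn_dissipation hq hqp hφ hs h)
      (Eventually.of_forall fun u => dissipation_nonneg h0 u), EReal.coe_ennreal_ofReal,
    max_eq_left hnn, integral_weight hq hqp t (measurable_fderiv_curvatureField hφ), massRate_eq,
    EReal.coe_add, EReal.coe_neg]
  rfl

lemma lintegral_Ioc_inv {δ : ℝ} (hδ : 0 < δ) : ∫⁻ s in Ioc 0 δ, ENNReal.ofReal s⁻¹ = ⊤ := by
  by_contra h
  have hi : IntegrableOn (fun s : ℝ => s⁻¹) (Ioc 0 δ) := by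
    refine ⟨measurable_inv.aestronglyMeasurable, ?_⟩
    rw [hasFiniteIntegral_iff_ofReal]
    · exact lt_top_iff_ne_top.2 h
    · exact (ae_restrict_mem measurableSet_Ioc).mono fun s hs => inv_nonneg.2 hs.1.le
  have hi' := (intervalIntegrable_iff_integrableOn_Ioc_of_le hδ.le).2 hi
  rcases intervalIntegrable_inv_iff.1 hi' with h | h
  · exact hδ.ne h
  · exact h left_mem_uIcc

/-- The squared mean curvature of the cone is not integrable at the vertex. -/
lemma lintegral_dissipation_zero (hq : 0 < q) (hqp : q < p) (hφ : Continuous φ) (h0 : 0 < φ 0) :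
    ∫⁻ u in openStrip, ENNReal.ofReal (dissipation p q φ 0 u) = ⊤ := by
  have hp' : (0 : ℝ) < p := by exact_mod_cast hq.trans hqp
  have hq' : (0 : ℝ) < q := by exact_mod_cast hq
  have hpq : (0 : ℝ) < p - q := sub_pos.2 (by exact_mod_cast hqp)
  obtain ⟨δ, hδ, hball⟩ := Metric.eventually_nhds_iff.1
    (hφ.continuousAt.eventually_const_lt (half_lt_self h0))
  have hr : 0 < √((p : ℝ) + q) := Real.sqrt_pos.2 (by positivity)
  -- On the cone |x| ≤ √(p + q) s, so s ≤ a keeps x in the δ-ball where φ > φ(0)/2; there the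
  -- integrand is at least κ/s.
  set a : ℝ := δ / √((p : ℝ) + q) / 2
  have ha : 0 < a := by positivity
  set κ : ℝ := ((p : ℝ) - q) ^ 2 / √((p : ℝ) * q) * (φ 0 / 2)
  have hκ : 0 < κ := by
    have : 0 < √((p : ℝ) * q) := Real.sqrt_pos.2 (by positivity)
    positivity
  have hle : ∀ u ∈ Ioc 0 a ×ˢ Ico 0 (2 * Real.pi), ENNReal.ofReal κ * ENNReal.ofReal u.1⁻¹ ≤
      ENNReal.ofReal (dissipation p q φ 0 u) := by
    intro u hu
    have hu0 : 0 < u.1 := hu.1.1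
    have hsp : flowSpeed p q 0 u.1 = u.1 := (flow_zero hu0.le).2.2
    rw [← ENNReal.ofReal_mul hκ.le]
    apply ENNReal.ofReal_le_ofReal
    have hlt : φ 0 / 2 < φ (flowPos p q 0 u) := by
      apply hball
      rw [dist_zero_right]
      have h1 := norm_flowPos_le (t := 0) hq hqp u
      rw [hsp] at h1
      calc ‖flowPos p q 0 u‖ ≤ √((p : ℝ) + q) * a := h1.trans (by gcongr; exact hu.1.2)
        _ = δ / 2 := by simp only [a]; field_simp
        _ < δ := half_lt_self hδ
    rw [dissipation_eq hq hqp hu0, hsp, div_eq_mul_inv (φ _), ← mul_assoc]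
    gcongr
    exact mul_le_mul_of_nonneg_left hlt.le (by positivity)
  rw [eq_top_iff]
  calc (⊤ : ℝ≥0∞) = ∫⁻ u in Ioc 0 a ×ˢ Ico 0 (2 * Real.pi),
        ENNReal.ofReal κ * ENNReal.ofReal u.1⁻¹ := by
        have hm : Measurable fun u : ℝ × ℝ => ENNReal.ofReal κ * ENNReal.ofReal u.1⁻¹ :=
          measurable_const.mul measurable_fst.inv.ennreal_ofReal
        have hm1 : Measurable fun x : ℝ => ENNReal.ofReal x⁻¹ := measurable_inv.ennreal_ofReal
        have hm2 : Measurable fun x : ℝ => ENNReal.ofReal κ * ENNReal.ofReal x⁻¹ :=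
          measurable_const.mul hm1
        rw [Measure.volume_eq_prod, setLIntegral_prod _ hm.aemeasurable]
        simp only [setLIntegral_const]
        rw [lintegral_mul_const _ hm2, lintegral_const_mul _ hm1, lintegral_Ioc_inv ha,
          ENNReal.mul_top (ENNReal.ofReal_pos.2 hκ).ne', ENNReal.top_mul]
        simp [Real.pi_pos]
    _ ≤ ∫⁻ u in Ioc 0 a ×ˢ Ico 0 (2 * Real.pi), ENNReal.ofReal (dissipation p q φ 0 u) :=
        setLIntegral_mono' (measurableSet_Ioc.prod measurableSet_Ico) hle
    _ ≤ _ := lintegral_mono_set (prod_mono Ioc_subset_Ioi_self le_rfl)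

/-- Fatou's lemma: the integrands are nonnegative and converge pointwise to that of the cone, whose
integral is infinite. -/
lemma tendsto_integral_dissipation (hq : 0 < q) (hqp : q < p) (hφ : ContDiff ℝ 1 φ)
    (hs : HasCompactSupport φ) (h0 : ∀ x, 0 ≤ φ x) (hpos : 0 < φ 0) :
    Tendsto (fun t => ∫ u in openStrip, dissipation p q φ t u) (𝓝[≠] 0) atTop := by
  have hfatou : (⊤ : ℝ≥0∞) ≤ liminf (fun t : ℝ => ∫⁻ u in openStrip,
      ENNReal.ofReal (dissipation p q φ t u)) (𝓝[≠] 0) := by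
    refine le_trans ?_ (lintegral_liminf_le fun t =>
      (measurable_dissipation hφ.continuous t).ennreal_ofReal)
    rw [← lintegral_dissipation_zero hq hqp hφ.continuous hpos]
    refine setLIntegral_mono' measurableSet_openStrip fun u hu => ?_
    have h1 : Tendsto (fun t => ENNReal.ofReal (dissipation p q φ t u)) (𝓝[≠] 0)
        (𝓝 (ENNReal.ofReal (dissipation p q φ 0 u))) :=
      ((ENNReal.continuous_ofReal.comp
        (continuous_dissipation_left hq hqp hφ.continuous hu.1)).tendsto 0).mono_left
          nhdsWithin_le_nhds
    exact h1.liminf_eq.ge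
  have htop := tendsto_of_le_liminf_of_limsup_le hfatou le_top
  rw [← ENNReal.tendsto_ofReal_nhds_top]
  refine htop.congr' ?_
  filter_upwards [eventually_mem_nhdsWithin] with t ht
  exact (ofReal_integral_eq_lintegral_ofReal
    (integrableOn_dissipation hq hqp hφ hs (Or.inl ht))
    (Eventually.of_forall fun u => dissipation_nonneg h0 u)).symm

/-- If φ(0) = 0, both integrals are continuous at t = 0. If φ(0) > 0, the dissipation blows up while
the transport term converges, and the cone's own variation is −∞ as well. -/
lemma tendsto_massRate_zero (hq : 0 < q) (hqp : q < p) (hφ : ContDiff ℝ 1 φ)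
    (hs : HasCompactSupport φ) (h0 : ∀ x, 0 ≤ φ x) :
    Tendsto (fun t => (massRate p q φ t : EReal)) (𝓝[≠] 0)
      (𝓝 ((flowVarifold hq hqp 0).variationAlong φ (curvatureField p q))) := by
  have htr := continuous_integral_transport hq hqp hφ hs
  rcases (h0 0).eq_or_lt with h | h
  · rw [variationAlong_eq_massRate hq hqp hφ hs h0 (Or.inr h.symm)]
    have hc : Continuous fun t => massRate p q φ t :=
      (continuous_integral_dissipation hq hqp hφ hs h.symm).neg.add htr
    exact ((continuous_coe_real_ereal.comp hc).tendsto 0).mono_left nhdsWithin_le_nhds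
  · have hbot : (flowVarifold hq hqp 0).variationAlong φ (curvatureField p q) = ⊥ := by
      rw [Varifold.variationAlong, lintegral_dissipation hq hqp hφ.continuous,
        lintegral_dissipation_zero hq hqp hφ.continuous h]
      simp
    rw [hbot, EReal.tendsto_coe_nhds_bot_iff]
    exact (tendsto_neg_atTop_atBot.comp
      (tendsto_integral_dissipation hq hqp hφ hs h0 h)).atBot_add
        ((htr.tendsto 0).mono_left nhdsWithin_le_nhds)

/-- Brakke's inequality holds with equality, including at the singular time. -/
lemma upperMassDerivative_eq (hq : 1 < q) (hq0 : 0 < q) (hqp : q < p) (hpq : Nat.Coprime p q)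
    (hφ : ContDiff ℝ 1 φ) (hs : HasCompactSupport φ) (h0 : ∀ x, 0 ≤ φ x) (t : ℝ) :
    upperMassDerivative (flowVarifold hq0 hqp) φ t = (flowVarifold hq0 hqp t).brakkeVariation φ := by
  rw [brakkeVariation_eq (isGeneralizedMeanCurvature_flowVarifold hq hq0 hqp hpq t),
    upperMassDerivative]
  by_cases ht : t = 0
  · subst ht
    exact (tendsto_slope_of_tendsto_deriv (continuous_mass hq0 hqp hφ.continuous hs)
      (fun t ht => hasDerivAt_mass hq hq0 hqp hpq hφ hs ht)
      (tendsto_massRate_zero hq0 hqp hφ hs h0)).limsup_eq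
  · rw [variationAlong_eq_massRate hq0 hqp hφ hs h0 (Or.inl ht)]
    have h := hasDerivAt_iff_tendsto_slope.1 (hasDerivAt_mass hq hq0 hqp hpq hφ hs ht)
    refine Tendsto.limsup_eq ((continuous_coe_real_ereal.tendsto _).comp (h.congr fun s => ?_))
    rw [slope_def_field]

end Brakke

end SchoenWolfson

end

/-! ### Assembly of the theorem. -/

theorem theorem1p2 (p q : ℕ) (hq : 1 < q) (hqp : q < p) (hpq : Nat.Coprime p q) :
    ∃ V : ℝ → Varifold 2 C2,
      -- the half-shrinkers and half-expanders form such a motion, with the cone at time zero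
      IsHamStatSelfSimilarEternalBrakkeMotion V (swFlow p q) halfStrip ∧
      IsVarifoldOf (V 0) (swCone p q) halfStrip ∧
      -- convergence to the cone from either direction
      VarifoldTendsto V (𝓝[<] 0) (V 0) ∧
      VarifoldTendsto V (𝓝[>] 0) (V 0) ∧
      -- the generalized mean curvature vector is the usual one
      (∀ t : ℝ, t ≠ 0 → ∃ h : C2 → C2, (V t).IsGeneralizedMeanCurvature h ∧
        ∀ u ∈ halfStrip, h (swFlow p q t u) = meanCurvature (swFlow p q t) u) ∧
      -- the boundary circle gives no contribution to the first variation
      (∀ t : ℝ, t ≠ 0 → ∀ W : C2 → C2, Continuous W →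
        boundaryVariation (swFlow p q t) W = 0) ∧
      -- the sums of roots of unity for the boundary of the shrinker and of the expander
      ∑ k ∈ Finset.range p, Complex.exp (-(2 * Real.pi * Complex.I * q * k / p)) = 0 ∧
      ∑ k ∈ Finset.range q, Complex.exp (2 * Real.pi * Complex.I * p * k / q) = 0 := by
  open SchoenWolfson in
  have hq0 : 0 < q := by omega
  have hp0 : 0 < p := hq0.trans hqp
  have hlim := tendsto_flowVarifold hq0 hqp 0
  have hprof := fun (t : ℝ) (ht : t ≠ 0) => isHyperbolicProfile_hyp (t := t) hq0 hqp ht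
  -- The self-similarity constant of the slice at time t is t itself, so its sign distinguishes
  -- shrinkers from expanders.
  have hself : ∀ t : ℝ, t ≠ 0 → IsHamiltonianStationary (swFlow p q t) halfStrip ∧
      IsSelfSimilar (swFlow p q t) halfStrip t := by
    intro t ht
    rw [swFlow_eq]
    exact ⟨(hprof t ht).isHamiltonianStationary hp0 hq0 _,
      (hprof t ht).isSelfSimilar hq0 hqp (hypFst_sq_sub_hypSnd_sq hq0 hqp t) _⟩
  have hbrakke := fun (t : ℝ) (φ : C2 → ℝ) (hφ : ContDiff ℝ 1 φ) (hs : HasCompactSupport φ)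
    (h0 : ∀ x, 0 ≤ φ x) => upperMassDerivative_eq hq hq0 hqp hpq hφ hs h0 t
  refine ⟨flowVarifold hq0 hqp, ⟨?_, ⟨?_, hbrakke⟩, ?_, ?_, ?_⟩, isVarifoldOf_swCone hq0 hqp hpq,
    fun f hf hs => (hlim f hf hs).mono_left nhdsWithin_le_nhds,
    fun f hf hs => (hlim f hf hs).mono_left nhdsWithin_le_nhds, ?_, ?_, ?_, ?_⟩
  · exact fun t φ hφ hs h0 => (hbrakke t φ hφ hs h0).le
  · exact fun φ hφ hs => continuous_mass hq0 hqp hφ hs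
  · exact fun t ht => isVarifoldOf_swFlow hq0 hqp hpq ht
  · exact fun t ht => ⟨(hself t ht.ne).1, t, ht, (hself t ht.ne).2⟩
  · exact fun t ht => ⟨(hself t ht.ne').1, t, ht, (hself t ht.ne').2⟩
  · intro t ht
    refine ⟨curvatureField p q, isGeneralizedMeanCurvature_flowVarifold hq hq0 hqp hpq t,
      fun u _ => ?_⟩
    rw [swFlow_eq, (hprof t ht).meanCurvature_eq hp0 hq0]
  · intro t ht W hW
    rw [swFlow_eq]
    exact (hprof t ht).boundaryVariation_eq_zero hq hqp hpq (hypFst_mul_hypSnd_zero t) hW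
  -- Complex conjugation supplies the minus sign in the exponent, after p and q exchange roles.
  · have h := congrArg (starRingEnd ℂ) (sum_exp_two_pi_mul_div (hq.trans hqp) hpq.symm)
    rw [map_sum, map_zero] at h
    rw [← h]
    refine Finset.sum_congr rfl fun k _ => ?_
    rw [← Complex.exp_conj]
    congr 1
    have h2 : (starRingEnd ℂ) 2 = 2 := map_ofNat _ 2
    simp [h2]
    ring
  · exact sum_exp_two_pi_mul_div hq hpq
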